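/- **Conventions.** All manifolds, metrics and maps are $C^\infty$. $\mathbf H^n$ is the space of $n$-tuples of quaternions with its Euclidean inner product, and $I,J,K$ are the left multiplications by $i,j,k$. An isometric immersion $L:M^n\to\mathbf H^n$ of a Riemannian $n$-manifold is *Lagrangian* if $I(T_pM),J(T_pM),K(T_pM)$ are orthogonal to $T_pM$ for all $p$ (tangent spaces being identified with their images); $h$ is its second fundamental form, and $p$ is *totally geodesic* if $h_p=0$. $L$ is *$H$-umbilical* if near every point there are a smooth orthonormal frame $e_1,\dots,e_n$ and real functions $\lambda_a,\mu_a$ with $h(e_1,e_1)=\lambda_1Ie_1+\lambda_2Je_1+\lambda_3Ke_1$, and for $j\ge2$ $h(e_1,e_j)=\mu_1Ie_j+\mu_2Je_j+\mu_3Ke_j$, $h(e_j,e_j)=\mu_1Ie_1+\mu_2Je_1+\mu_3Ke_1$, and $h(e_j,e_k)=0$ for distinct $j,k\ge2$. A manifold is *flat* if its curvature tensor vanishes. A *special Legendre curve* is a unit speed curve $z$ in the unit sphere $S^{4n-1}\subset\mathbf H^n$ with $\langle z',iz\rangle=\langle z',jz\rangle=\langle z',kz\rangle=0$ for which there are normal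 fields $P_3,\dots,P_n$ along $z$, parallel in the normal bundle of $z$ in $S^{4n-1}$, such that $z,z',P_3,\dots,P_n$ and their products with $i,j,k$ form an orthonormal frame and $$z''=i\alpha z'+j\beta z'+k\gamma z'-z-\sum_{l=3}^n a_lP_l$$ for some real functions $\alpha,\beta,\gamma,a_l$. **Theorem.** (a) Let $n\ge1$ and let $T\subset\mathbf R\times\mathbf E^{n-1}$ be a simply connected open set with metric $g=f^2dx_1^2+\sum_{j\ge2}dx_j^2$, where $f>0$, $f^2=f_1^2+f_2^2+f_3^2$ for nowhere zero functions $f_1,f_2,f_3$ on $T$ such that each $f/f_a$ is a function of $x_1$ only, and $f=\beta(x_1)+\sum_{j\ge2}\alpha_j(x_1)x_j$. Then there is a Lagrangian isometric immersion $L_f:T\to\mathbf H^n$ without totally geodesic points such that, for $j,k\ge2$, $$h(e_1,e_1)=\lambda_1Ie_1+\lambda_2Je_1+\lambda_3Ke_1,\qquad h(e_1,e_j)=h(e_j,e_k)=0,$$ where $e_1=\frac1f\partial_{x_1}$, $e_j=\partial_{x_j}$, $\lambda_a=1/f_a$. It is unique up to rigid motions $x\mapsto A(x)+c$ of $\mathbf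 H^n$, with $A$ an isometry that is linear over the quaternions and $c$ constant. (b) Let $n\ge3$ and let $L:M^n\to\mathbf H^n$ be a Lagrangian $H$-umbilical isometric immersion of a flat manifold without totally geodesic points. Call a coordinate system $(x_1,\dots,x_n)$ on an open subset $U\subset M$ *adapted* if it maps $U$ onto a simply connected open set $T$, takes the metric to $f^2dx_1^2+\sum_{j\ge2}dx_j^2$ with $f$ (and some $f_1,f_2,f_3,\beta,\alpha_j$) as in (a), and if for some unit quaternion $q$ the map $qL$ (that is, $L$ followed by the rigid motion $x\mapsto qx$ of $\mathbf H^n$) is, in these coordinates, an immersion $L_f$ as in (a). Then every $p\in M$ lies in the domain of adapted coordinates in which $p$ is the origin. One may take $q=1$ if $\lambda_1,\lambda_2,\lambda_3$ are all nonzero at $p$; and the coordinates can be chosen so that, if $\alpha_j(0)\ne0$ for some $j$, then $\alpha_2>0$ on the whole coordinate domain. Moreover, in any adapted coordinates: (i) If $\alpha_2=\dots=\alpha_n=0$, i.e. $f$ depends on $x_1$ only, then $L=D(x_1)+\sum_{j\ge2}c_jx_j$ for a smooth curve $D$ and constant vectors $c_j$; this is a Lagrangian cylinder: the $c_j$ are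 orthonormal, $\langle ic_j,c_k\rangle=\langle jc_j,c_k\rangle=\langle kc_j,c_k\rangle=0$, and $D'$ is orthogonal to $c_j,ic_j,jc_j,kc_j$. (ii) If $\alpha_2$ has no zero, then for every value $o$ of $x_1$ the functions $t=\int_o^{x_1}\alpha_2(x)\,dx$, $u_j=x_j$ $(j\ge2)$ are coordinates on the same domain, in which $g=\tilde f^2dt^2+\sum_{j\ge2}du_j^2$ with $\tilde f=b(t)+u_2+\sum_{j\ge3}a_j(t)u_j$ for smooth $b,a_j$, and, for a constant $c\in\mathbf H^n$, $$L=u_2z(t)+\sum_{j=3}^nu_jP_j(t)+\int_0^tb(s)z'(s)\,ds+c,$$ where $z$ is a special Legendre curve in $S^{4n-1}$ and $P_3,\dots,P_n$ are normal fields along it as in the definition above. -/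

import Mathlib

open Set Topology MeasureTheory
open scoped Manifold ContDiff Quaternion InnerProductSpace

noncomputable section

/-! ## The quaternionic space and its complex structures -/

/-- `ℍⁿ` with its Euclidean inner product; quaternions act by left multiplication. -/
abbrev Hn (n : ℕ) : Type := PiLp 2 (fun _ : Fin n => ℍ[ℝ])

/-- Euclidean `n`-space. -/
abbrev En (n : ℕ) : Type := EuclideanSpace ℝ (Fin n)

/-- The imaginary units `i, j, k`; left multiplication by them gives `I, J, K` on `ℍⁿ`. -/
def imUnit : Fin 3 → ℍ[ℝ] := ![⟨0, 1, 0, 0⟩, ⟨0, 0, 1, 0⟩, ⟨0, 0, 0, 1⟩]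

/-- The real basis `1, i, j, k` of the quaternions. -/
def quatBasis : Fin 4 → ℍ[ℝ] :=
  ![⟨1, 0, 0, 0⟩, ⟨0, 1, 0, 0⟩, ⟨0, 0, 1, 0⟩, ⟨0, 0, 0, 1⟩]

/-! ## Submanifold geometry of maps from a Euclidean domain to `ℍⁿ` -/

/-- The `i`-th coordinate vector of `ℝⁿ`. -/
abbrev coordVec {n : ℕ} (i : Fin n) : En n := EuclideanSpace.single i (1 : ℝ)

/-- The second fundamental form of an immersion `F` of an open piece of `ℝⁿ` at `x`: the component
of `D²F(x)(v, w)` orthogonal to the tangent space, i.e. to the range of `DF(x)`. -/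
def secondFF {n : ℕ} (F : En n → Hn n) (x v w : En n) : Hn n :=
  (LinearMap.range (fderiv ℝ F x).toLinearMap)ᗮ.starProjection
    (fderiv ℝ (fun y => fderiv ℝ F y) x v w)

/-- The matrix of the twisted product metric `f² dx₁² + dx₂² + ⋯ + dxₙ²`
(the first coordinate has index `0`). -/
def twistedMetric {n : ℕ} [NeZero n] (f : En n → ℝ) (x : En n) (i j : Fin n) : ℝ :=
  if i = j then (if i = 0 then f x ^ 2 else 1) else 0

/-- `T` is a simply connected open domain of `ℝ × ℝⁿ⁻¹` and `f > 0` is a twisting function on it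
such that `f² = f₁² + f₂² + f₃²`, each `f / f_a` depends only on `x₁`, and
`f = β(x₁) + ∑_{j ≥ 2} α_j(x₁) x_j`. The functions `f₁, f₂, f₃` are `fc 0, fc 1, fc 2`; the
coordinates `x₁, x₂, …` are `x 0, x 1, …`; the value `α 0` is irrelevant. -/
structure IsTwistingData {n : ℕ} [NeZero n] (T : Set (En n)) (f : En n → ℝ)
    (fc : Fin 3 → En n → ℝ) (β : ℝ → ℝ) (α : Fin n → ℝ → ℝ) : Prop where
  isOpen : IsOpen T
  simplyConnected : IsSimplyConnected T
  smooth : ContDiffOn ℝ ∞ f T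
  pos : ∀ x ∈ T, 0 < f x
  smooth_fc : ∀ a, ContDiffOn ℝ ∞ (fc a) T
  fc_ne_zero : ∀ a, ∀ x ∈ T, fc a x ≠ 0
  sq_eq : ∀ x ∈ T, f x ^ 2 = fc 0 x ^ 2 + fc 1 x ^ 2 + fc 2 x ^ 2
  ratio : ∀ a, ∃ φ : ℝ → ℝ, ∀ x ∈ T, f x / fc a x = φ (x 0)
  affine : ∀ x ∈ T, f x = β (x 0) + ∑ j ∈ Finset.univ.erase 0, α j (x 0) * x j

/-- `F` is a Lagrangian isometric immersion into `ℍⁿ` of the domain `T` with metric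
`f² dx₁² + dx₂² + ⋯ + dxₙ²`, without totally geodesic points, whose second fundamental form is
`h(e₁,e₁) = λ₁ I e₁ + λ₂ J e₁ + λ₃ K e₁`, `h(e₁,e_j) = h(e_j,e_k) = 0` for `j, k ≥ 2`, where
`e₁ = f⁻¹ ∂₁`, `e_j = ∂_j` and `λ_a = 1 / f_a`. -/
structure IsLf {n : ℕ} [NeZero n] (T : Set (En n)) (f : En n → ℝ) (fc : Fin 3 → En n → ℝ)
    (F : En n → Hn n) : Prop where
  smooth : ContDiffOn ℝ ∞ F T
  isometric : ∀ x ∈ T, ∀ i j : Fin n,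
    ⟪fderiv ℝ F x (coordVec i), fderiv ℝ F x (coordVec j)⟫_ℝ = twistedMetric f x i j
  lagrangian : ∀ x ∈ T, ∀ a : Fin 3, ∀ v w : En n,
    ⟪imUnit a • fderiv ℝ F x v, fderiv ℝ F x w⟫_ℝ = 0
  not_totallyGeodesic : ∀ x ∈ T, ∃ v w : En n, secondFF F x v w ≠ 0
  sff_one_one : ∀ x ∈ T,
    secondFF F x ((1 / f x) • coordVec 0) ((1 / f x) • coordVec 0) =
      ∑ a : Fin 3, (1 / fc a x) • (imUnit a • fderiv ℝ F x ((1 / f x) • coordVec 0))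
  sff_one_j : ∀ x ∈ T, ∀ j : Fin n, j ≠ 0 →
    secondFF F x ((1 / f x) • coordVec 0) (coordVec j) = 0
  sff_j_k : ∀ x ∈ T, ∀ j k : Fin n, j ≠ 0 → k ≠ 0 →
    secondFF F x (coordVec j) (coordVec k) = 0

/-! ## Riemannian manifolds, curvature, and immersions of manifolds into `ℍⁿ` -/

/-- Smooth Riemannian metrics on an `n`-manifold `M`. -/
abbrev SmoothMetric (n : ℕ) (M : Type*) [TopologicalSpace M] [ChartedSpace (En n) M]
    [IsManifold 𝓘(ℝ, En n) ∞ M] :=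
  Bundle.ContMDiffRiemannianMetric 𝓘(ℝ, En n) ∞ (En n)
    (fun x : M => TangentSpace 𝓘(ℝ, En n) x)

/-- The coefficients `g(∂_i, ∂_j)` of a Riemannian metric in the chart `Φ`. -/
def metricCoeff {n : ℕ} {M : Type*} [TopologicalSpace M] [ChartedSpace (En n) M]
    [IsManifold 𝓘(ℝ, En n) ∞ M] (g : SmoothMetric n M) (Φ : OpenPartialHomeomorph M (En n))
    (x : En n) (i j : Fin n) : ℝ :=
  g.inner (Φ.symm x)
    (mfderiv 𝓘(ℝ, En n) 𝓘(ℝ, En n) Φ.symm x (coordVec i))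
    (mfderiv 𝓘(ℝ, En n) 𝓘(ℝ, En n) Φ.symm x (coordVec j))

/-- The partial derivative `∂_i u`. -/
def pderiv {n : ℕ} (i : Fin n) (u : En n → ℝ) (x : En n) : ℝ := fderiv ℝ u x (coordVec i)

/-- The Christoffel symbols `Γ^k_{ij}` of a metric with coefficients `G`. -/
def christoffel {n : ℕ} (G : En n → Fin n → Fin n → ℝ) (k i j : Fin n) (x : En n) : ℝ :=
  (1 / 2) * ∑ l : Fin n, (Matrix.of (G x))⁻¹ k l *
    (pderiv i (fun y => G y j l) x + pderiv j (fun y => G y i l) x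
      - pderiv l (fun y => G y i j) x)

/-- The coefficient of `∂_l` in `R(∂_i, ∂_j) ∂_k`. -/
def riemannCoeff {n : ℕ} (G : En n → Fin n → Fin n → ℝ) (l k i j : Fin n) (x : En n) : ℝ :=
  pderiv i (christoffel G l j k) x - pderiv j (christoffel G l i k) x
    + ∑ m : Fin n, (christoffel G l i m x * christoffel G m j k x
      - christoffel G l j m x * christoffel G m i k x)

/-- A Riemannian manifold is flat if its curvature tensor vanishes. -/
def IsFlat {n : ℕ} {M : Type*} [TopologicalSpace M] [ChartedSpace (En n) M]
    [IsManifold 𝓘(ℝ, En n) ∞ M] (g : SmoothMetric n M) : Prop :=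
  ∀ Φ ∈ IsManifold.maximalAtlas 𝓘(ℝ, En n) ∞ M, ∀ x ∈ Φ.target, ∀ l k i j : Fin n,
    riemannCoeff (metricCoeff g Φ) l k i j x = 0

/-- The differential of a map `L : M → ℍⁿ` at `p`. -/
def diffAt {n : ℕ} {M : Type*} [TopologicalSpace M] [ChartedSpace (En n) M]
    (L : M → Hn n) (p : M) : TangentSpace 𝓘(ℝ, En n) p →L[ℝ] Hn n :=
  mfderiv 𝓘(ℝ, En n) 𝓘(ℝ, Hn n) L p

/-- The second fundamental form of an immersion `L : M → ℍⁿ` at `p`, computed in the preferred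
chart at `p`, through which `T_pM` is identified with `ℝⁿ`. -/
def secondFFAt {n : ℕ} {M : Type*} [TopologicalSpace M] [ChartedSpace (En n) M]
    (L : M → Hn n) (p : M) (v w : TangentSpace 𝓘(ℝ, En n) p) : Hn n :=
  secondFF (L ∘ (chartAt (En n) p).symm) (chartAt (En n) p p) v w

/-- `L` is a (smooth) Lagrangian isometric immersion of `(M, g)` into `ℍⁿ`: the subspaces
`I(T_pM), J(T_pM), K(T_pM)` are all normal to `T_pM`. -/
structure IsLagrangianIsometricImmersion {n : ℕ} {M : Type*} [TopologicalSpace M]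
    [ChartedSpace (En n) M] [IsManifold 𝓘(ℝ, En n) ∞ M] (g : SmoothMetric n M)
    (L : M → Hn n) : Prop where
  smooth : ContMDiff 𝓘(ℝ, En n) 𝓘(ℝ, Hn n) ∞ L
  isometric : ∀ (p : M) (v w : TangentSpace 𝓘(ℝ, En n) p),
    ⟪diffAt L p v, diffAt L p w⟫_ℝ = g.inner p v w
  lagrangian : ∀ (p : M) (a : Fin 3) (v w : TangentSpace 𝓘(ℝ, En n) p),
    ⟪imUnit a • diffAt L p v, diffAt L p w⟫_ℝ = 0

/-- `L` has no totally geodesic point: its second fundamental form vanishes nowhere. -/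
def NoTotallyGeodesicPoint {n : ℕ} {M : Type*} [TopologicalSpace M] [ChartedSpace (En n) M]
    (L : M → Hn n) : Prop :=
  ∀ p : M, ∃ v w : TangentSpace 𝓘(ℝ, En n) p, secondFFAt L p v w ≠ 0

/-- `L` is `H`-umbilical: around every point there is a smooth orthonormal frame `e₁, …, eₙ` with
`h(e₁,e₁) = λ₁ I e₁ + λ₂ J e₁ + λ₃ K e₁`, `h(e₁,e_j) = μ₁ I e_j + μ₂ J e_j + μ₃ K e_j`,
`h(e_j,e_j) = μ₁ I e₁ + μ₂ J e₁ + μ₃ K e₁` and `h(e_j,e_k) = 0` for `j ≠ k`, `j, k ≥ 2`. -/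
def IsHUmbilical {n : ℕ} [NeZero n] {M : Type*} [TopologicalSpace M] [ChartedSpace (En n) M]
    [IsManifold 𝓘(ℝ, En n) ∞ M] (g : SmoothMetric n M) (L : M → Hn n) : Prop :=
  ∀ p : M, ∃ U : Set M, IsOpen U ∧ p ∈ U ∧
    ∃ (e : Fin n → (x : M) → TangentSpace 𝓘(ℝ, En n) x) (lam mu : Fin 3 → M → ℝ),
      (∀ i, ContMDiffOn 𝓘(ℝ, En n) (𝓘(ℝ, En n)).tangent ∞
        (fun x => (⟨x, e i x⟩ : TangentBundle 𝓘(ℝ, En n) M)) U) ∧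
      ∀ x ∈ U,
        (∀ i j, g.inner x (e i x) (e j x) = if i = j then 1 else 0) ∧
        secondFFAt L x (e 0 x) (e 0 x) =
          ∑ a : Fin 3, lam a x • (imUnit a • diffAt L x (e 0 x)) ∧
        (∀ j, j ≠ 0 →
          secondFFAt L x (e 0 x) (e j x) =
            ∑ a : Fin 3, mu a x • (imUnit a • diffAt L x (e j x)) ∧
          secondFFAt L x (e j x) (e j x) =
            ∑ a : Fin 3, mu a x • (imUnit a • diffAt L x (e 0 x))) ∧
        ∀ j k, j ≠ 0 → k ≠ 0 → j ≠ k → secondFFAt L x (e j x) (e k x) = 0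

/-- In the chart `Φ`, the metric is `f² dx₁² + dx₂² + ⋯ + dxₙ²`. -/
def IsTwistedChart {n : ℕ} [NeZero n] {M : Type*} [TopologicalSpace M] [ChartedSpace (En n) M]
    [IsManifold 𝓘(ℝ, En n) ∞ M] (g : SmoothMetric n M) (Φ : OpenPartialHomeomorph M (En n))
    (f : En n → ℝ) : Prop :=
  Φ ∈ IsManifold.maximalAtlas 𝓘(ℝ, En n) ∞ M ∧
    ∀ x ∈ Φ.target, ∀ i j, metricCoeff g Φ x i j = twistedMetric f x i j

/-- The chart `Φ` identifies its source with a simply connected open portion of a twisted product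
whose twisting function is given by data `f, f₁, f₂, f₃, β, α_j` as in `IsTwistingData`, and, after
the rigid motion `x ↦ q x` of `ℍⁿ` (left multiplication by a unit quaternion `q`), the map `L`
becomes the immersion with the second fundamental form described in `IsLf`. -/
structure IsAdaptedChart {n : ℕ} [NeZero n] {M : Type*} [TopologicalSpace M]
    [ChartedSpace (En n) M] [IsManifold 𝓘(ℝ, En n) ∞ M] (g : SmoothMetric n M) (L : M → Hn n)
    (Φ : OpenPartialHomeomorph M (En n)) (f : En n → ℝ) (fc : Fin 3 → En n → ℝ)
    (β : ℝ → ℝ) (α : Fin n → ℝ → ℝ) (q : ℍ[ℝ]) : Prop where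
  twisted : IsTwistedChart g Φ f
  data : IsTwistingData Φ.target f fc β α
  norm_q : ‖q‖ = 1
  isLf : IsLf Φ.target f fc (fun x => q • L (Φ.symm x))

/-! ## Cylinders and special Legendre curves -/

/-- On the set `T` the map `F` is `D(x₁) + ∑_{j ≥ 2} c_j x_j`, a Lagrangian cylinder over the
smooth curve `D`: the constant vectors `c_j` are orthonormal and span a totally real
`(n-1)`-plane, and `D'` is orthogonal to the quaternionic span of that plane. -/
structure IsLagrangianCylinder {n : ℕ} [NeZero n] (T : Set (En n)) (F : En n → Hn n)
    (D : ℝ → Hn n) (c : Fin n → Hn n) : Prop where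
  smooth : ContDiffOn ℝ ∞ D ((fun x : En n => x 0) '' T)
  formula : ∀ x ∈ T, F x = D (x 0) + ∑ j ∈ Finset.univ.erase 0, x j • c j
  orthonormal : ∀ j k : Fin n, j ≠ 0 → k ≠ 0 → ⟪c j, c k⟫_ℝ = if j = k then 1 else 0
  totallyReal : ∀ a : Fin 3, ∀ j k : Fin n, j ≠ 0 → k ≠ 0 → ⟪imUnit a • c j, c k⟫_ℝ = 0
  normal : ∀ x ∈ T, ∀ r : Fin 4, ∀ j : Fin n, j ≠ 0 →
    ⟪deriv D (x 0), quatBasis r • c j⟫_ℝ = 0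

/-- `z : S → S⁴ⁿ⁻¹ ⊂ ℍⁿ` is a special Legendre curve with parallel normal fields `P₃, …, Pₙ`
(with indices `2, …, n - 1` here; `P 0`, `P 1` are irrelevant): `z` is a unit speed curve in the
unit sphere, `z'` is orthogonal to `iz, jz, kz`; the vectors `z, z', P_l` and their products with
`i, j, k` form an orthonormal frame; the component of `P_l'` normal to the curve in the sphere is
zero; and `z'' = iα z' + jβ z' + kγ z' - z - ∑ a_l P_l` for real functions `α, β, γ, a_l`. -/
structure IsSpecialLegendre {n : ℕ} [NeZero n] (S : Set ℝ) (z : ℝ → Hn n)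
    (P : Fin n → ℝ → Hn n) : Prop where
  smooth : ContDiffOn ℝ ∞ z S
  smooth_P : ∀ l, l ≠ 0 → l ≠ 1 → ContDiffOn ℝ ∞ (P l) S
  mem_sphere : ∀ s ∈ S, ‖z s‖ = 1
  unit_speed : ∀ s ∈ S, ‖deriv z s‖ = 1
  legendre : ∀ s ∈ S, ∀ a : Fin 3, ⟪deriv z s, imUnit a • z s⟫_ℝ = 0
  frame : ∀ s ∈ S, Orthonormal ℝ (fun r : Fin 4 × Fin n =>
    quatBasis r.1 • (if r.2 = 0 then deriv z s else if r.2 = 1 then z s else P r.2 s))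
  parallel : ∀ s ∈ S, ∀ l, l ≠ 0 → l ≠ 1 → deriv (P l) s ∈ Submodule.span ℝ {z s, deriv z s}
  special : ∃ (κ : Fin 3 → ℝ → ℝ) (a : Fin n → ℝ → ℝ), ∀ s ∈ S,
    deriv (deriv z) s = ∑ r : Fin 3, κ r s • (imUnit r • deriv z s) - z s
      - ∑ l ∈ (Finset.univ.erase 0).erase 1, a l s • P l s

end

open Set Topology MeasureTheory
open scoped Manifold ContDiff Quaternion InnerProductSpace

noncomputable section

/-! ## Linear ordinary differential equations on an open interval -/

section LinearODE

variable {V : Type*} [NormedAddCommGroup V] [NormedSpace ℝ V]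

/-! Both halves rest on one normal form. Let E_1 = f⁻¹∂_1L and E_j = ∂_jL (j ≥ 2; the code counts
from 0). The Lagrangian condition makes this frame orthonormal over the quaternions. Koszul's
formula and the prescribed h give dE_1 = (φE_1 − Σα_jE_j)dx_1 and dE_j = α_jE_1dx_1, where φ is the
imaginary quaternion with components f/f_a (`IsLf.hasFDerivAt_unitFrame`). This is a linear
skew-hermitian system in x_1 alone, and integrating once more yields L = D(x_1) + Σx_jE_j(x_1) with
D' = βE_1 (`IsNormalForm`).

Existence in (a) is therefore solvability of linear equations on an interval, skewness keeping the
frame orthonormal (`exists_isNormalForm`). For uniqueness, the product X*Y of two solutions is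
constant (`exists_sum_entry_eq`), so the two frames differ by a fixed quaternion-linear isometry.

For (b), the Gauss equation on e_2, e_3, available since n ≥ 3, reads |μ|² = 0
(`umbilic_coefficient_eq_zero`). Hence h = θ⊗θ·νN with N the image of e_1 and θ its dual form. For a
graph over a tangent space the whole second derivative then has the form θ⊗θ·C with C nowhere zero
(`IsRankOneGraph.snd_fderiv_eq`). Symmetry of third derivatives makes the leaves of ker θ straight
and the map affine along them (`IsRankOneGraph.apply_add_of_ker`). Along a line transverse to the
leaves, a basis of ker θ is transported so that its image moves in the direction N only; this
produces the normal form (`IsRankOneGraph.exists_isNormalForm_axis`).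

Two adjustments remain. A unit quaternion q conjugates ν so that all three components are nonzero at
the base point (`exists_conj_imComp_ne_zero`), and a change of the parameter x_1 achieves Σ1/φ_a² =
1, which is f² = Σf_a² for f_a = f/φ_a (`exists_normalizing_parameter`).

The explicit formulas are read off the normal form. If all α_j vanish, the E_j are constant. If α_2
has no zero, the parameter t = ∫α_2 gives E_2' = E_1, so z = E_2 is the Legendre curve, the equation
of E_1 is the one required of z'', and D' = bz'. -/

theorem exists_Icc_subset_of_isOpen {J : Set ℝ} (hJ : IsOpen J) (hc : J.OrdConnected) {s t : ℝ}
    (hs : s ∈ J) (ht : t ∈ J) : ∃ a b, s ∈ Ioo a b ∧ t ∈ Ioo a b ∧ Icc a b ⊆ J := by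
  wlog h : s ≤ t generalizing s t
  · obtain ⟨a, b, h1, h2, h3⟩ := this ht hs (le_of_not_ge h)
    exact ⟨a, b, h2, h1, h3⟩
  obtain ⟨r, hr, hrs⟩ := Metric.isOpen_iff.1 hJ s hs
  obtain ⟨r', hr', hrt⟩ := Metric.isOpen_iff.1 hJ t ht
  refine ⟨s - r / 2, t + r' / 2, ⟨by linarith, by linarith⟩, ⟨by linarith, by linarith⟩, ?_⟩
  apply hc.out
  · apply hrs; simp [abs_of_pos hr]; linarith
  · apply hrt; simp [abs_of_pos hr']; linarith

/-- On a compact subinterval ‖A‖ is bounded, so the field is Lipschitz there. With A = 0, or with a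
scalar A and one solution zero, this also serves below as the criterion for a quantity to be
constant or to vanish along a line. -/
theorem linearODE_unique {A : ℝ → V →L[ℝ] V} {J : Set ℝ} (hJ : IsOpen J) (hc : J.OrdConnected)
    (hA : ContinuousOn A J) {y z : ℝ → V} (hy : ∀ t ∈ J, HasDerivAt y (A t (y t)) t)
    (hz : ∀ t ∈ J, HasDerivAt z (A t (z t)) t) {t₀ : ℝ} (ht₀ : t₀ ∈ J) (h : y t₀ = z t₀) :
    EqOn y z J := by
  intro t ht
  obtain ⟨a, b, h1, h2, h3⟩ := exists_Icc_subset_of_isOpen hJ hc ht₀ ht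
  obtain ⟨C, hC⟩ := isCompact_Icc.exists_bound_of_continuousOn (hA.mono h3)
  have hsub : Ioo a b ⊆ J := Ioo_subset_Icc_self.trans h3
  refine ODE_solution_unique_of_mem_Ioo (K := C.toNNReal) (v := fun t x => A t x)
    (s := fun _ => univ) ?_ h1 (fun s hs => ⟨hy s (hsub hs), mem_univ _⟩)
    (fun s hs => ⟨hz s (hsub hs), mem_univ _⟩) h h2
  intro s hs
  refine ((A s).lipschitz.weaken ?_).lipschitzOnWith
  rw [← NNReal.coe_le_coe, coe_nnnorm]
  exact (hC s (Ioo_subset_Icc_self hs)).trans (Real.le_coe_toNNReal C)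

/-- By uniqueness the solution chosen for t agrees near t with the ones chosen for neighbouring
points, so the diagonal t ↦ y_t(t) is a solution. -/
theorem linearODE_glue {A : ℝ → V →L[ℝ] V} {J : Set ℝ} (hA : ContinuousOn A J) {t₀ : ℝ} {y₀ : V}
    (h : ∀ t ∈ J, ∃ a b, t₀ ∈ Ioo a b ∧ t ∈ Ioo a b ∧ Ioo a b ⊆ J ∧ ∃ y : ℝ → V, y t₀ = y₀ ∧
      ∀ s ∈ Ioo a b, HasDerivAt y (A s (y s)) s) (ht₀ : t₀ ∈ J) :
    ∃ y : ℝ → V, y t₀ = y₀ ∧ ∀ t ∈ J, HasDerivAt y (A t (y t)) t := by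
  choose! a b h0 ht hs y hy hd using h
  refine ⟨fun t => y t t, hy t₀ ht₀, fun t htJ => ?_⟩
  have key : ∀ s ∈ Ioo (a t) (b t), y s s = y t s := by
    intro s hst
    have hsJ := hs t htJ hst
    have := linearODE_unique (J := Ioo (a s) (b s) ∩ Ioo (a t) (b t)) (A := A)
      (isOpen_Ioo.inter isOpen_Ioo) (ordConnected_Ioo.inter ordConnected_Ioo)
      (hA.mono (inter_subset_left.trans (hs s hsJ)))
      (fun r hr => hd s hsJ r hr.1) (fun r hr => hd t htJ r hr.2) ⟨h0 s hsJ, h0 t htJ⟩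
      ((hy s hsJ).trans (hy t htJ).symm)
    exact this ⟨ht s hsJ, hst⟩
  refine (hd t htJ t (ht t htJ)).congr_of_eventuallyEq ?_
  filter_upwards [isOpen_Ioo.mem_nhds (ht t htJ)] with s hs' using key s hs'

/-- The two solutions coincide on the overlap of their intervals, so switching at `t₁` leaves no
corner. -/
theorem linearODE_extend {A : ℝ → V →L[ℝ] V} (hA : Continuous A) {a c b d : ℝ} {y z : ℝ → V}
    (hy : ∀ t ∈ Ioo a b, HasDerivAt y (A t (y t)) t)
    (hz : ∀ t ∈ Ioo c d, HasDerivAt z (A t (z t)) t) {t₁ : ℝ} (h1 : t₁ ∈ Ioo a b ∩ Ioo c d)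
    (h : y t₁ = z t₁) :
    ∃ w : ℝ → V, (∀ t ∈ Iic t₁, w t = y t) ∧ (∀ t ∈ Ici t₁, w t = z t) ∧
      ∀ t ∈ Ioo a d, HasDerivAt w (A t (w t)) t := by
  have hloc : EqOn y z (Ioo a b ∩ Ioo c d) :=
    linearODE_unique (isOpen_Ioo.inter isOpen_Ioo) (ordConnected_Ioo.inter ordConnected_Ioo)
      hA.continuousOn (fun t ht => hy t ht.1) (fun t ht => hz t ht.2) h1 h
  refine ⟨fun t => if t ≤ t₁ then y t else z t, fun t ht => if_pos ht, fun t ht => ?_, ?_⟩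
  · rcases eq_or_lt_of_le (mem_Ici.1 ht) with rfl | h'
    · simp [h]
    · exact if_neg (not_le.2 h')
  intro t ht
  rcases lt_trichotomy t t₁ with h' | rfl | h'
  · simp only [h'.le, if_true]
    refine (hy t ⟨ht.1, h'.trans h1.1.2⟩).congr_of_eventuallyEq ?_
    filter_upwards [Iio_mem_nhds h'] with s hs using if_pos (le_of_lt hs)
  · simp only [le_refl, if_true]
    refine (hy t h1.1).congr_of_eventuallyEq ?_
    filter_upwards [(isOpen_Ioo.inter isOpen_Ioo).mem_nhds h1] with s hs
    split_ifs
    · rfl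
    · exact (hloc hs).symm
  · simp only [not_le.2 h', if_false]
    refine (hz t ⟨h1.2.1.trans h', ht.2⟩).congr_of_eventuallyEq ?_
    filter_upwards [Ioi_mem_nhds h'] with s hs using if_neg (not_le.2 hs)

/-- Bootstrapping: if y is of class C^k, then so is y' = Ay. -/
theorem linearODE_contDiffOn {A : ℝ → V →L[ℝ] V} {J : Set ℝ} (hJ : IsOpen J)
    (hA : ContDiffOn ℝ ∞ A J) {y : ℝ → V} (hy : ∀ t ∈ J, HasDerivAt y (A t (y t)) t) :
    ContDiffOn ℝ ∞ y J := by
  rw [contDiffOn_infty]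
  intro k
  induction k with
  | zero =>
    exact contDiffOn_zero.2 fun t ht => (hy t ht).continuousAt.continuousWithinAt
  | succ k ih =>
    push_cast
    rw [contDiffOn_succ_iff_deriv_of_isOpen hJ]
    refine ⟨fun t ht => (hy t ht).differentiableAt.differentiableWithinAt, by simp, ?_⟩
    exact ((hA.of_le (by exact_mod_cast le_top)).clm_apply ih).congr fun t ht => (hy t ht).deriv

variable [CompleteSpace V]

theorem linearODE_exists_short {A : ℝ → V →L[ℝ] V} (hA : Continuous A) {K : ℝ} (hK : 0 < K)
    (hb : ∀ t, ‖A t‖ ≤ K) (t₀ : ℝ) (y₀ : V) : ∃ y : ℝ → V, y t₀ = y₀ ∧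
      ∀ t ∈ Ioo (t₀ - 1 / (2 * K)) (t₀ + 1 / (2 * K)), HasDerivAt y (A t (y t)) t := by
  have hε : 0 < 1 / (2 * K) := by positivity
  set ε := 1 / (2 * K) with hεd
  -- On the ball of radius ‖y₀‖ + 1 about y₀ the field is at most K(2‖y₀‖ + 1), and over time 1/(2K)
  -- this moves a point by at most ‖y₀‖ + 1/2. Linearity makes the step length independent of the
  -- initial value.
  let a : NNReal := ⟨‖y₀‖ + 1, by positivity⟩
  let Lb : NNReal := ⟨K * (2 * ‖y₀‖ + 1), by positivity⟩
  let Kb : NNReal := ⟨K, hK.le⟩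
  have hp : IsPicardLindelof (fun t x => A t x) (tmin := t₀ - ε) (tmax := t₀ + ε)
      ⟨t₀, by constructor <;> linarith⟩ y₀ a 0 Lb Kb := by
    refine ⟨fun t _ => ((A t).lipschitz.weaken ?_).lipschitzOnWith, fun x _ => ?_, ?_, ?_⟩
    · rw [← NNReal.coe_le_coe]; exact hb t
    · exact (hA.clm_apply continuous_const).continuousOn
    · intro t _ x hx
      have hx' : ‖x‖ ≤ 2 * ‖y₀‖ + 1 := by
        have h1 : ‖x - y₀‖ ≤ ‖y₀‖ + 1 := mem_closedBall_iff_norm.1 hx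
        have h2 := norm_add_le (x - y₀) y₀
        rw [sub_add_cancel] at h2
        linarith
      calc ‖A t x‖ ≤ ‖A t‖ * ‖x‖ := (A t).le_opNorm x
        _ ≤ K * (2 * ‖y₀‖ + 1) := by gcongr; exact hb t
    · have : max (t₀ + ε - t₀) (t₀ - (t₀ - ε)) = ε := by simp
      change K * (2 * ‖y₀‖ + 1) * max (t₀ + ε - t₀) (t₀ - (t₀ - ε)) ≤ (‖y₀‖ + 1) - 0
      rw [this, hεd]
      field_simp
      linarith [norm_nonneg y₀]
  obtain ⟨y, hy0, hy⟩ := hp.exists_eq_forall_mem_Icc_hasDerivWithinAt₀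
  exact ⟨y, hy0, fun t ht => (hy t (Ioo_subset_Icc_self ht)).hasDerivAt (Icc_mem_nhds ht.1 ht.2)⟩

theorem linearODE_exists_of_bounded {A : ℝ → V →L[ℝ] V} (hA : Continuous A) {K : ℝ} (hK : 0 < K)
    (hb : ∀ t, ‖A t‖ ≤ K) (t₀ : ℝ) (y₀ : V) : ∃ y : ℝ → V, y t₀ = y₀ ∧
      ∀ t, HasDerivAt y (A t (y t)) t := by
  set ε := 1 / (2 * K) with hεd
  have hε : 0 < ε := by positivity
  have step : ∀ k : ℕ, ∃ y : ℝ → V, y t₀ = y₀ ∧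
      ∀ t ∈ Ioo (t₀ - (k + 1) * (ε / 2)) (t₀ + (k + 1) * (ε / 2)), HasDerivAt y (A t (y t)) t := by
    intro k
    induction k with
    | zero =>
      obtain ⟨y, h0, hy⟩ := linearODE_exists_short hA hK hb t₀ y₀
      refine ⟨y, h0, fun t ht => hy t ?_⟩
      simp only [Nat.cast_zero, zero_add, one_mul, mem_Ioo] at ht ⊢
      constructor <;> linarith [ht.1, ht.2]
    | succ k ih =>
      obtain ⟨y, h0, hy⟩ := ih
      have hkε : 0 ≤ (k : ℝ) * (ε / 2) := by positivity
      push_cast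
      -- A restart at distance kε/2, strictly inside the known interval, lives for time ε and so
      -- reaches distance (k + 2)ε/2. The same is then done on the left.
      obtain ⟨z, z0, hz⟩ := linearODE_exists_short hA hK hb (t₀ + k * (ε / 2)) (y (t₀ + k * (ε / 2)))
      obtain ⟨w, w1, -, w3⟩ := linearODE_extend hA hy hz
        (t₁ := t₀ + k * (ε / 2)) ⟨⟨by linarith, by linarith⟩, ⟨by linarith, by linarith⟩⟩ z0.symm
      obtain ⟨v, v0, hv⟩ := linearODE_exists_short hA hK hb (t₀ - k * (ε / 2)) (w (t₀ - k * (ε / 2)))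
      obtain ⟨u, -, u2, u3⟩ := linearODE_extend hA hv w3
        (t₁ := t₀ - k * (ε / 2)) ⟨⟨by linarith, by linarith⟩, ⟨by linarith, by linarith⟩⟩ v0
      refine ⟨u, ?_, fun t ht => u3 t ?_⟩
      · rw [u2 t₀ (by simp only [mem_Ici]; linarith), w1 t₀ (by simp only [mem_Iic]; linarith), h0]
      · constructor <;> linarith [ht.1, ht.2]
  obtain ⟨y, h0, hy⟩ := linearODE_glue (J := univ) hA.continuousOn (t₀ := t₀) (y₀ := y₀) (fun t _ => by
    obtain ⟨k, hk⟩ := exists_nat_gt (|t - t₀| / (ε / 2))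
    obtain ⟨y, h0, hy⟩ := step k
    have hk' : |t - t₀| < (k + 1) * (ε / 2) := by
      rw [div_lt_iff₀ (by positivity)] at hk
      linarith
    have := abs_lt.1 hk'
    refine ⟨_, _, ⟨?_, ?_⟩, ⟨?_, ?_⟩, subset_univ _, y, h0, hy⟩
    · linarith [abs_nonneg (t - t₀)]
    · linarith [abs_nonneg (t - t₀)]
    · linarith
    · linarith) (mem_univ _)
  exact ⟨y, h0, fun t => hy t (mem_univ _)⟩

theorem linearODE_exists {A : ℝ → V →L[ℝ] V} {J : Set ℝ} (hJ : IsOpen J) (hc : J.OrdConnected)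
    (hA : ContinuousOn A J) {t₀ : ℝ} (ht₀ : t₀ ∈ J) (y₀ : V) : ∃ y : ℝ → V, y t₀ = y₀ ∧
      ∀ t ∈ J, HasDerivAt y (A t (y t)) t := by
  refine linearODE_glue hA (fun t ht => ?_) ht₀
  obtain ⟨a, b, h1, h2, h3⟩ := exists_Icc_subset_of_isOpen hJ hc ht₀ ht
  have hab : a ≤ b := (h1.1.trans h1.2).le
  -- Freezing A at the end points outside [a, b] gives a bounded continuous coefficient on the whole
  -- line, unchanged on the interval of interest.
  let B : ℝ → V →L[ℝ] V := fun s => A (projIcc a b hab s)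
  have hB : Continuous B :=
    (continuousOn_iff_continuous_domRestrict.1 (hA.mono h3)).comp continuous_projIcc
  obtain ⟨C, hC⟩ := isCompact_Icc.exists_bound_of_continuousOn (hA.mono h3)
  obtain ⟨y, h0, hy⟩ := linearODE_exists_of_bounded hB (K := |C| + 1) (by positivity)
    (fun s => (hC _ (projIcc a b hab s).2).trans (by linarith [le_abs_self C])) t₀ y₀
  refine ⟨a, b, h1, h2, Ioo_subset_Icc_self.trans h3, y, h0, fun s hs => ?_⟩
  have := hy s
  simp only [B, projIcc_of_mem hab (Ioo_subset_Icc_self hs)] at this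
  exact this

end LinearODE

/-! ## Quaternionic linear algebra -/

/-- The quaternion-valued hermitian product of `ℍⁿ`. -/
def qdot {n : ℕ} (x y : Hn n) : ℍ[ℝ] := ∑ m, x m * star (y m)

/-- The imaginary quaternion with given components. -/
def imQuat (c : Fin 3 → ℝ) : ℍ[ℝ] := ⟨0, c 0, c 1, c 2⟩

/-- The components of the imaginary part of a quaternion. -/
def imComp (ν : ℍ[ℝ]) : Fin 3 → ℝ := ![ν.imI, ν.imJ, ν.imK]

/-- Orthonormal frames of `ℍⁿ` over the quaternions. -/
def IsQFrame {n : ℕ} (E : Fin n → Hn n) : Prop := ∀ i j, qdot (E i) (E j) = if i = j then 1 else 0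

section Quat

variable {n : ℕ}

@[simp] theorem imQuat_re (c : Fin 3 → ℝ) : (imQuat c).re = 0 := rfl
@[simp] theorem imQuat_imI (c : Fin 3 → ℝ) : (imQuat c).imI = c 0 := rfl
@[simp] theorem imQuat_imJ (c : Fin 3 → ℝ) : (imQuat c).imJ = c 1 := rfl
@[simp] theorem imQuat_imK (c : Fin 3 → ℝ) : (imQuat c).imK = c 2 := rfl
@[simp] theorem imComp_zero (ν : ℍ[ℝ]) : imComp ν 0 = ν.imI := rfl
@[simp] theorem imComp_one (ν : ℍ[ℝ]) : imComp ν 1 = ν.imJ := rfl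
@[simp] theorem imComp_two (ν : ℍ[ℝ]) : imComp ν 2 = ν.imK := rfl

theorem imUnit_eq_imQuat (a : Fin 3) : imUnit a = imQuat fun b => if b = a then 1 else 0 := by
  fin_cases a <;> rfl

theorem quatBasis_zero : quatBasis 0 = 1 := rfl

theorem quatBasis_succ (a : Fin 3) : quatBasis a.succ = imUnit a := by
  fin_cases a <;> rfl

theorem inner_eq_re_qdot (x y : Hn n) : ⟪x, y⟫_ℝ = (qdot x y).re := by
  rw [PiLp.inner_apply, qdot]
  simp only [Quaternion.inner_def]
  exact (map_sum (AddMonoidHom.mk' (fun q : ℍ[ℝ] => q.re) fun _ _ => rfl)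
    (fun m => x m * star (y m)) Finset.univ).symm

theorem qdot_smul_left (q : ℍ[ℝ]) (x y : Hn n) : qdot (q • x) y = q * qdot x y := by
  simp [qdot, Finset.mul_sum, mul_assoc]

theorem qdot_smul_right (q : ℍ[ℝ]) (x y : Hn n) : qdot x (q • y) = qdot x y * star q := by
  simp [qdot, Finset.sum_mul, mul_assoc]

theorem qdot_rsmul_left (c : ℝ) (x y : Hn n) : qdot (c • x) y = c • qdot x y := by
  simp [qdot, Finset.smul_sum]

theorem qdot_rsmul_right (c : ℝ) (x y : Hn n) : qdot x (c • y) = c • qdot x y := by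
  simp [qdot, Finset.smul_sum]

theorem qdot_add_left (x y z : Hn n) : qdot (x + y) z = qdot x z + qdot y z := by
  simp [qdot, add_mul, Finset.sum_add_distrib]

theorem qdot_add_right (x y z : Hn n) : qdot x (y + z) = qdot x y + qdot x z := by
  simp [qdot, mul_add, Finset.sum_add_distrib]

/-- The hermitian product as a continuous real bilinear map. -/
def qdotL : Hn n →L[ℝ] Hn n →L[ℝ] ℍ[ℝ] :=
  LinearMap.mkContinuous₂ (LinearMap.mk₂ ℝ qdot qdot_add_left qdot_rsmul_left qdot_add_right
    qdot_rsmul_right) n (by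
      intro x y
      simp only [LinearMap.mk₂_apply]
      calc ‖qdot x y‖ ≤ ∑ m : Fin n, ‖x‖ * ‖y‖ := by
            refine norm_sum_le_of_le _ fun m _ => ?_
            rw [norm_mul, norm_star]
            gcongr
            · exact PiLp.norm_apply_le x m
            · exact PiLp.norm_apply_le y m
        _ = n * ‖x‖ * ‖y‖ := by simp [mul_assoc])

theorem qdotL_apply (x y : Hn n) : qdotL x y = qdot x y := rfl

theorem qdot_sum_left {ι : Type*} (s : Finset ι) (f : ι → Hn n) (y : Hn n) :
    qdot (∑ i ∈ s, f i) y = ∑ i ∈ s, qdot (f i) y := by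
  simp only [← qdotL_apply, map_sum, sum_apply]

theorem qdot_sum_right {ι : Type*} (s : Finset ι) (f : ι → Hn n) (y : Hn n) :
    qdot y (∑ i ∈ s, f i) = ∑ i ∈ s, qdot y (f i) := by
  simp only [← qdotL_apply, map_sum]

theorem inner_imUnit_smul (a : Fin 3) (x y : Hn n) :
    ⟪imUnit a • x, y⟫_ℝ = - imComp (qdot x y) a := by
  rw [inner_eq_re_qdot, qdot_smul_left, Quaternion.re_mul, imUnit_eq_imQuat]
  fin_cases a <;> simp

/-- The imaginary components of the hermitian product are, up to sign, the pairings with Ix, Jx, Kx.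
On a Lagrangian tangent space the hermitian product is thus real and equal to the metric, so
orthonormal tangent frames are quaternionic frames. -/
theorem qdot_eq_coe {x y : Hn n} {r : ℝ} (h : ⟪x, y⟫_ℝ = r)
    (hI : ∀ a, ⟪imUnit a • x, y⟫_ℝ = 0) : qdot x y = (r : ℍ[ℝ]) := by
  simp only [inner_imUnit_smul, neg_eq_zero] at hI
  rw [inner_eq_re_qdot] at h
  have h0 := hI 0; have h1 := hI 1; have h2 := hI 2
  simp only [imComp] at h0 h1 h2
  ext
  · simpa using h
  · simpa using h0
  · simpa using h1
  · simpa using h2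

theorem isQFrame_of_inner {E : Fin n → Hn n} (h : ∀ i j, ⟪E i, E j⟫_ℝ = if i = j then 1 else 0)
    (hI : ∀ a i j, ⟪imUnit a • E i, E j⟫_ℝ = 0) : IsQFrame E := by
  intro i j
  rw [qdot_eq_coe (h i j) fun a => hI a i j]
  split_ifs <;> simp

theorem IsQFrame.inner_smul {E : Fin n → Hn n} (h : IsQFrame E) (p q : ℍ[ℝ]) (i j : Fin n) :
    ⟪p • E i, q • E j⟫_ℝ = if i = j then ⟪p, q⟫_ℝ else 0 := by
  rw [inner_eq_re_qdot, qdot_smul_left, qdot_smul_right, h i j, Quaternion.inner_def]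
  split_ifs <;> simp

theorem IsQFrame.inner {E : Fin n → Hn n} (h : IsQFrame E) (i j : Fin n) :
    ⟪E i, E j⟫_ℝ = if i = j then 1 else 0 := by
  rw [inner_eq_re_qdot, h i j]
  split_ifs <;> simp

theorem IsQFrame.inner_imUnit {E : Fin n → Hn n} (h : IsQFrame E) (a : Fin 3) (i j : Fin n) :
    ⟪imUnit a • E i, E j⟫_ℝ = 0 := by
  rw [inner_imUnit_smul, h i j]
  split_ifs <;> fin_cases a <;> simp

theorem mul_star_self_of_norm {q : ℍ[ℝ]} (hq : ‖q‖ = 1) : q * star q = 1 := by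
  rw [Quaternion.self_mul_star, Quaternion.normSq_eq_norm_mul_self, hq]; simp

theorem star_mul_self_of_norm {q : ℍ[ℝ]} (hq : ‖q‖ = 1) : star q * q = 1 := by
  rw [Quaternion.star_mul_self, Quaternion.normSq_eq_norm_mul_self, hq]; simp

theorem IsQFrame.smul {E : Fin n → Hn n} (h : IsQFrame E) {q : ℍ[ℝ]} (hq : ‖q‖ = 1) :
    IsQFrame fun i => q • E i := by
  intro i j
  rw [qdot_smul_left, qdot_smul_right, h i j]
  split_ifs
  · rw [one_mul, mul_star_self_of_norm hq]
  · simp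

theorem inner_quatBasis (r s : Fin 4) : ⟪quatBasis r, quatBasis s⟫_ℝ = if r = s then 1 else 0 := by
  rw [Quaternion.inner_def]
  refine Fin.cases ?_ (fun a => ?_) r <;> refine Fin.cases ?_ (fun b => ?_) s
  · simp [quatBasis_zero]
  · simp [quatBasis_zero, quatBasis_succ, imUnit_eq_imQuat, (Fin.succ_ne_zero b).symm]
  · simp [quatBasis_zero, quatBasis_succ, imUnit_eq_imQuat]
  · simp only [quatBasis_succ, imUnit_eq_imQuat, Fin.succ_inj]
    fin_cases a <;> fin_cases b <;> simp [Quaternion.re_mul]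

theorem IsQFrame.orthonormal {E : Fin n → Hn n} (h : IsQFrame E) :
    Orthonormal ℝ fun r : Fin 4 × Fin n => quatBasis r.1 • E r.2 := by
  rw [orthonormal_iff_ite]
  rintro ⟨r, i⟩ ⟨s, j⟩
  rw [h.inner_smul, inner_quatBasis]
  by_cases hi : i = j <;> by_cases hr : r = s <;> simp [hi, hr]

theorem sum_smul_imUnit_smul (c : Fin 3 → ℝ) (x : Hn n) :
    ∑ a, c a • (imUnit a • x) = imQuat c • x := by
  have : imQuat c = ∑ a, c a • imUnit a := by
    simp only [Fin.sum_univ_three]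
    ext <;> simp [imUnit_eq_imQuat]
  rw [this, Finset.sum_smul]
  simp only [smul_assoc]

theorem imQuat_imComp {ν : ℍ[ℝ]} (h : ν.re = 0) : imQuat (imComp ν) = ν := by
  ext <;> simp [h]

theorem imComp_imQuat (c : Fin 3 → ℝ) : imComp (imQuat c) = c := by
  ext a; fin_cases a <;> rfl

theorem re_conj {q ν : ℍ[ℝ]} (h : ν.re = 0) : (q * ν * star q).re = 0 := by
  simp only [Quaternion.re_mul, Quaternion.imI_mul, Quaternion.imJ_mul, Quaternion.imK_mul,
    Quaternion.re_star, Quaternion.imI_star, Quaternion.imJ_star, Quaternion.imK_star, h]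
  ring

theorem IsQFrame.inner_im {E : Fin n → Hn n} (h : IsQFrame E) {ν : ℍ[ℝ]} (hν : ν.re = 0)
    (i j : Fin n) : ⟪ν • E i, E j⟫_ℝ = 0 := by
  rw [inner_eq_re_qdot, qdot_smul_left, h i j]
  split_ifs <;> simp [hν]

theorem IsQFrame.comp_inner {E : Fin n → Hn n} (h : IsQFrame E) {ν : ℍ[ℝ]} (a : Fin 3)
    (i : Fin n) : ⟪ν • E i, imUnit a • E i⟫_ℝ = imComp ν a := by
  rw [h.inner_smul, if_pos rfl, Quaternion.inner_def,
    imUnit_eq_imQuat]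
  fin_cases a <;> simp [Quaternion.re_mul]

/-- Conjugation by a unit quaternion moves a nonzero imaginary quaternion to one without
vanishing components. -/
theorem exists_conj_imComp_ne_zero {ν : ℍ[ℝ]} (h : ν.re = 0) (h0 : ν ≠ 0) :
    ∃ q : ℍ[ℝ], ‖q‖ = 1 ∧ ∀ a, imComp (q * ν * star q) a ≠ 0 := by
  by_cases hall : ∀ a, imComp ν a ≠ 0
  · exact ⟨1, by simp, by simpa using hall⟩
  set r := ‖ν‖ with hr
  have hr0 : 0 < r := norm_pos_iff.2 h0
  -- The target: equal components and the same norm as ν, whence b² = ν² = −r².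
  set b : ℍ[ℝ] := imQuat fun _ => r / √3 with hb
  have h3 : (√3 : ℝ) ^ 2 = 3 := Real.sq_sqrt (by norm_num)
  have h3' : 0 < √3 := by positivity
  have hνν : ν * ν = ((-(r * r) : ℝ) : ℍ[ℝ]) := by
    have := Quaternion.self_mul_star ν
    have hs : star ν = -ν := by ext <;> simp [h]
    rw [hs, mul_neg, Quaternion.normSq_eq_norm_mul_self, ← hr] at this
    rw [Quaternion.coe_neg, ← this, neg_neg]
  have hbb : b * b = ((-(r * r) : ℝ) : ℍ[ℝ]) := by
    have e : r / √3 * (r / √3) = r * r / 3 := by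
      rw [div_mul_div_comm, ← sq (√3), h3]
    ext <;> simp [hb, e]
    ring
  set p : ℍ[ℝ] := ((r * r : ℝ) : ℍ[ℝ]) - b * ν with hp
  have hpν : p * ν = b * p := by
    rw [hp, sub_mul, mul_sub, mul_assoc, hνν, ← mul_assoc, hbb]
    simp only [Quaternion.coe_neg, mul_neg, neg_mul]
    rw [Quaternion.coe_commutes (r * r) ν]
    abel
  have hp0 : p ≠ 0 := by
    intro hp0
    have h1 : b * ν = ((r * r : ℝ) : ℍ[ℝ]) := (sub_eq_zero.1 hp0).symm
    have h2 : b * (b * ν) = b * ((r * r : ℝ) : ℍ[ℝ]) := by rw [h1]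
    rw [← mul_assoc, hbb, ← Quaternion.coe_commutes (r * r) b] at h2
    have hrr : ((r * r : ℝ) : ℍ[ℝ]) ≠ 0 := by
      intro hc
      have := Quaternion.coe_injective (R := ℝ) (hc.trans Quaternion.coe_zero.symm)
      nlinarith
    have h3 : ν = -b := by
      apply mul_left_cancel₀ hrr
      rw [Quaternion.coe_neg] at h2
      rw [mul_neg, ← h2, neg_mul, neg_neg]
    apply hall
    intro a
    rw [h3]
    fin_cases a <;> simp [hb, hr0.ne']
  have hpn : ‖p‖ ≠ 0 := norm_ne_zero_iff.2 hp0
  refine ⟨(‖p‖⁻¹ : ℝ) • p, by rw [norm_smul]; simp [hpn], fun a => ?_⟩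
  have : (‖p‖⁻¹ • p) * ν * star (‖p‖⁻¹ • p) = b := by
    rw [Quaternion.star_smul, smul_mul_assoc, smul_mul_assoc, mul_smul_comm, hpν, mul_assoc,
      Quaternion.self_mul_star, Quaternion.normSq_eq_norm_mul_self, smul_smul]
    rw [← Quaternion.coe_commutes, Quaternion.coe_mul_eq_smul, smul_smul]
    rw [show ‖p‖⁻¹ * ‖p‖⁻¹ * (‖p‖ * ‖p‖) = 1 by field_simp, one_smul]
  rw [this]
  fin_cases a <;> simp [hb, hr0.ne']

/-- A family of tangent vectors with orthonormal images is a basis. -/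
theorem eq_sum_of_orthonormal_image {Λ : En n →L[ℝ] Hn n} {e : Fin n → En n}
    (h : ∀ i j, ⟪Λ (e i), Λ (e j)⟫_ℝ = if i = j then 1 else 0) (v : En n) :
    v = ∑ i, ⟪Λ v, Λ (e i)⟫_ℝ • e i := by
  have hon : Orthonormal ℝ fun i => Λ (e i) := orthonormal_iff_ite.2 h
  have hli : LinearIndependent ℝ e :=
    LinearIndependent.of_comp Λ.toLinearMap hon.linearIndependent
  have hsp : ⊤ ≤ Submodule.span ℝ (Set.range e) :=
    (hli.span_eq_top_of_card_eq_finrank' (by simp)).ge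
  let b := Module.Basis.mk hli hsp
  have hb : ∀ i, b i = e i := fun i => by simp [b]
  have hv : v = ∑ i, b.repr v i • e i := by
    conv_lhs => rw [← b.sum_repr v]
    simp only [hb]
  have hc : ∀ i, ⟪Λ v, Λ (e i)⟫_ℝ = b.repr v i := by
    intro i
    conv_lhs => rw [hv, map_sum, sum_inner]
    simp [inner_smul_left, h]
  simp only [hc]
  exact hv

/-- The isometry of `ℍⁿ` over the quaternions that maps the standard frame to a given one. -/
theorem IsQFrame.exists_isometry {E : Fin n → Hn n} (h : IsQFrame E) :
    ∃ A : Hn n ≃ₗᵢ[ℍ[ℝ]] Hn n, ∀ x, A x = ∑ m, x m • E m := by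
  let f : Hn n →ₗ[ℍ[ℝ]] Hn n :=
    { toFun := fun x => ∑ m, x m • E m
      map_add' := fun x y => by simp [add_smul, Finset.sum_add_distrib]
      map_smul' := fun q x => by simp [mul_smul, Finset.smul_sum] }
  have hq : ∀ x y, qdot (f x) (f y) = qdot x y := by
    intro x y
    change qdot (∑ m, x m • E m) (∑ m, y m • E m) = _
    simp only [qdot_sum_left, qdot_sum_right, qdot_smul_left, qdot_smul_right, h _ _]
    simp [qdot]
  have hn : ∀ x, ‖f x‖ = ‖x‖ := by
    intro x
    rw [← sq_eq_sq₀ (norm_nonneg _) (norm_nonneg _), ← real_inner_self_eq_norm_sq,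
      ← real_inner_self_eq_norm_sq, inner_eq_re_qdot, inner_eq_re_qdot, hq]
  let F : Hn n →ₗᵢ[ℍ[ℝ]] Hn n := ⟨f, hn⟩
  have hs : Function.Surjective F :=
    (LinearMap.injective_iff_surjective (f := f)).1 F.injective
  exact ⟨LinearIsometryEquiv.ofSurjective F hs, fun x => rfl⟩

theorem isQFrame_single : IsQFrame fun i : Fin n => (PiLp.single 2 i (1 : ℍ[ℝ]) : Hn n) := by
  intro i j
  simp only [qdot, PiLp.single_apply]
  rw [Finset.sum_eq_single j]
  · by_cases h : i = j <;> simp [h, eq_comm]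
  · intro b _ hb; simp [hb]
  · simp

end Quat

/-! ## Calculus on domains of `ℝⁿ` -/

section Calculus

variable {n : ℕ}

theorem contDiff_coord (j : Fin n) : ContDiff ℝ ∞ fun x : En n => x j :=
  (EuclideanSpace.proj j : En n →L[ℝ] ℝ).contDiff

theorem proj_apply (j : Fin n) (v : En n) : (EuclideanSpace.proj j : En n →L[ℝ] ℝ) v = v j := rfl

theorem snd_fderiv_apply {V : Type*} [NormedAddCommGroup V] [NormedSpace ℝ V] {F : En n → V}
    {x : En n} (hF : ContDiffAt ℝ ∞ F x) (v w : En n) :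
    fderiv ℝ (fun y => fderiv ℝ F y) x v w = fderiv ℝ (fun y => fderiv ℝ F y w) x v := by
  have h : DifferentiableAt ℝ (fun y => fderiv ℝ F y) x :=
    (hF.fderiv_right (m := ∞) (by simp)).differentiableAt (by simp)
  rw [fderiv_clm_apply h (differentiableAt_const w)]
  simp

theorem snd_fderiv_symm {V : Type*} [NormedAddCommGroup V] [NormedSpace ℝ V] {F : En n → V}
    {x : En n} (hF : ContDiffAt ℝ ∞ F x) (v w : En n) :
    fderiv ℝ (fun y => fderiv ℝ F y) x v w = fderiv ℝ (fun y => fderiv ℝ F y) x w v :=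
  (hF.isSymmSndFDerivAt (by
    rw [minSmoothness_of_isRCLikeNormedField]; exact WithTop.coe_le_coe.2 le_top)).eq v w

/-- Any splitting into a tangential and a normal vector is the orthogonal one, so h can be found
without evaluating a projection. -/
theorem secondFF_eq_of_add {F : En n → Hn n} {x v w : En n} {a b : Hn n}
    (h : fderiv ℝ (fun y => fderiv ℝ F y) x v w = a + b)
    (ha : ∃ u, fderiv ℝ F x u = a) (hb : ∀ u, ⟪fderiv ℝ F x u, b⟫_ℝ = 0) :
    secondFF F x v w = b := by
  rw [secondFF, h, map_add]
  obtain ⟨u, rfl⟩ := ha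
  rw [(Submodule.starProjection_apply_eq_zero_iff _).2, zero_add]
  · rw [Submodule.starProjection_eq_self_iff, Submodule.mem_orthogonal]
    rintro _ ⟨u, rfl⟩
    exact hb u
  · exact Submodule.le_orthogonal_orthogonal _ ⟨u, rfl⟩

theorem snd_fderiv_eq_add (F : En n → Hn n) (x v w : En n) :
    ∃ u, fderiv ℝ (fun y => fderiv ℝ F y) x v w = fderiv ℝ F x u + secondFF F x v w := by
  set z := fderiv ℝ (fun y => fderiv ℝ F y) x v w with hz
  set S := LinearMap.range (fderiv ℝ F x).toLinearMap
  have h : S.starProjection z + Sᗮ.starProjection z = z :=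
    S.starProjection_add_starProjection_orthogonal z
  obtain ⟨u, hu⟩ : S.starProjection z ∈ S := Submodule.starProjection_apply_mem S z
  refine ⟨u, ?_⟩
  rw [← h, ← hu]
  rfl

theorem inner_secondFF (F : En n → Hn n) (x v w u : En n) :
    ⟪fderiv ℝ F x u, secondFF F x v w⟫_ℝ = 0 :=
  (Submodule.mem_orthogonal _ _).1 (Submodule.starProjection_apply_mem _ _) _ ⟨u, rfl⟩

theorem secondFF_congr {F G : En n → Hn n} {x : En n} (h : F =ᶠ[𝓝 x] G) (v w : En n) :
    secondFF F x v w = secondFF G x v w := by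
  simp only [secondFF, h.fderiv_eq, h.fderiv.fderiv_eq]

theorem secondFF_smul (F : En n → Hn n) (x v w : En n) (a b : ℝ) :
    secondFF F x (a • v) (b • w) = (a * b) • secondFF F x v w := by
  simp only [secondFF, map_smul, smul_apply, smul_smul, mul_comm a b]

variable [NeZero n]

/-- The range of the first coordinate on a set. -/
abbrev firstRange (T : Set (En n)) : Set ℝ := (fun x : En n => x 0) '' T

/-- The first coordinate as a continuous linear functional. -/
abbrev projZero : En n →L[ℝ] ℝ := EuclideanSpace.proj 0

theorem isOpen_firstRange {T : Set (En n)} (hT : IsOpen T) : IsOpen (firstRange T) := by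
  refine (projZero (n := n)).isOpenMap (fun t => ⟨t • coordVec 0, ?_⟩) T hT
  simp

theorem ordConnected_firstRange {T : Set (En n)} (hT : IsPreconnected T) :
    (firstRange T).OrdConnected :=
  (hT.image _ (contDiff_coord 0).continuous.continuousOn).ordConnected

theorem hasFDerivAt_comp_coord {V : Type*} [NormedAddCommGroup V] [NormedSpace ℝ V] {γ : ℝ → V}
    {γ' : V} {x : En n} (h : HasDerivAt γ γ' (x 0)) :
    HasFDerivAt (fun y : En n => γ (y 0)) ((projZero (n := n)).smulRight γ') x := by
  have := h.hasFDerivAt.comp x (projZero (n := n)).hasFDerivAt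
  refine this.congr_fderiv ?_
  ext v
  simp

/-- On a short segment parallel to the first axis, w agrees with the smooth u. This supplies the
smoothness of β, α_j and f/f_a as functions of x₁, which the twisting data do not assume. -/
theorem contDiffOn_of_comp_coord {V : Type*} [NormedAddCommGroup V] [NormedSpace ℝ V]
    {T : Set (En n)} (hT : IsOpen T) {u : En n → V} (hu : ContDiffOn ℝ ∞ u T) {w : ℝ → V}
    (h : ∀ x ∈ T, u x = w (x 0)) : ContDiffOn ℝ ∞ w (firstRange T) := by
  rintro _ ⟨x, hx, rfl⟩
  let s : ℝ → En n := fun t => x + (t - x 0) • coordVec 0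
  have hs : ContDiff ℝ ∞ s := by fun_prop
  have hs0 : s (x 0) = x := by simp [s]
  have hst : ∀ t, s t 0 = t := fun t => by simp [s]
  have h1 : ContDiffAt ℝ ∞ (fun t => u (s t)) (x 0) :=
    ContDiffAt.comp (x 0) (by rw [hs0]; exact hu.contDiffAt (hT.mem_nhds hx)) hs.contDiffAt
  refine (h1.congr_of_eventuallyEq ?_).contDiffWithinAt
  have : s ⁻¹' T ∈ 𝓝 (x 0) :=
    hs.continuous.continuousAt.preimage_mem_nhds (by rw [hs0]; exact hT.mem_nhds hx)
  filter_upwards [this] with t ht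
  rw [h _ ht, hst]

theorem sum_erase_single {V : Type*} [AddCommGroup V] [Module ℝ V] (g : Fin n → V) {j : Fin n}
    (hj : j ≠ 0) : ∑ i ∈ Finset.univ.erase 0, (coordVec j : En n) i • g i = g j := by
  rw [Finset.sum_eq_single j]
  · simp
  · intro i _ hi; simp [hi]
  · intro h; exact absurd (Finset.mem_erase.2 ⟨hj, Finset.mem_univ _⟩) h

theorem sum_erase_single_zero {V : Type*} [AddCommGroup V] [Module ℝ V] (g : Fin n → V) :
    ∑ i ∈ Finset.univ.erase 0, (coordVec 0 : En n) i • g i = 0 := by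
  refine Finset.sum_eq_zero fun i hi => ?_
  simp [Finset.ne_of_mem_erase hi]

theorem sum_eq_zero_add_erase {V : Type*} [AddCommMonoid V] (g : Fin n → V) :
    ∑ i, g i = g 0 + ∑ i ∈ Finset.univ.erase 0, g i :=
  (Finset.add_sum_erase _ _ (Finset.mem_univ _)).symm

theorem eq_zero_smul_add_sum (v : En n) :
    v = v 0 • coordVec 0 + ∑ i ∈ Finset.univ.erase 0, v i • (coordVec i : En n) := by
  rw [← sum_eq_zero_add_erase fun i => v i • (coordVec i : En n)]
  ext j
  simp [Finset.sum_apply, Pi.single_apply]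

theorem IsLf.congr {T : Set (En n)} {f : En n → ℝ} {fc : Fin 3 → En n → ℝ} {F G : En n → Hn n}
    (h : IsLf T f fc F) (hT : IsOpen T) (hFG : EqOn G F T) : IsLf T f fc G := by
  have he : ∀ x ∈ T, G =ᶠ[𝓝 x] F := fun x hx => hFG.eventuallyEq_of_mem (hT.mem_nhds hx)
  refine ⟨h.smooth.congr hFG, ?_, ?_, ?_, ?_, ?_, ?_⟩ <;> intro x hx
  · rw [(he x hx).fderiv_eq]; exact h.isometric x hx
  · rw [(he x hx).fderiv_eq]; exact h.lagrangian x hx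
  · simp only [secondFF_congr (he x hx)]; exact h.not_totallyGeodesic x hx
  · rw [(he x hx).fderiv_eq, secondFF_congr (he x hx)]; exact h.sff_one_one x hx
  · simp only [secondFF_congr (he x hx)]; exact h.sff_one_j x hx
  · simp only [secondFF_congr (he x hx)]; exact h.sff_j_k x hx

end Calculus

/-! ## Twisting data -/

section Twisting

variable {n : ℕ} [NeZero n] {T : Set (En n)} {f : En n → ℝ} {fc : Fin 3 → En n → ℝ} {β : ℝ → ℝ}
  {α : Fin n → ℝ → ℝ}

theorem IsTwistingData.isPreconnected (h : IsTwistingData T f fc β α) : IsPreconnected T :=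
  h.simplyConnected.isPathConnected.isConnected.isPreconnected

theorem IsTwistingData.differentiableAt (h : IsTwistingData T f fc β α) {x : En n} (hx : x ∈ T) :
    DifferentiableAt ℝ f x :=
  (h.smooth.contDiffAt (h.isOpen.mem_nhds hx)).differentiableAt (by simp)

/-- Moving along the j-th axis keeps x₁ fixed, so f is affine there with slope α_j(x₁); no
regularity of β and α is needed. -/
theorem IsTwistingData.fderiv_coordVec (h : IsTwistingData T f fc β α) {x : En n} (hx : x ∈ T)
    {j : Fin n} (hj : j ≠ 0) : fderiv ℝ f x (coordVec j) = α j (x 0) := by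
  let s : ℝ → En n := fun t => x + t • coordVec j
  have hs : HasDerivAt s (coordVec j) 0 := by
    simpa [s] using ((hasDerivAt_id (0 : ℝ)).smul_const (coordVec j : En n)).const_add x
  have hs0 : s 0 = x := by simp [s]
  have h1 : HasDerivAt (fun t => f (s t)) (fderiv ℝ f x (coordVec j)) 0 := by
    have := (h.differentiableAt hx).hasFDerivAt
    rw [← hs0] at this
    have h1 := this.comp_hasDerivAt 0 hs
    rwa [hs0] at h1
  have h2 : HasDerivAt (fun t : ℝ => f x + t * α j (x 0)) (α j (x 0)) 0 := by
    simpa using ((hasDerivAt_id (0 : ℝ)).mul_const (α j (x 0))).const_add (f x)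
  refine h1.unique (h2.congr_of_eventuallyEq ?_)
  have : s ⁻¹' T ∈ 𝓝 0 :=
    hs.continuousAt.preimage_mem_nhds (by rw [hs0]; exact h.isOpen.mem_nhds hx)
  filter_upwards [this] with t ht
  rw [h.affine _ ht, h.affine _ hx]
  have e0 : s t 0 = x 0 := by simp [s, hj.symm]
  have e1 : ∑ i ∈ Finset.univ.erase 0, α i (x 0) * s t i =
      ∑ i ∈ Finset.univ.erase 0, α i (x 0) * x i + t * α j (x 0) := by
    rw [← sum_erase_single (fun i => t * α i (x 0)) hj, ← Finset.sum_add_distrib]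
    refine Finset.sum_congr rfl fun i _ => ?_
    simp only [s, PiLp.add_apply, PiLp.smul_apply, smul_eq_mul]
    ring
  rw [e0, e1]
  ring

theorem IsTwistingData.contDiffOn_alpha (h : IsTwistingData T f fc β α) {j : Fin n} (hj : j ≠ 0) :
    ContDiffOn ℝ ∞ (α j) (firstRange T) := by
  refine contDiffOn_of_comp_coord h.isOpen (u := fun x => fderiv ℝ f x (coordVec j)) ?_
    fun x hx => h.fderiv_coordVec hx hj
  exact (h.smooth.fderiv_of_isOpen h.isOpen (m := ∞) (by simp)).clm_apply contDiffOn_const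

theorem contDiffOn_comp_firstRange {V : Type*} [NormedAddCommGroup V] [NormedSpace ℝ V]
    {γ : ℝ → V} {J : Set ℝ} {T : Set (En n)} (h : ContDiffOn ℝ ∞ γ J)
    (hT : ∀ x ∈ T, x 0 ∈ J) : ContDiffOn ℝ ∞ (fun x : En n => γ (x 0)) T :=
  h.comp (contDiff_coord 0).contDiffOn hT

theorem IsTwistingData.contDiffOn_beta (h : IsTwistingData T f fc β α) :
    ContDiffOn ℝ ∞ β (firstRange T) := by
  refine contDiffOn_of_comp_coord h.isOpen
    (u := fun x => f x - ∑ j ∈ Finset.univ.erase 0, α j (x 0) * x j) ?_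
    fun x hx => by rw [h.affine x hx]; ring
  refine h.smooth.sub (ContDiffOn.sum fun j hj => ?_)
  exact (contDiffOn_comp_firstRange (h.contDiffOn_alpha (Finset.ne_of_mem_erase hj))
    fun x hx => mem_image_of_mem _ hx).mul (contDiff_coord j).contDiffOn

theorem IsTwistingData.exists_ratio (h : IsTwistingData T f fc β α) :
    ∃ φ : Fin 3 → ℝ → ℝ, (∀ a, ∀ x ∈ T, f x / fc a x = φ a (x 0)) ∧
      ∀ a, ContDiffOn ℝ ∞ (φ a) (firstRange T) := by
  choose φ hφ using h.ratio
  exact ⟨φ, hφ, fun a => contDiffOn_of_comp_coord h.isOpen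
    (h.smooth.div (h.smooth_fc a) (h.fc_ne_zero a)) (hφ a)⟩

end Twisting

/-! ## Maps in normal form -/

section NormalForm

variable {n : ℕ} [NeZero n]

/-- `D` and the quaternionic orthonormal frame `E` satisfy the structure equations of the
immersions `x ↦ D(x₁) + ∑_{j ≥ 2} x_j E_j(x₁)` with `f = β + ∑ α_j x_j` and `f / f_a = φ_a`. -/
structure IsNormalForm (J : Set ℝ) (D : ℝ → Hn n) (E : Fin n → ℝ → Hn n) (β : ℝ → ℝ)
    (α : Fin n → ℝ → ℝ) (φ : Fin 3 → ℝ → ℝ) : Prop where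
  smooth_D : ContDiffOn ℝ ∞ D J
  smooth_E : ∀ i, ContDiffOn ℝ ∞ (E i) J
  frame : ∀ t ∈ J, IsQFrame fun i => E i t
  deriv_D : ∀ t ∈ J, HasDerivAt D (β t • E 0 t) t
  deriv_E_zero : ∀ t ∈ J, HasDerivAt (E 0)
    (imQuat (fun a => φ a t) • E 0 t - ∑ j ∈ Finset.univ.erase 0, α j t • E j t) t
  deriv_E : ∀ t ∈ J, ∀ j, j ≠ 0 → HasDerivAt (E j) (α j t • E 0 t) t

/-- The map `x ↦ D(x₁) + ∑_{j ≥ 2} x_j E_j(x₁)`. -/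
def nfMap (D : ℝ → Hn n) (E : Fin n → ℝ → Hn n) (x : En n) : Hn n :=
  D (x 0) + ∑ j ∈ Finset.univ.erase 0, x j • E j (x 0)

variable {J : Set ℝ} {D : ℝ → Hn n} {E : Fin n → ℝ → Hn n} {β : ℝ → ℝ} {α : Fin n → ℝ → ℝ}
  {φ : Fin 3 → ℝ → ℝ}

theorem IsNormalForm.contDiffOn_nfMap (h : IsNormalForm J D E β α φ) {T : Set (En n)}
    (hT : ∀ x ∈ T, x 0 ∈ J) : ContDiffOn ℝ ∞ (nfMap D E) T := by
  refine (contDiffOn_comp_firstRange h.smooth_D hT).add (ContDiffOn.sum fun j _ => ?_)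
  exact (contDiff_coord j).contDiffOn.smul (contDiffOn_comp_firstRange (h.smooth_E j) hT)

/-- D' and all E_j' with j ≠ 0 are multiples of E_0. Their coefficients add up to the twisting
function, so ∂_0 maps to fE_0 and ∂_j to E_j. -/
theorem IsNormalForm.fderiv_nfMap (h : IsNormalForm J D E β α φ) {x : En n} (hx : x 0 ∈ J)
    (v : En n) : fderiv ℝ (nfMap D E) x v =
      (v 0 * (β (x 0) + ∑ j ∈ Finset.univ.erase 0, α j (x 0) * x j)) • E 0 (x 0) +
        ∑ j ∈ Finset.univ.erase 0, v j • E j (x 0) := by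
  have h1 : HasFDerivAt (nfMap D E) _ x :=
    (hasFDerivAt_comp_coord (h.deriv_D _ hx)).add (HasFDerivAt.fun_sum fun j hj =>
      (EuclideanSpace.proj j : En n →L[ℝ] ℝ).hasFDerivAt.smul
        (hasFDerivAt_comp_coord (h.deriv_E _ hx j (Finset.ne_of_mem_erase hj))))
  rw [h1.fderiv]
  simp only [add_apply, ContinuousLinearMap.smulRight_apply,
    sum_apply, smul_apply, proj_apply]
  rw [Finset.sum_add_distrib, mul_add, add_smul, Finset.mul_sum, Finset.sum_smul, mul_smul,
    add_assoc]
  congr 2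
  refine Finset.sum_congr rfl fun j _ => ?_
  simp only [smul_smul]
  congr 1
  ring

theorem IsNormalForm.fderiv_coordVec_zero (h : IsNormalForm J D E β α φ) {x : En n}
    (hx : x 0 ∈ J) : fderiv ℝ (nfMap D E) x (coordVec 0) =
      (β (x 0) + ∑ j ∈ Finset.univ.erase 0, α j (x 0) * x j) • E 0 (x 0) := by
  rw [h.fderiv_nfMap hx, sum_erase_single_zero]
  simp

theorem IsNormalForm.fderiv_coordVec (h : IsNormalForm J D E β α φ) {x : En n}
    (hx : x 0 ∈ J) {j : Fin n} (hj : j ≠ 0) :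
    fderiv ℝ (nfMap D E) x (coordVec j) = E j (x 0) := by
  rw [h.fderiv_nfMap hx, sum_erase_single _ hj]
  simp [hj.symm]

/-- Among the derivatives of the frame only E_0' leaves the real span of the frame, through the term
φE_0, and φ being imaginary makes this term normal. It enters with factor f for each first component
of v and w. -/
theorem IsNormalForm.secondFF_nfMap (h : IsNormalForm J D E β α φ) (hJ : IsOpen J)
    {f : En n → ℝ} {x : En n} (hx : x 0 ∈ J) (hfd : DifferentiableAt ℝ f x)
    (hf : ∀ᶠ y in 𝓝 x, f y = β (y 0) + ∑ j ∈ Finset.univ.erase 0, α j (y 0) * y j)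
    (hf0 : f x ≠ 0) (v w : En n) :
    secondFF (nfMap D E) x v w = (v 0 * w 0 * f x) • (imQuat (fun a => φ a (x 0)) • E 0 (x 0)) := by
  have hJx : {y : En n | y 0 ∈ J} ∈ 𝓝 x :=
    (contDiff_coord 0).continuous.continuousAt.preimage_mem_nhds (hJ.mem_nhds hx)
  have hsm : ContDiffAt ℝ ∞ (nfMap D E) x :=
    (h.contDiffOn_nfMap (T := {y : En n | y 0 ∈ J}) fun _ hy => hy).contDiffAt hJx
  have he : (fun y => fderiv ℝ (nfMap D E) y w) =ᶠ[𝓝 x] fun y =>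
      (w 0 * f y) • E 0 (y 0) + ∑ j ∈ Finset.univ.erase 0, w j • E j (y 0) := by
    filter_upwards [hJx, hf] with y hy hfy
    rw [h.fderiv_nfMap hy, hfy]
  have hd : HasFDerivAt (fun y =>
      (w 0 * f y) • E 0 (y 0) + ∑ j ∈ Finset.univ.erase 0, w j • E j (y 0)) _ x :=
    ((hfd.hasFDerivAt.const_mul (w 0)).smul (hasFDerivAt_comp_coord (h.deriv_E_zero _ hx))).add
      (HasFDerivAt.fun_sum fun j hj => (hasFDerivAt_comp_coord
        (h.deriv_E _ hx j (Finset.ne_of_mem_erase hj))).const_smul (w j))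
  have hfr := h.frame _ hx
  have hE0 : ∃ u, fderiv ℝ (nfMap D E) x u = E 0 (x 0) :=
    ⟨(f x)⁻¹ • coordVec 0, by
      rw [map_smul, h.fderiv_coordVec_zero hx, ← hf.self_of_nhds, smul_smul, inv_mul_cancel₀ hf0,
        one_smul]⟩
  have hEj : ∀ j ∈ Finset.univ.erase (0 : Fin n), ∃ u, fderiv ℝ (nfMap D E) x u = E j (x 0) :=
    fun j hj => ⟨coordVec j, h.fderiv_coordVec hx (Finset.ne_of_mem_erase hj)⟩
  let S := LinearMap.range (fderiv ℝ (nfMap D E) x).toLinearMap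
  have key : fderiv ℝ (nfMap D E) x v ∈ S := ⟨v, rfl⟩
  have h0S : E 0 (x 0) ∈ S := hE0
  have hjS : ∀ j ∈ Finset.univ.erase (0 : Fin n), E j (x 0) ∈ S := hEj
  refine secondFF_eq_of_add (a := (w 0 * fderiv ℝ f x v) • E 0 (x 0)
    - (v 0 * w 0 * f x) • ∑ j ∈ Finset.univ.erase 0, α j (x 0) • E j (x 0)
    + ∑ j ∈ Finset.univ.erase 0, (w j * v 0 * α j (x 0)) • E 0 (x 0)) ?_ ?_ ?_
  · rw [snd_fderiv_apply hsm, he.fderiv_eq, hd.fderiv]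
    simp only [add_apply, ContinuousLinearMap.smulRight_apply,
      sum_apply, smul_apply, proj_apply, smul_eq_mul, smul_sub,
      smul_smul]
    rw [show w 0 * f x * v 0 = v 0 * w 0 * f x by ring]
    simp only [mul_assoc]
    abel
  · change _ ∈ S
    refine S.add_mem (S.sub_mem (S.smul_mem _ h0S) (S.smul_mem _ (S.sum_mem fun j hj =>
      S.smul_mem _ (hjS j hj)))) (S.sum_mem fun j _ => S.smul_mem _ h0S)
  · intro u
    rw [h.fderiv_nfMap hx, real_inner_comm, inner_add_right, inner_sum, inner_smul_left]
    simp only [inner_smul_right, inner_smul_left, hfr.inner_im (imQuat_re _)]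
    simp

theorem IsNormalForm.isLf {T : Set (En n)} {f : En n → ℝ} {fc : Fin 3 → En n → ℝ}
    (hd : IsTwistingData T f fc β α) (hφ : ∀ a, ∀ x ∈ T, f x / fc a x = φ a (x 0))
    (h : IsNormalForm J D E β α φ) (hJ : IsOpen J) (hT : ∀ x ∈ T, x 0 ∈ J) :
    IsLf T f fc (nfMap D E) := by
  have hff : ∀ x ∈ T, ∀ v w, secondFF (nfMap D E) x v w =
      (v 0 * w 0 * f x) • (imQuat (fun a => φ a (x 0)) • E 0 (x 0)) := fun x hx v w =>
    h.secondFF_nfMap hJ (hT x hx) (hd.differentiableAt hx)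
      (Filter.mem_of_superset (hd.isOpen.mem_nhds hx) hd.affine) (hd.pos x hx).ne' v w
  have hD : ∀ x ∈ T, ∀ v, fderiv ℝ (nfMap D E) x v =
      ∑ i, (if i = 0 then v 0 * f x else v i) • E i (x 0) := by
    intro x hx v
    rw [h.fderiv_nfMap (hT x hx), sum_eq_zero_add_erase, if_pos rfl, ← hd.affine x hx]
    congr 1
    exact Finset.sum_congr rfl fun j hj => by rw [if_neg (Finset.ne_of_mem_erase hj)]
  have h11 : ∀ x ∈ T, secondFF (nfMap D E) x ((1 / f x) • coordVec 0) ((1 / f x) • coordVec 0) =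
      ∑ a : Fin 3, (1 / fc a x) • (imUnit a • fderiv ℝ (nfMap D E) x ((1 / f x) • coordVec 0)) := by
    intro x hx
    have hf := (hd.pos x hx).ne'
    rw [hff x hx, map_smul, h.fderiv_coordVec_zero (hT x hx), ← hd.affine x hx, smul_smul,
      one_div_mul_cancel hf, one_smul, ← sum_smul_imUnit_smul, Finset.smul_sum]
    refine Finset.sum_congr rfl fun a _ => ?_
    rw [smul_smul, ← hφ a x hx]
    congr 1
    simp
    field_simp
  refine ⟨h.contDiffOn_nfMap hT, ?_, ?_, ?_, h11, ?_, ?_⟩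
  · intro x hx i j
    have hfr := h.frame _ (hT x hx)
    by_cases hi : i = 0 <;> by_cases hj : j = 0
    · subst hi hj
      rw [h.fderiv_coordVec_zero (hT x hx), ← hd.affine x hx, inner_smul_left, inner_smul_right,
        hfr.inner, twistedMetric]
      simp [sq]
    · subst hi
      rw [h.fderiv_coordVec_zero (hT x hx), h.fderiv_coordVec (hT x hx) hj, inner_smul_left,
        hfr.inner, twistedMetric]
      simp [Ne.symm hj]
    · subst hj
      rw [h.fderiv_coordVec_zero (hT x hx), h.fderiv_coordVec (hT x hx) hi, inner_smul_right,
        hfr.inner, twistedMetric]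
      simp [hi]
    · rw [h.fderiv_coordVec (hT x hx) hj, h.fderiv_coordVec (hT x hx) hi, hfr.inner,
        twistedMetric]
      simp [hi]
  · intro x hx a v w
    have hfr := h.frame _ (hT x hx)
    rw [hD x hx, hD x hx, Finset.smul_sum, sum_inner]
    refine Finset.sum_eq_zero fun i _ => ?_
    rw [inner_sum]
    refine Finset.sum_eq_zero fun j _ => ?_
    rw [smul_comm, inner_smul_left, inner_smul_right, hfr.inner_imUnit]
    simp
  -- If h(∂_0, ∂_0) vanished, then so would its I-component, which involves the nowhere zero
  -- quotient f/f_1.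
  · intro x hx
    refine ⟨coordVec 0, coordVec 0, fun h0 => ?_⟩
    rw [hff x hx] at h0
    have hf := (hd.pos x hx).ne'
    have hfr := h.frame _ (hT x hx)
    have h1 : imQuat (fun a => φ a (x 0)) • E 0 (x 0) = 0 := by simpa [hf] using h0
    have h2 := hfr.comp_inner (ν := imQuat fun a => φ a (x 0)) 0 0
    rw [h1, inner_zero_left, imComp_imQuat, ← hφ 0 x hx] at h2
    exact div_ne_zero hf (hd.fc_ne_zero 0 x hx) h2.symm
  · intro x hx j hj
    rw [hff x hx]
    simp [hj.symm]
  · intro x hx j k hj _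
    rw [hff x hx]
    simp [hj.symm]

end NormalForm

/-! ## The frame equations -/

section Frames

variable {n : ℕ}

/-- The bilinear map `(x, y) ↦ x̄_m y_k`. -/
def entryL (m k : Fin n) : Hn n →L[ℝ] Hn n →L[ℝ] ℍ[ℝ] :=
  LinearMap.mkContinuous₂ (LinearMap.mk₂ ℝ (fun x y : Hn n => star (x m) * y k)
    (fun x y z => by simp [add_mul]) (fun c x y => by
      rw [PiLp.smul_apply, Quaternion.star_smul, smul_mul_assoc])
    (fun x y z => by simp [mul_add]) (fun c x y => by simp)) 1 (by
      intro x y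
      simp only [LinearMap.mk₂_apply, norm_mul, norm_star, one_mul]
      gcongr
      · exact PiLp.norm_apply_le x m
      · exact PiLp.norm_apply_le y k)

theorem entryL_apply (m k : Fin n) (x y : Hn n) : entryL m k x y = star (x m) * y k := rfl

/-- The square matrix of a frame is unitary on either side. -/
theorem isQFrame_iff_sum (E : Fin n → Hn n) :
    IsQFrame E ↔ ∀ m k, ∑ i, star (E i m) * E i k = if m = k then 1 else 0 := by
  let U : Matrix (Fin n) (Fin n) ℍ[ℝ] := fun i m => E i m
  let W : Matrix (Fin n) (Fin n) ℍ[ℝ] := fun m i => star (E i m)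
  have h1 : IsQFrame E ↔ U * W = 1 := by
    rw [← Matrix.ext_iff]
    refine forall_congr' fun i => forall_congr' fun j => ?_
    rw [Matrix.mul_apply, Matrix.one_apply]
    rfl
  have h2 : (∀ m k, ∑ i, star (E i m) * E i k = if m = k then 1 else 0) ↔ W * U = 1 := by
    rw [← Matrix.ext_iff]
    refine forall_congr' fun i => forall_congr' fun j => ?_
    rw [Matrix.mul_apply, Matrix.one_apply]
  -- A one-sided inverse of a square quaternionic matrix is two-sided. The row relations define a
  -- frame, but the column relations are the ones preserved by the structure equations.
  rw [h1, h2, mul_eq_one_comm]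

/-- In matrix form: since EE* = 1, the relation E*Y = Q gives Y = EQ. -/
theorem sum_smul_of_isQFrame {E : Fin n → Hn n} (h : IsQFrame E) {Y : Fin n → Hn n}
    {Q : Fin n → Hn n} (hQ : ∀ m k, ∑ i, star (E i m) * Y i k = Q m k) (i : Fin n) :
    Y i = ∑ m, E i m • Q m := by
  ext1 k
  simp only [WithLp.ofLp_sum, Finset.sum_apply, PiLp.smul_apply, smul_eq_mul, ← hQ,
    Finset.mul_sum]
  rw [Finset.sum_comm]
  have : ∀ j, ∑ m, E i m * (star (E j m) * Y j k) = (if i = j then 1 else 0) * Y j k := by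
    intro j
    rw [← h i j, qdot, Finset.sum_mul]
    simp only [mul_assoc]
  simp [this]

theorem hasFDerivAt_smulRight_of_hasDerivAt {V : Type*} [NormedAddCommGroup V] [NormedSpace ℝ V]
    {γ : ℝ → V} {γ' : V} {t : ℝ} (h : HasDerivAt γ γ' t) :
    HasFDerivAt γ ((ContinuousLinearMap.id ℝ ℝ).smulRight γ') t := by
  refine h.hasFDerivAt.congr_fderiv ?_
  ext
  simp

theorem contDiffOn_of_hasDerivAt {V : Type*} [NormedAddCommGroup V] [NormedSpace ℝ V] {J : Set ℝ}
    (hJ : IsOpen J) {g G : ℝ → V} (hg : ContDiffOn ℝ ∞ g J) (hG : ∀ t ∈ J, HasDerivAt G (g t) t) :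
    ContDiffOn ℝ ∞ G J := by
  rw [contDiffOn_infty_iff_deriv_of_isOpen hJ]
  exact ⟨fun t ht => (hG t ht).differentiableAt.differentiableWithinAt,
    hg.congr fun t ht => (hG t ht).deriv⟩

theorem hasDerivAt_primitive {V : Type*} [NormedAddCommGroup V] [NormedSpace ℝ V]
    [CompleteSpace V] {J : Set ℝ} (hJ : IsOpen J) (hc : J.OrdConnected) {g : ℝ → V}
    (hg : ContinuousOn g J) {t₀ t : ℝ} (ht₀ : t₀ ∈ J) (ht : t ∈ J) :
    HasDerivAt (fun t => ∫ s in t₀..t, g s) (g t) t :=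
  intervalIntegral.integral_hasDerivAt_right
    (hg.mono (hc.uIcc_subset ht₀ ht)).intervalIntegrable
    (hg.stronglyMeasurableAtFilter hJ t ht) (hg.continuousAt (hJ.mem_nhds ht))

theorem contDiffOn_primitive {V : Type*} [NormedAddCommGroup V] [NormedSpace ℝ V]
    [CompleteSpace V] {J : Set ℝ} (hJ : IsOpen J) (hc : J.OrdConnected) {g : ℝ → V}
    (hg : ContDiffOn ℝ ∞ g J) {t₀ : ℝ} (ht₀ : t₀ ∈ J) :
    ContDiffOn ℝ ∞ (fun t => ∫ s in t₀..t, g s) J :=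
  contDiffOn_of_hasDerivAt hJ hg fun _ ht => hasDerivAt_primitive hJ hc hg.continuousOn ht₀ ht

variable [NeZero n]

/-- The right hand side of the structure equations of a frame. -/
def frameOp (q : ℍ[ℝ]) (a : Fin n → ℝ) (E : Fin n → Hn n) (i : Fin n) : Hn n :=
  if i = 0 then q • E 0 - ∑ j ∈ Finset.univ.erase 0, a j • E j else a i • E 0

theorem frameOp_zero (q : ℍ[ℝ]) (a : Fin n → ℝ) (E : Fin n → Hn n) :
    frameOp q a E 0 = q • E 0 - ∑ j ∈ Finset.univ.erase 0, a j • E j := if_pos rfl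

theorem frameOp_of_ne (q : ℍ[ℝ]) (a : Fin n → ℝ) (E : Fin n → Hn n) {i : Fin n} (hi : i ≠ 0) :
    frameOp q a E i = a i • E 0 := if_neg hi

/-- The frame equations are skew-hermitian. -/
theorem frameOp_skew {q : ℍ[ℝ]} (hq : q.re = 0) (a : Fin n → ℝ) (X Y : Fin n → Hn n)
    (m k : Fin n) :
    ∑ i, (star (frameOp q a X i m) * Y i k + star (X i m) * frameOp q a Y i k) = 0 := by
  have hs : star q = -q := by ext <;> simp [hq]
  have hr : ∀ (c : ℝ) (x : ℍ[ℝ]), star (c • x) = c • star x := fun c x => Quaternion.star_smul c x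
  rw [sum_eq_zero_add_erase, frameOp_zero, frameOp_zero]
  have h2 : ∑ i ∈ Finset.univ.erase 0,
      (star (frameOp q a X i m) * Y i k + star (X i m) * frameOp q a Y i k) =
      ∑ i ∈ Finset.univ.erase 0, (a i • (star (X 0 m) * Y i k) + a i • (star (X i m) * Y 0 k)) := by
    refine Finset.sum_congr rfl fun i hi => ?_
    rw [frameOp_of_ne _ _ _ (Finset.ne_of_mem_erase hi),
      frameOp_of_ne _ _ _ (Finset.ne_of_mem_erase hi)]
    simp only [PiLp.smul_apply, hr, smul_mul_assoc, mul_smul_comm]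
  rw [h2]
  simp only [PiLp.sub_apply, PiLp.smul_apply, WithLp.ofLp_sum, Finset.sum_apply, smul_eq_mul,
    star_sub, star_mul, star_sum, hr, hs, sub_mul, mul_sub, Finset.sum_mul, Finset.mul_sum,
    smul_mul_assoc, mul_smul_comm, Finset.sum_add_distrib, mul_assoc, neg_mul, mul_neg]
  abel

/-- Two solutions of the frame equations have constant mutual products. -/
theorem exists_sum_entry_eq {V : Type*} [NormedAddCommGroup V] [NormedSpace ℝ V] {T : Set V}
    (hT : IsOpen T) (hT' : IsPreconnected T) {X Y : Fin n → V → Hn n} {l : V → V →L[ℝ] ℝ}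
    {q : V → ℍ[ℝ]} {a : V → Fin n → ℝ} (hq : ∀ x ∈ T, (q x).re = 0)
    (hX : ∀ x ∈ T, ∀ i, HasFDerivAt (X i)
      ((l x).smulRight (frameOp (q x) (a x) (fun i => X i x) i)) x)
    (hY : ∀ x ∈ T, ∀ i, HasFDerivAt (Y i)
      ((l x).smulRight (frameOp (q x) (a x) (fun i => Y i x) i)) x) (m k : Fin n) :
    ∃ c : ℍ[ℝ], ∀ x ∈ T, ∑ i, star (X i x m) * Y i x k = c := by
  -- The derivative of X*Y is the form l times (ΩX)*Y + X*(ΩY), and this vanishes by skewness.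
  -- Allowing an arbitrary form l covers curves on an interval and frames on a domain alike.
  have hd : ∀ x ∈ T, HasFDerivAt (fun x => ∑ i, star (X i x m) * Y i x k) (0 : V →L[ℝ] ℍ[ℝ]) x := by
    intro x hx
    have h1 := HasFDerivAt.fun_sum fun i (_ : i ∈ Finset.univ) =>
      (entryL m k).hasFDerivAt_of_bilinear (hX x hx i) (hY x hx i)
    refine h1.congr_fderiv ?_
    ext1 v
    have h2 := frameOp_skew (hq x hx) (a x) (fun i => X i x) (fun i => Y i x) m k
    have h3 : ∀ (c : ℝ) (x : ℍ[ℝ]), star (c • x) = c • star x := fun c x => Quaternion.star_smul c x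
    have h4 : ∑ i, l x v • (star (frameOp (q x) (a x) (fun i => X i x) i m) * Y i x k +
        star (X i x m) * frameOp (q x) (a x) (fun i => Y i x) i k) = 0 := by
      rw [← Finset.smul_sum, h2, smul_zero]
    simp only [sum_apply, add_apply, ContinuousLinearMap.precompR_apply,
      ContinuousLinearMap.precompL_apply, ContinuousLinearMap.compL_apply,
      ContinuousLinearMap.comp_apply, ContinuousLinearMap.smulRight_apply, entryL_apply,
      PiLp.smul_apply, h3, mul_smul_comm, smul_mul_assoc, zero_apply]
    rw [← h4]
    refine Finset.sum_congr rfl fun i _ => ?_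
    rw [smul_add, add_comm]
  exact hT.exists_is_const_of_fderiv_eq_zero hT'
    (fun x hx => (hd x hx).differentiableAt.differentiableWithinAt) fun x hx => (hd x hx).fderiv

variable {J : Set ℝ} {β : ℝ → ℝ} {α : Fin n → ℝ → ℝ} {φ : Fin 3 → ℝ → ℝ}

theorem isNormalForm_iff {D : ℝ → Hn n} {E : Fin n → ℝ → Hn n} :
    IsNormalForm J D E β α φ ↔ ContDiffOn ℝ ∞ D J ∧ (∀ i, ContDiffOn ℝ ∞ (E i) J) ∧
      (∀ t ∈ J, IsQFrame fun i => E i t) ∧ (∀ t ∈ J, HasDerivAt D (β t • E 0 t) t) ∧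
      ∀ t ∈ J, ∀ i, HasDerivAt (E i)
        (frameOp (imQuat fun a => φ a t) (fun j => α j t) (fun i => E i t) i) t := by
  constructor
  · refine fun h => ⟨h.smooth_D, h.smooth_E, h.frame, h.deriv_D, fun t ht i => ?_⟩
    by_cases hi : i = 0
    · subst hi
      rw [frameOp_zero]
      exact h.deriv_E_zero t ht
    · rw [frameOp_of_ne _ _ _ hi]
      exact h.deriv_E t ht i hi
  · rintro ⟨h1, h2, h3, h4, h5⟩
    refine ⟨h1, h2, h3, h4, fun t ht => ?_, fun t ht j hj => ?_⟩
    · have := h5 t ht 0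
      rwa [frameOp_zero] at this
    · have := h5 t ht j
      rwa [frameOp_of_ne _ _ _ hj] at this

/-- Existence of solutions of the structure equations. -/
theorem exists_isNormalForm (hJ : IsOpen J) (hc : J.OrdConnected) (hβ : ContDiffOn ℝ ∞ β J)
    (hα : ∀ j, j ≠ 0 → ContDiffOn ℝ ∞ (α j) J) (hφ : ∀ a, ContDiffOn ℝ ∞ (φ a) J) {t₀ : ℝ}
    (ht₀ : t₀ ∈ J) : ∃ (D : ℝ → Hn n) (E : Fin n → ℝ → Hn n), IsNormalForm J D E β α φ ∧
      ∀ i, E i t₀ = PiLp.single 2 i (1 : ℍ[ℝ]) := by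
  let pr : Fin n → (Fin n → Hn n) →L[ℝ] Hn n := fun i => ContinuousLinearMap.proj i
  let A : ℝ → (Fin n → Hn n) →L[ℝ] (Fin n → Hn n) := fun t => ContinuousLinearMap.pi fun i =>
    if i = 0 then ∑ a, φ a t • (imUnit a • pr 0) - ∑ j ∈ Finset.univ.erase 0, α j t • pr j
    else α i t • pr 0
  have hA : ∀ t y i, A t y i = frameOp (imQuat fun a => φ a t) (fun j => α j t) y i := by
    intro t y i
    by_cases hi : i = 0
    · subst hi
      rw [frameOp_zero, ← sum_smul_imUnit_smul]
      simp [A, pr]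
    · rw [frameOp_of_ne _ _ _ hi]
      simp [A, pr, hi]
  have hAs : ContDiffOn ℝ ∞ A J := by
    rw [contDiffOn_clm_apply]
    intro y
    rw [contDiffOn_pi]
    intro i
    by_cases hi : i = 0
    · subst hi
      simp only [hA, frameOp_zero, ← sum_smul_imUnit_smul]
      exact (ContDiffOn.sum fun a _ => (hφ a).smul contDiffOn_const).sub
        (ContDiffOn.sum fun j hj => (hα j (Finset.ne_of_mem_erase hj)).smul contDiffOn_const)
    · simp only [hA, frameOp_of_ne _ _ _ hi]
      exact (hα i hi).smul contDiffOn_const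
  obtain ⟨y, hy0, hy⟩ := linearODE_exists hJ hc hAs.continuousOn ht₀
    fun i : Fin n => (PiLp.single 2 i (1 : ℍ[ℝ]) : Hn n)
  have hys := linearODE_contDiffOn hJ hAs hy
  rw [contDiffOn_pi] at hys
  have hyi : ∀ t ∈ J, ∀ i, HasDerivAt (fun t => y t i)
      (frameOp (imQuat fun a => φ a t) (fun j => α j t) (y t) i) t := by
    intro t ht i
    rw [← hA]
    exact hasDerivAt_pi.1 (hy t ht) i
  -- Compare the solution with itself: the column Gram matrix is constant and equals the identity at
  -- `t₀`.
  have hfr : ∀ t ∈ J, IsQFrame fun i => y t i := by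
    intro t ht
    rw [isQFrame_iff_sum]
    intro m k
    obtain ⟨c, hc'⟩ := exists_sum_entry_eq hJ hc.isPreconnected (X := fun i t => y t i)
      (Y := fun i t => y t i) (l := fun _ => ContinuousLinearMap.id ℝ ℝ)
      (q := fun t => imQuat fun a => φ a t) (a := fun t j => α j t) (fun _ _ => imQuat_re _)
      (fun t ht i => hasFDerivAt_smulRight_of_hasDerivAt (hyi t ht i))
      (fun t ht i => hasFDerivAt_smulRight_of_hasDerivAt (hyi t ht i)) m k
    rw [hc' t ht, ← hc' t₀ ht₀, hy0]
    exact (isQFrame_iff_sum _).1 isQFrame_single m k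
  have hg : ContDiffOn ℝ ∞ (fun t => β t • y t 0) J := hβ.smul (hys 0)
  exact ⟨_, fun i t => y t i, isNormalForm_iff.2 ⟨contDiffOn_primitive hJ hc hg ht₀, hys, hfr,
    fun t ht => hasDerivAt_primitive hJ hc hg.continuousOn ht₀ ht, hyi⟩, fun i => congrFun hy0 i⟩

end Frames

/-! ## Structure equations of the immersions `L_f` and part (a) -/

section StructureEquations

variable {n : ℕ} [NeZero n] {T : Set (En n)} {f : En n → ℝ} {fc : Fin 3 → En n → ℝ} {β : ℝ → ℝ}
  {α : Fin n → ℝ → ℝ} {φ : Fin 3 → ℝ → ℝ} {F : En n → Hn n}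

/-- The unit frame `f⁻¹ ∂₁F, ∂₂F, …, ∂ₙF`. -/
def unitFrame (f : En n → ℝ) (F : En n → Hn n) (i : Fin n) (x : En n) : Hn n :=
  if i = 0 then (f x)⁻¹ • fderiv ℝ F x (coordVec 0) else fderiv ℝ F x (coordVec i)

theorem unitFrame_zero (f : En n → ℝ) (F : En n → Hn n) (x : En n) :
    unitFrame f F 0 x = (f x)⁻¹ • fderiv ℝ F x (coordVec 0) := if_pos rfl

theorem unitFrame_of_ne (f : En n → ℝ) (F : En n → Hn n) {i : Fin n} (hi : i ≠ 0) (x : En n) :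
    unitFrame f F i x = fderiv ℝ F x (coordVec i) := if_neg hi

/-- The coordinate vectors whose images are the unit frame. -/
def unitVec (f : En n → ℝ) (i : Fin n) (x : En n) : En n :=
  if i = 0 then (f x)⁻¹ • coordVec 0 else coordVec i

theorem fderiv_unitVec (f : En n → ℝ) (F : En n → Hn n) (i : Fin n) (x : En n) :
    fderiv ℝ F x (unitVec f i x) = unitFrame f F i x := by
  unfold unitVec unitFrame
  split_ifs <;> simp

theorem IsLf.inner_unitFrame (h : IsLf T f fc F) {x : En n} (hx : x ∈ T) (hf : f x ≠ 0)
    (i j : Fin n) : ⟪unitFrame f F i x, unitFrame f F j x⟫_ℝ = if i = j then 1 else 0 := by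
  have hm := h.isometric x hx
  by_cases hi : i = 0 <;> by_cases hj : j = 0
  · subst hi hj
    rw [unitFrame_zero, inner_smul_left, inner_smul_right, hm, twistedMetric]
    simp
    field_simp
  · subst hi
    rw [unitFrame_zero, unitFrame_of_ne _ _ hj, inner_smul_left, hm, twistedMetric]
    simp [Ne.symm hj]
  · subst hj
    rw [unitFrame_zero, unitFrame_of_ne _ _ hi, inner_smul_right, hm, twistedMetric]
    simp [hi]
  · rw [unitFrame_of_ne _ _ hj, unitFrame_of_ne _ _ hi, hm, twistedMetric]
    simp [hi]

theorem IsLf.isQFrame (h : IsLf T f fc F) {x : En n} (hx : x ∈ T) (hf : f x ≠ 0) :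
    IsQFrame fun i => unitFrame f F i x := by
  refine isQFrame_of_inner (h.inner_unitFrame hx hf) fun a i j => ?_
  rw [← fderiv_unitVec, ← fderiv_unitVec]
  exact h.lagrangian x hx a _ _

theorem IsLf.sum_unitFrame (h : IsLf T f fc F) {x : En n} (hx : x ∈ T) (hf : f x ≠ 0)
    (v w : En n) : fderiv ℝ (fun y => fderiv ℝ F y) x v w =
      ∑ i, ⟪fderiv ℝ (fun y => fderiv ℝ F y) x v w, unitFrame f F i x⟫_ℝ • unitFrame f F i x +
        secondFF F x v w := by
  obtain ⟨u, hu⟩ := snd_fderiv_eq_add F x v w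
  have h1 := eq_sum_of_orthonormal_image (Λ := fderiv ℝ F x) (e := fun i => unitVec f i x)
    (fun i j => by rw [fderiv_unitVec, fderiv_unitVec]; exact h.inner_unitFrame hx hf i j) u
  have h2 : ∀ i, ⟪fderiv ℝ F x u + secondFF F x v w, unitFrame f F i x⟫_ℝ =
      ⟪fderiv ℝ F x u, unitFrame f F i x⟫_ℝ := by
    intro i
    rw [inner_add_left, ← fderiv_unitVec f F i x, real_inner_comm _ (secondFF F x v w),
      inner_secondFF, add_zero]
  rw [hu]
  simp only [h2]
  congr 1
  conv_lhs => rw [h1, map_sum]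
  simp only [map_smul, fderiv_unitVec]

/-- Koszul's formula for the twisted product metric. -/
theorem IsLf.inner_snd_fderiv (hd : IsTwistingData T f fc β α) (h : IsLf T f fc F) {x : En n}
    (hx : x ∈ T) (k i j : Fin n) :
    ⟪fderiv ℝ (fun y => fderiv ℝ F y) x (coordVec k) (coordVec i), fderiv ℝ F x (coordVec j)⟫_ℝ =
      (if i = 0 ∧ j = 0 then f x * fderiv ℝ f x (coordVec k) else 0) +
      (if k = 0 ∧ j = 0 then f x * fderiv ℝ f x (coordVec i) else 0) -
      (if k = 0 ∧ i = 0 then f x * fderiv ℝ f x (coordVec j) else 0) := by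
  have hF : ContDiffAt ℝ ∞ F x := h.smooth.contDiffAt (hd.isOpen.mem_nhds hx)
  have hF1 : ∀ i, DifferentiableAt ℝ (fun y => fderiv ℝ F y (coordVec i)) x := fun i =>
    ((hF.fderiv_right (m := ∞) (by simp)).differentiableAt (by simp)).clm_apply
      (differentiableAt_const _)
  -- Differentiating a metric coefficient gives the sum of two of the wanted products; the cyclic
  -- instances of this relation are then solved as in Koszul's formula.
  have hG : ∀ k i j : Fin n,
      ⟪fderiv ℝ (fun y => fderiv ℝ F y) x (coordVec k) (coordVec i), fderiv ℝ F x (coordVec j)⟫_ℝ +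
      ⟪fderiv ℝ (fun y => fderiv ℝ F y) x (coordVec k) (coordVec j), fderiv ℝ F x (coordVec i)⟫_ℝ =
      if i = 0 ∧ j = 0 then 2 * (f x * fderiv ℝ f x (coordVec k)) else 0 := by
    intro k i j
    have e1 := fderiv_inner_apply ℝ (hF1 i) (hF1 j) (coordVec k)
    rw [← snd_fderiv_apply hF, ← snd_fderiv_apply hF,
      real_inner_comm (fderiv ℝ (fun y => fderiv ℝ F y) x (coordVec k) (coordVec j))] at e1
    have e2 : (fun y => ⟪fderiv ℝ F y (coordVec i), fderiv ℝ F y (coordVec j)⟫_ℝ) =ᶠ[𝓝 x]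
        fun y => twistedMetric f y i j :=
      Filter.mem_of_superset (hd.isOpen.mem_nhds hx) fun y hy => h.isometric y hy i j
    rw [e2.fderiv_eq] at e1
    rw [add_comm, ← e1]
    by_cases hi : i = 0 <;> by_cases hj : j = 0
    · subst hi hj
      simp only [twistedMetric, if_true, and_self]
      rw [fderiv_fun_pow 2 (hd.differentiableAt hx)]
      simp
      ring
    · simp [hi, hj, twistedMetric, Ne.symm hj]
    · simp [hi, hj, twistedMetric]
    · simp [hi, twistedMetric]
  have hs : ∀ k i : Fin n, fderiv ℝ (fun y => fderiv ℝ F y) x (coordVec k) (coordVec i) =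
      fderiv ℝ (fun y => fderiv ℝ F y) x (coordVec i) (coordVec k) := fun k i =>
    snd_fderiv_symm hF _ _
  have h1 := hG k i j
  have h2 := hG i k j
  have h3 := hG j k i
  rw [hs i k] at h2
  rw [hs j k, hs j i] at h3
  have p : ∀ (a : Prop) [Decidable a] (c : ℝ), (if a then 2 * c else 0) = 2 * (if a then c else 0) :=
    fun a _ c => by split_ifs <;> simp
  simp only [p] at h1 h2 h3
  linarith

/-- Except on (∂_0, ∂_0) the second derivative of F is tangential, hence determined by the metric.
As f is affine in x_j for fixed x₁, its partial derivatives in these directions are the α_j, and the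
frame has no derivative in the directions ∂_j, j ≠ 0. -/
theorem IsLf.hasFDerivAt_unitFrame (hd : IsTwistingData T f fc β α)
    (hφ : ∀ a, ∀ x ∈ T, f x / fc a x = φ a (x 0)) (h : IsLf T f fc F) {x : En n}
    (hx : x ∈ T) (i : Fin n) : HasFDerivAt (unitFrame f F i)
      ((projZero (n := n)).smulRight (frameOp (imQuat fun a => φ a (x 0)) (fun j => α j (x 0))
        (fun i => unitFrame f F i x) i)) x := by
  have hF : ContDiffAt ℝ ∞ F x := h.smooth.contDiffAt (hd.isOpen.mem_nhds hx)
  have hf := (hd.pos x hx).ne'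
  have hF1 : ∀ i, HasFDerivAt (fun y => fderiv ℝ F y (coordVec i))
      (fderiv ℝ (fun y => fderiv ℝ F y (coordVec i)) x) x := fun i =>
    (((hF.fderiv_right (m := ∞) (by simp)).differentiableAt (by simp)).clm_apply
      (differentiableAt_const _)).hasFDerivAt
  have hs : ∀ v w, fderiv ℝ (fun y => fderiv ℝ F y) x v w =
      fderiv ℝ (fun y => fderiv ℝ F y) x w v := snd_fderiv_symm hF
  have hE0 : fderiv ℝ F x (coordVec 0) = f x • unitFrame f F 0 x := by
    rw [unitFrame_zero, smul_smul, mul_inv_cancel₀ hf, one_smul]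
  have hsplit : ∀ v w, fderiv ℝ (fun y => fderiv ℝ F y) x v w =
      v 0 • fderiv ℝ (fun y => fderiv ℝ F y) x (coordVec 0) w +
      ∑ k ∈ Finset.univ.erase 0, v k • fderiv ℝ (fun y => fderiv ℝ F y) x (coordVec k) w := by
    intro v w
    conv_lhs => rw [eq_zero_smul_add_sum v]
    simp only [map_add, map_smul, map_sum, add_apply, smul_apply, sum_apply]
  have hI : ∀ k i j : Fin n,
      ⟪fderiv ℝ (fun y => fderiv ℝ F y) x (coordVec k) (coordVec i), unitFrame f F j x⟫_ℝ =
      (if j = 0 then (f x)⁻¹ else 1) *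
      ((if i = 0 ∧ j = 0 then f x * fderiv ℝ f x (coordVec k) else 0) +
      (if k = 0 ∧ j = 0 then f x * fderiv ℝ f x (coordVec i) else 0) -
      (if k = 0 ∧ i = 0 then f x * fderiv ℝ f x (coordVec j) else 0)) := by
    intro k i j
    rw [← h.inner_snd_fderiv hd hx]
    by_cases hj : j = 0
    · subst hj
      rw [unitFrame_zero, inner_smul_right, if_pos rfl]
    · rw [unitFrame_of_ne _ _ hj, if_neg hj, one_mul]
  have hjk : ∀ j k : Fin n, j ≠ 0 → k ≠ 0 →
      fderiv ℝ (fun y => fderiv ℝ F y) x (coordVec j) (coordVec k) = 0 := by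
    intro j k hj hk
    rw [h.sum_unitFrame hx hf, h.sff_j_k x hx j k hj hk, add_zero]
    refine Finset.sum_eq_zero fun i _ => ?_
    rw [hI]
    simp [hj, hk]
  have h0j : ∀ j : Fin n, j ≠ 0 →
      fderiv ℝ (fun y => fderiv ℝ F y) x (coordVec 0) (coordVec j) =
        α j (x 0) • unitFrame f F 0 x := by
    intro j hj
    have e : secondFF F x (coordVec 0) (coordVec j) = 0 := by
      have := h.sff_one_j x hx j hj
      rw [← one_smul ℝ (coordVec j : En n), secondFF_smul] at this
      simpa [hf] using this
    rw [h.sum_unitFrame hx hf, e, add_zero, Finset.sum_eq_single 0]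
    · rw [hI, hd.fderiv_coordVec hx hj]
      simp [hj, hf]
    · intro i _ hi
      rw [hI]
      simp [hj, hi]
    · simp
  have h00 : fderiv ℝ (fun y => fderiv ℝ F y) x (coordVec 0) (coordVec 0) =
      fderiv ℝ f x (coordVec 0) • unitFrame f F 0 x + f x • frameOp (imQuat fun a => φ a (x 0))
        (fun j => α j (x 0)) (fun i => unitFrame f F i x) 0 := by
    have e : secondFF F x (coordVec 0) (coordVec 0) =
        f x • (imQuat (fun a => φ a (x 0)) • unitFrame f F 0 x) := by
      have := h.sff_one_one x hx
      rw [secondFF_smul, map_smul, hE0, smul_smul, one_div_mul_cancel hf, one_smul] at this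
      rw [← sum_smul_imUnit_smul, Finset.smul_sum]
      rw [← smul_right_injective _ (by positivity : (1 / f x * (1 / f x)) ≠ 0) |>.eq_iff]
      simp only [this, Finset.smul_sum, smul_smul]
      refine Finset.sum_congr rfl fun a _ => ?_
      rw [← hφ a x hx]
      congr 1
      field_simp
    rw [h.sum_unitFrame hx hf, e, frameOp_zero, smul_sub, sum_eq_zero_add_erase, hI]
    have e2 : ∑ i ∈ Finset.univ.erase 0,
        ⟪fderiv ℝ (fun y => fderiv ℝ F y) x (coordVec 0) (coordVec 0), unitFrame f F i x⟫_ℝ •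
          unitFrame f F i x = -(f x • ∑ j ∈ Finset.univ.erase 0, α j (x 0) • unitFrame f F j x) := by
      rw [Finset.smul_sum, ← Finset.sum_neg_distrib]
      refine Finset.sum_congr rfl fun j hj => ?_
      have hj := Finset.ne_of_mem_erase hj
      rw [hI, hd.fderiv_coordVec hx hj]
      simp [hj, smul_smul]
    rw [e2]
    simp only [and_self, if_true]
    rw [add_sub_cancel_right, inv_mul_cancel_left₀ hf]
    abel
  by_cases hi : i = 0
  · subst hi
    -- Differentiating the factor f⁻¹ cancels exactly the part Df(v)·E_0 of D²F(v, ∂_0), leaving v_0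
    -- times the frame equation.
    have h1 : HasFDerivAt (fun y => (f y)⁻¹ • fderiv ℝ F y (coordVec 0)) _ x :=
      (((hasDerivAt_inv hf).comp_hasFDerivAt x (hd.differentiableAt hx).hasFDerivAt)).smul (hF1 0)
    refine HasFDerivAt.congr_fderiv (f := unitFrame f F 0) (h1.congr_of_eventuallyEq
      (Filter.Eventually.of_forall fun y => unitFrame_zero f F y)) ?_
    ext1 v
    have hfv : fderiv ℝ f x v = v 0 * fderiv ℝ f x (coordVec 0) +
        ∑ k ∈ Finset.univ.erase 0, v k * α k (x 0) := by
      conv_lhs => rw [eq_zero_smul_add_sum v]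
      simp only [map_add, map_smul, map_sum, smul_eq_mul]
      congr 1
      exact Finset.sum_congr rfl fun k hk => by
        rw [hd.fderiv_coordVec hx (Finset.ne_of_mem_erase hk)]
    have hsum : ∑ k ∈ Finset.univ.erase 0,
        v k • fderiv ℝ (fun y => fderiv ℝ F y) x (coordVec k) (coordVec 0) =
        (∑ k ∈ Finset.univ.erase 0, v k * α k (x 0)) • unitFrame f F 0 x := by
      rw [Finset.sum_smul]
      refine Finset.sum_congr rfl fun k hk => ?_
      rw [hs, h0j k (Finset.ne_of_mem_erase hk), smul_smul]
    simp only [add_apply, smul_apply, ContinuousLinearMap.smulRight_apply, proj_apply]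
    rw [← snd_fderiv_apply hF, hsplit, h00, hsum, hE0, hfv]
    simp only [smul_add, smul_smul, Function.comp_apply, smul_eq_mul]
    rw [show (f x)⁻¹ * (v 0 * f x) = v 0 by field_simp]
    set X := frameOp (imQuat fun a => φ a (x 0)) (fun j => α j (x 0)) (fun i => unitFrame f F i x) 0
    set s := ∑ k ∈ Finset.univ.erase 0, v k * α k (x 0)
    match_scalars
    · field_simp
      ring
    · ring
  · refine HasFDerivAt.congr_fderiv (f := unitFrame f F i) ((hF1 i).congr_of_eventuallyEq
      (Filter.Eventually.of_forall fun y => unitFrame_of_ne f F hi y)) ?_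
    ext1 v
    rw [← snd_fderiv_apply hF, hsplit, h0j i hi, frameOp_of_ne _ _ _ hi,
      ContinuousLinearMap.smulRight_apply, proj_apply]
    rw [Finset.sum_eq_zero fun k hk => by rw [hjk k i (Finset.ne_of_mem_erase hk) hi, smul_zero],
      add_zero]

end StructureEquations

/-! ## Diffeomorphisms of open sets -/

section Diffeo

variable {V : Type*} [NormedAddCommGroup V] [NormedSpace ℝ V] [FiniteDimensional ℝ V]

/-- The continuous linear automorphism given by an injective endomorphism. -/
def equivOfInjective (A : V →L[ℝ] V) (h : Function.Injective A) : V ≃L[ℝ] V :=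
  (LinearEquiv.ofInjectiveEndo A.toLinearMap h).toContinuousLinearEquiv

theorem coe_equivOfInjective (A : V →L[ℝ] V) (h : Function.Injective A) :
    (equivOfInjective A h : V →L[ℝ] V) = A := by
  ext v
  rfl

theorem hasStrictFDerivAt_of_contDiffOn {f : V → V} {U : Set V} (hU : IsOpen U)
    (hf : ContDiffOn ℝ ∞ f U) {x : V} (hx : x ∈ U) (hi : Function.Injective (fderiv ℝ f x)) :
    HasStrictFDerivAt f (equivOfInjective (fderiv ℝ f x) hi : V →L[ℝ] V) x := by
  rw [coe_equivOfInjective]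
  exact (hf.contDiffAt (hU.mem_nhds hx)).hasStrictFDerivAt (by simp)

/-- An injective smooth map with injective differentials is a diffeomorphism onto its image. -/
theorem exists_diffeo_of_injOn {f : V → V} {U : Set V} (hU : IsOpen U) (hf : ContDiffOn ℝ ∞ f U)
    (hinj : InjOn f U) (hd : ∀ x ∈ U, Function.Injective (fderiv ℝ f x)) :
    ∃ e : OpenPartialHomeomorph V V, e.source = U ∧ (∀ x, e x = f x) ∧
      ContDiffOn ℝ ∞ e.symm e.target := by
  have := FiniteDimensional.complete ℝ V
  -- The map is open on U because the inverse function theorem applies at each of its points.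
  let e := OpenPartialHomeomorph.ofContinuousOpenRestrict (hinj.bijOn_image.toPartialEquiv f U _)
    hf.continuousOn (by
      rw [isOpenMap_iff_nhds_le]
      intro x
      change 𝓝 (f x) ≤ Filter.map (f ∘ Subtype.val) (𝓝 x)
      rw [← Filter.map_map, map_nhds_subtype_coe_eq_nhds x.2 (hU.mem_nhds x.2),
        (hasStrictFDerivAt_of_contDiffOn hU hf x.2 (hd x x.2)).map_nhds_eq_of_equiv]) hU
  refine ⟨e, rfl, fun x => rfl, fun y hy => ContDiffAt.contDiffWithinAt ?_⟩
  have hx : e.symm y ∈ U := e.map_target hy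
  exact e.contDiffAt_symm hy (hasStrictFDerivAt_of_contDiffOn hU hf hx (hd _ hx)).hasFDerivAt
    (hf.contDiffAt (hU.mem_nhds hx))

/-- The inverse function theorem, with smoothness of the inverse on a whole neighbourhood. -/
theorem exists_local_diffeo {f : V → V} {U : Set V} (hU : IsOpen U) (hf : ContDiffOn ℝ ∞ f U)
    {x : V} (hx : x ∈ U) (hd : Function.Injective (fderiv ℝ f x)) :
    ∃ e : OpenPartialHomeomorph V V, x ∈ e.source ∧ e.source ⊆ U ∧ (∀ x, e x = f x) ∧
      ContDiffOn ℝ ∞ e.symm e.target := by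
  have := FiniteDimensional.complete ℝ V
  have h := hasStrictFDerivAt_of_contDiffOn hU hf hx hd
  let g := h.toOpenPartialHomeomorph f
  have hc : ContinuousAt (fderiv ℝ f) x :=
    (hf.continuousOn_fderiv_of_isOpen hU (by simp)).continuousAt (hU.mem_nhds hx)
  -- Invertible operators form an open set, so the differential is injective near x; the inverse is
  -- then smooth on the whole target and not only at the image of x.
  have hev : ∀ᶠ y in 𝓝 x, Function.Injective (fderiv ℝ f y) := by
    have := hc.preimage_mem_nhds
      (by rw [← coe_equivOfInjective _ hd]; exact ContinuousLinearEquiv.nhds _)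
    filter_upwards [this] with y hy
    obtain ⟨e, he⟩ := hy
    rw [← he]
    exact e.injective
  obtain ⟨W, hW, hWo, hxW⟩ := eventually_nhds_iff.1 hev
  have hxg : x ∈ g.source := h.mem_toOpenPartialHomeomorph_source
  have ho : IsOpen (U ∩ W ∩ g.source) := (hU.inter hWo).inter g.open_source
  have hg : InjOn f g.source := g.injOn
  obtain ⟨e, he, hef, hes⟩ := exists_diffeo_of_injOn ho (hf.mono fun y hy => hy.1.1)
    (hg.mono fun y hy => hy.2) (fun y hy => hW y hy.1.2)
  exact ⟨e, he ▸ ⟨⟨hx, hxW⟩, hxg⟩, he ▸ fun y hy => hy.1.1, hef, hes⟩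

end Diffeo

/-! ## Representation by normal forms -/

section Representation

variable {n : ℕ}

/-- A linear isometry over the quaternions as a real continuous linear map. -/
def realCLM (A : Hn n ≃ₗᵢ[ℍ[ℝ]] Hn n) : Hn n →L[ℝ] Hn n :=
  { toFun := A
    map_add' := map_add A
    map_smul' := fun c x => by
      rw [← algebraMap_smul ℍ[ℝ] c x, map_smul, algebraMap_smul]; rfl
    cont := A.continuous }

theorem realCLM_apply (A : Hn n ≃ₗᵢ[ℍ[ℝ]] Hn n) (x : Hn n) : realCLM A x = A x := rfl

theorem IsQFrame.map {E : Fin n → Hn n} (h : IsQFrame E) (A : Hn n ≃ₗᵢ[ℍ[ℝ]] Hn n) :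
    IsQFrame fun i => A (E i) := by
  have hin : ∀ x y, ⟪A x, A y⟫_ℝ = ⟪x, y⟫_ℝ := by
    intro x y
    simp only [real_inner_eq_norm_add_mul_self_sub_norm_mul_self_sub_norm_mul_self_div_two,
      ← map_add, LinearIsometryEquiv.norm_map]
  refine isQFrame_of_inner (fun i j => by rw [hin, h.inner]) fun a i j => ?_
  rw [← map_smul, hin, h.inner_imUnit]

variable [NeZero n] {T : Set (En n)} {f : En n → ℝ} {fc : Fin 3 → En n → ℝ} {β : ℝ → ℝ}
  {α : Fin n → ℝ → ℝ} {φ : Fin 3 → ℝ → ℝ} {F : En n → Hn n} {J : Set ℝ} {D : ℝ → Hn n}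
  {E : Fin n → ℝ → Hn n}

theorem fderiv_eq_sum_unitFrame {x : En n} (hf : f x ≠ 0) (v : En n) :
    fderiv ℝ F x v = ∑ i, (if i = 0 then v 0 * f x else v i) • unitFrame f F i x := by
  conv_lhs => rw [eq_zero_smul_add_sum v]
  rw [sum_eq_zero_add_erase, if_pos rfl, unitFrame_zero, smul_smul, mul_inv_cancel_right₀ hf]
  simp only [map_add, map_smul, map_sum]
  congr 1
  refine Finset.sum_congr rfl fun j hj => ?_
  rw [if_neg (Finset.ne_of_mem_erase hj), unitFrame_of_ne _ _ (Finset.ne_of_mem_erase hj)]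

theorem IsNormalForm.map (h : IsNormalForm J D E β α φ) (A : Hn n ≃ₗᵢ[ℍ[ℝ]] Hn n) (c : Hn n) :
    IsNormalForm J (fun t => A (D t) + c) (fun i t => A (E i t)) β α φ := by
  have hA : ∀ {γ : ℝ → Hn n} {γ' : Hn n} {t : ℝ}, HasDerivAt γ γ' t →
      HasDerivAt (fun s => A (γ s)) (A γ') t := fun h => (realCLM A).hasFDerivAt.comp_hasDerivAt _ h
  have hr : ∀ (r : ℝ) x, A (r • x) = r • A x := fun r x => map_smul (realCLM A) r x
  refine ⟨((realCLM A).contDiff.comp_contDiffOn h.smooth_D).add contDiffOn_const,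
    fun i => (realCLM A).contDiff.comp_contDiffOn (h.smooth_E i), fun t ht => (h.frame t ht).map A,
    fun t ht => ?_, fun t ht => ?_, fun t ht j hj => ?_⟩
  · rw [← hr]
    exact (hA (h.deriv_D t ht)).add_const c
  · have := hA (h.deriv_E_zero t ht)
    simpa only [map_sub, map_smul, map_sum, hr] using this
  · rw [← hr]
    exact hA (h.deriv_E t ht j hj)

theorem map_nfMap (A : Hn n ≃ₗᵢ[ℍ[ℝ]] Hn n) (c : Hn n) (x : En n) :
    A (nfMap D E x) + c = nfMap (fun t => A (D t) + c) (fun i t => A (E i t)) x := by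
  have hr : ∀ (r : ℝ) x, A (r • x) = r • A x := fun r x => map_smul (realCLM A) r x
  simp only [nfMap, map_add, map_sum, hr]
  abel

/-- Uniqueness up to rigid motions of the solutions with given data. -/
theorem IsLf.exists_isometry_normalForm (hd : IsTwistingData T f fc β α)
    (hφ : ∀ a, ∀ x ∈ T, f x / fc a x = φ a (x 0)) (h : IsLf T f fc F)
    (hN : IsNormalForm (firstRange T) D E β α φ) {x₀ : En n} (hx₀ : x₀ ∈ T)
    (hE : ∀ i, E i (x₀ 0) = PiLp.single 2 i (1 : ℍ[ℝ])) :
    ∃ (A : Hn n ≃ₗᵢ[ℍ[ℝ]] Hn n) (c : Hn n), ∀ x ∈ T, F x = A (nfMap D E x) + c := by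
  have hmem : ∀ x ∈ T, x 0 ∈ firstRange T := fun x hx => mem_image_of_mem _ hx
  have hf : ∀ x ∈ T, f x ≠ 0 := fun x hx => (hd.pos x hx).ne'
  have hNLf := hN.isLf hd hφ (isOpen_firstRange hd.isOpen) hmem
  -- The comparison takes place on T, which is connected; the slices of T with x₁ fixed need not be.
  have key : ∀ m k, ∃ c : ℍ[ℝ], ∀ x ∈ T, ∑ i, star (E i (x 0) m) * unitFrame f F i x k = c :=
    fun m k => exists_sum_entry_eq hd.isOpen hd.isPreconnected (X := fun i x => E i (x 0))
      (Y := unitFrame f F) (l := fun _ => projZero) (q := fun x => imQuat fun a => φ a (x 0))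
      (a := fun x j => α j (x 0)) (fun _ _ => imQuat_re _)
      (fun x hx i => hasFDerivAt_comp_coord ((isNormalForm_iff.1 hN).2.2.2.2 _ (hmem x hx) i))
      (fun x hx i => h.hasFDerivAt_unitFrame hd hφ hx i) m k
  choose Q hQ using key
  -- The rows of the constant matrix Q. Since E is the standard frame at x₀, they are the unit frame
  -- of F at x₀, hence a quaternionic frame.
  let R : Fin n → Hn n := fun m => WithLp.toLp 2 fun k => Q m k
  have hR : ∀ x ∈ T, ∀ i, unitFrame f F i x = ∑ m, E i (x 0) m • R m := fun x hx i =>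
    sum_smul_of_isQFrame (Y := fun i => unitFrame f F i x) (hN.frame _ (hmem x hx))
      (fun m k => hQ m k x hx) i
  have hR0 : ∀ i, unitFrame f F i x₀ = R i := by
    intro i
    rw [hR x₀ hx₀, hE]
    rw [Finset.sum_eq_single i]
    · simp
    · intro m _ hm; simp [hm]
    · simp
  have hRF : IsQFrame R := by
    have := h.isQFrame hx₀ (hf x₀ hx₀)
    simpa only [hR0] using this
  obtain ⟨A, hA⟩ := hRF.exists_isometry
  have hE' : ∀ x ∈ T, ∀ i, unitFrame f (nfMap D E) i x = E i (x 0) := by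
    intro x hx i
    by_cases hi : i = 0
    · subst hi
      rw [unitFrame_zero, hN.fderiv_coordVec_zero (hmem x hx), ← hd.affine x hx, smul_smul,
        inv_mul_cancel₀ (hf x hx), one_smul]
    · rw [unitFrame_of_ne _ _ hi, hN.fderiv_coordVec (hmem x hx) hi]
  have hdiff : ∀ G : En n → Hn n, IsLf T f fc G → ∀ x ∈ T, DifferentiableAt ℝ G x :=
    fun G hG x hx => (hG.smooth.contDiffAt (hd.isOpen.mem_nhds hx)).differentiableAt (by simp)
  have hfd : ∀ x ∈ T, fderiv ℝ F x = fderiv ℝ (fun y => A (nfMap D E y)) x := by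
    intro x hx
    have h1 : HasFDerivAt (fun y => A (nfMap D E y)) (realCLM A ∘SL fderiv ℝ (nfMap D E) x) x :=
      (realCLM A).hasFDerivAt.comp x (hdiff _ hNLf x hx).hasFDerivAt
    rw [h1.fderiv]
    ext1 v
    rw [ContinuousLinearMap.comp_apply, fderiv_eq_sum_unitFrame (hf x hx),
      fderiv_eq_sum_unitFrame (F := nfMap D E) (hf x hx), map_sum]
    refine Finset.sum_congr rfl fun i _ => ?_
    rw [map_smul, hE' x hx, realCLM_apply, hA, hR x hx]
  refine ⟨A, F x₀ - A (nfMap D E x₀), ?_⟩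
  refine hd.isOpen.eqOn_of_fderiv_eq (𝕜 := ℝ) hd.isPreconnected
    (fun x hx => (hdiff _ h x hx).differentiableWithinAt)
    (fun x hx => (((realCLM A).differentiableAt.comp x (hdiff _ hNLf x hx)).add_const
      _).differentiableWithinAt)
    (fun x hx => ?_) hx₀ (by abel)
  rw [hfd x hx]
  exact (fderiv_add_const _).symm

theorem IsTwistingData.exists_isNormalForm (hd : IsTwistingData T f fc β α)
    (hφ : ∀ a, ContDiffOn ℝ ∞ (φ a) (firstRange T)) {x₀ : En n} (hx₀ : x₀ ∈ T) :
    ∃ (D : ℝ → Hn n) (E : Fin n → ℝ → Hn n), IsNormalForm (firstRange T) D E β α φ ∧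
      ∀ i, E i (x₀ 0) = PiLp.single 2 i (1 : ℍ[ℝ]) :=
  _root_.exists_isNormalForm (isOpen_firstRange hd.isOpen)
    (ordConnected_firstRange hd.isPreconnected) hd.contDiffOn_beta
    (fun _ hj => hd.contDiffOn_alpha hj) hφ (mem_image_of_mem _ hx₀)

/-- Existence and uniqueness up to rigid motions of the immersions with given twisting data. -/
theorem IsTwistingData.exists_isLf (hd : IsTwistingData T f fc β α) :
    ∃ F : En n → Hn n, IsLf T f fc F ∧ ∀ F' : En n → Hn n, IsLf T f fc F' →
      ∃ (A : Hn n ≃ₗᵢ[ℍ[ℝ]] Hn n) (c : Hn n), ∀ x ∈ T, F' x = A (F x) + c := by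
  obtain ⟨φ, hφ, hφs⟩ := hd.exists_ratio
  obtain ⟨x₀, hx₀⟩ := hd.simplyConnected.nonempty
  obtain ⟨D, E, hN, hE⟩ := hd.exists_isNormalForm hφs hx₀
  exact ⟨nfMap D E, hN.isLf hd hφ (isOpen_firstRange hd.isOpen) fun x hx => mem_image_of_mem _ hx,
    fun F' hF' => hF'.exists_isometry_normalForm hd hφ hN hx₀ hE⟩

/-- The immersions with given twisting data have normal forms. -/
theorem IsLf.exists_normalForm (hd : IsTwistingData T f fc β α) (h : IsLf T f fc F) :
    ∃ (φ : Fin 3 → ℝ → ℝ) (D : ℝ → Hn n) (E : Fin n → ℝ → Hn n),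
      IsNormalForm (firstRange T) D E β α φ ∧ ∀ x ∈ T, F x = nfMap D E x := by
  obtain ⟨φ, hφ, hφs⟩ := hd.exists_ratio
  obtain ⟨x₀, hx₀⟩ := hd.simplyConnected.nonempty
  obtain ⟨D, E, hN, hE⟩ := hd.exists_isNormalForm hφs hx₀
  obtain ⟨A, c, hA⟩ := h.exists_isometry_normalForm hd hφ hN hx₀ hE
  exact ⟨φ, _, _, hN.map A c, fun x hx => by rw [hA x hx, map_nfMap]⟩

end Representation

/-! ## Immersions of manifolds in charts -/

section Charts

variable {n : ℕ} {M : Type*} [TopologicalSpace M] [ChartedSpace (En n) M]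

theorem trans_mem_maximalAtlas {Φ : OpenPartialHomeomorph M (En n)}
    (hΦ : Φ ∈ IsManifold.maximalAtlas 𝓘(ℝ, En n) ∞ M)
    {e : OpenPartialHomeomorph (En n) (En n)} (h1 : ContDiffOn ℝ ∞ e e.source)
    (h2 : ContDiffOn ℝ ∞ e.symm e.target) :
    Φ.trans e ∈ IsManifold.maximalAtlas 𝓘(ℝ, En n) ∞ M := by
  have he : e ∈ contDiffGroupoid ∞ 𝓘(ℝ, En n) := by
    rw [contDiffGroupoid, mem_groupoid_of_pregroupoid]
    simpa [contDiffPregroupoid] using ⟨h1, h2⟩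
  intro c hc
  obtain ⟨h3, h4⟩ := hΦ c hc
  constructor
  · rw [OpenPartialHomeomorph.trans_symm_eq_symm_trans_symm, OpenPartialHomeomorph.trans_assoc]
    exact (contDiffGroupoid ∞ 𝓘(ℝ, En n)).trans ((contDiffGroupoid ∞ 𝓘(ℝ, En n)).symm he) h3
  · rw [← OpenPartialHomeomorph.trans_assoc]
    exact (contDiffGroupoid ∞ 𝓘(ℝ, En n)).trans h4 he

variable {L : M → Hn n} {Φ : OpenPartialHomeomorph M (En n)}

theorem contDiffOn_comp_symm (hL : ContMDiff 𝓘(ℝ, En n) 𝓘(ℝ, Hn n) ∞ L)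
    (hΦ : Φ ∈ IsManifold.maximalAtlas 𝓘(ℝ, En n) ∞ M) :
    ContDiffOn ℝ ∞ (L ∘ Φ.symm) Φ.target := by
  rw [← contMDiffOn_iff_contDiffOn]
  exact hL.comp_contMDiffOn (contMDiffOn_symm_of_mem_maximalAtlas hΦ)

theorem mdifferentiableAt_symm (hΦ : Φ ∈ IsManifold.maximalAtlas 𝓘(ℝ, En n) ∞ M) {x : En n}
    (hx : x ∈ Φ.target) : MDifferentiableAt 𝓘(ℝ, En n) 𝓘(ℝ, En n) Φ.symm x :=
  ((contMDiffOn_symm_of_mem_maximalAtlas hΦ).contMDiffAt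
    (Φ.open_target.mem_nhds hx)).mdifferentiableAt (by simp)

theorem diffAt_mfderiv_symm (hL : ContMDiff 𝓘(ℝ, En n) 𝓘(ℝ, Hn n) ∞ L)
    (hΦ : Φ ∈ IsManifold.maximalAtlas 𝓘(ℝ, En n) ∞ M) {x : En n} (hx : x ∈ Φ.target) (v : En n) :
    diffAt L (Φ.symm x) (mfderiv 𝓘(ℝ, En n) 𝓘(ℝ, En n) Φ.symm x v) =
      fderiv ℝ (L ∘ Φ.symm) x v := by
  have h1 : MDifferentiableAt 𝓘(ℝ, En n) 𝓘(ℝ, Hn n) L (Φ.symm x) :=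
    hL.contMDiffAt.mdifferentiableAt (by simp)
  have h2 := mfderiv_comp x h1 (mdifferentiableAt_symm hΦ hx)
  rw [mfderiv_eq_fderiv] at h2
  rw [h2]
  rfl

/-- The chain rule adds to D²F(Dψv, Dψw) only the tangential term DF(D²ψ(v, w)). Surjectivity of Dψ
makes the two tangent spaces equal, so the normal parts agree. -/
theorem secondFF_comp {F : En n → Hn n} {ψ : En n → En n} {x : En n}
    (hF : ContDiffAt ℝ ∞ F (ψ x)) (hψ : ContDiffAt ℝ ∞ ψ x)
    (hs : Function.Surjective (fderiv ℝ ψ x)) (v w : En n) :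
    secondFF (fun y => F (ψ y)) x v w = secondFF F (ψ x) (fderiv ℝ ψ x v) (fderiv ℝ ψ x w) := by
  have hd : ∀ {G : Type} [NormedAddCommGroup G] [NormedSpace ℝ G] {H : En n → G} {y : En n},
      ContDiffAt ℝ ∞ H y → ∀ᶠ z in 𝓝 y, DifferentiableAt ℝ H z := fun h =>
    ((h.of_le (m := 1) (by simp)).eventually (by simp)).mono fun z hz =>
      hz.differentiableAt (by simp)
  have hev : ∀ᶠ y in 𝓝 x, DifferentiableAt ℝ F (ψ y) ∧ DifferentiableAt ℝ ψ y :=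
    (hψ.continuousAt.eventually (hd hF)).and (hd hψ)
  have h1 : ∀ {y}, DifferentiableAt ℝ F (ψ y) ∧ DifferentiableAt ℝ ψ y →
      fderiv ℝ (fun z => F (ψ z)) y = fderiv ℝ F (ψ y) ∘SL fderiv ℝ ψ y := fun h =>
    fderiv_comp _ h.1 h.2
  have hx := h1 hev.self_of_nhds
  have h2 : (fun y => fderiv ℝ (fun z => F (ψ z)) y w) =ᶠ[𝓝 x]
      fun y => fderiv ℝ F (ψ y) (fderiv ℝ ψ y w) := by
    filter_upwards [hev] with y hy
    rw [h1 hy]; rfl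
  obtain ⟨u, hu⟩ := snd_fderiv_eq_add F (ψ x) (fderiv ℝ ψ x v) (fderiv ℝ ψ x w)
  refine secondFF_eq_of_add (a := fderiv ℝ F (ψ x) u +
    fderiv ℝ F (ψ x) (fderiv ℝ (fun y => fderiv ℝ ψ y) x v w)) ?_ ?_ ?_
  · rw [snd_fderiv_apply (F := fun y => F (ψ y)) (hF.comp x hψ), h2.fderiv_eq]
    have d1 : DifferentiableAt ℝ (fun y => fderiv ℝ F y) (ψ x) :=
      (hF.fderiv_right (m := ∞) (by simp)).differentiableAt (by simp)
    have d2 : DifferentiableAt ℝ (fun y => fderiv ℝ ψ y w) x :=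
      ((hψ.fderiv_right (m := ∞) (by simp)).differentiableAt (by simp)).clm_apply
        (differentiableAt_const _)
    have d3 : HasFDerivAt (fun y => fderiv ℝ F (ψ y)) _ x :=
      HasFDerivAt.comp (g := fun z => fderiv ℝ F z) x d1.hasFDerivAt (hψ.differentiableAt (by simp)).hasFDerivAt
    rw [(d3.clm_apply d2.hasFDerivAt).fderiv]
    simp only [add_apply, ContinuousLinearMap.comp_apply, ContinuousLinearMap.flip_apply]
    rw [hu, snd_fderiv_apply hψ]
    abel
  · obtain ⟨u', hu'⟩ := hs (u + fderiv ℝ (fun y => fderiv ℝ ψ y) x v w)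
    refine ⟨u', ?_⟩
    rw [hx, ContinuousLinearMap.comp_apply, hu', map_add]
  · intro u
    rw [hx]
    exact inner_secondFF _ _ _ _ _

/-- The differential of an inverse chart is bijective. -/
theorem bijective_mfderiv_symm (hΦ : Φ ∈ IsManifold.maximalAtlas 𝓘(ℝ, En n) ∞ M) {x : En n}
    (hx : x ∈ Φ.target) :
    Function.Bijective (mfderiv 𝓘(ℝ, En n) 𝓘(ℝ, En n) Φ.symm x) := by
  have h1 : MDifferentiableAt 𝓘(ℝ, En n) 𝓘(ℝ, En n) Φ (Φ.symm x) :=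
    ((contMDiffOn_of_mem_maximalAtlas hΦ).contMDiffAt
      (Φ.open_source.mem_nhds (Φ.map_target hx))).mdifferentiableAt (by simp)
  have h2 := mfderiv_comp x h1 (mdifferentiableAt_symm hΦ hx)
  have h3 : (Φ ∘ Φ.symm) =ᶠ[𝓝 x] id := Φ.eventually_right_inverse hx
  rw [h3.mfderiv_eq, mfderiv_id] at h2
  have hi : Function.Injective (mfderiv 𝓘(ℝ, En n) 𝓘(ℝ, En n) Φ.symm x) := by
    intro v w hvw
    have h4 : ∀ u, mfderiv 𝓘(ℝ, En n) 𝓘(ℝ, En n) Φ (Φ.symm x)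
      (mfderiv 𝓘(ℝ, En n) 𝓘(ℝ, En n) Φ.symm x u) = u := fun u => (DFunLike.congr_fun h2 u).symm
    rw [← h4 v, hvw, h4]
  let A : En n →L[ℝ] En n := mfderiv 𝓘(ℝ, En n) 𝓘(ℝ, En n) Φ.symm x
  exact ⟨hi, LinearMap.surjective_of_injective (f := A.toLinearMap) hi⟩

variable [IsManifold 𝓘(ℝ, En n) ∞ M] {g : SmoothMetric n M}

theorem metricCoeff_eq (hL : IsLagrangianIsometricImmersion g L)
    (hΦ : Φ ∈ IsManifold.maximalAtlas 𝓘(ℝ, En n) ∞ M) {x : En n} (hx : x ∈ Φ.target)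
    (i j : Fin n) : metricCoeff g Φ x i j =
      ⟪fderiv ℝ (L ∘ Φ.symm) x (coordVec i), fderiv ℝ (L ∘ Φ.symm) x (coordVec j)⟫_ℝ := by
  rw [metricCoeff, ← hL.isometric, diffAt_mfderiv_symm hL.smooth hΦ hx,
    diffAt_mfderiv_symm hL.smooth hΦ hx]

/-- The second fundamental form of an immersion of a manifold, computed in any chart. -/
theorem secondFFAt_mfderiv_symm (hL : ContMDiff 𝓘(ℝ, En n) 𝓘(ℝ, Hn n) ∞ L)
    (hΦ : Φ ∈ IsManifold.maximalAtlas 𝓘(ℝ, En n) ∞ M) {x : En n} (hx : x ∈ Φ.target)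
    (v w : En n) :
    secondFFAt L (Φ.symm x) (mfderiv 𝓘(ℝ, En n) 𝓘(ℝ, En n) Φ.symm x v)
      (mfderiv 𝓘(ℝ, En n) 𝓘(ℝ, En n) Φ.symm x w) = secondFF (L ∘ Φ.symm) x v w := by
  set p := Φ.symm x with hp
  set c := chartAt (En n) p with hc
  have hpc : p ∈ c.source := mem_chart_source _ p
  have hcm : c ∈ IsManifold.maximalAtlas 𝓘(ℝ, En n) ∞ M := IsManifold.chart_mem_maximalAtlas p
  have hψ : ContDiffAt ℝ ∞ (c ∘ Φ.symm) x := by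
    rw [← contMDiffAt_iff_contDiffAt]
    exact ((contMDiffOn_of_mem_maximalAtlas hcm).contMDiffAt (c.open_source.mem_nhds hpc)).comp x
      ((contMDiffOn_symm_of_mem_maximalAtlas hΦ).contMDiffAt (Φ.open_target.mem_nhds hx))
  -- The tangent space at p is ℝⁿ through the preferred chart c at p, so the differential of
  -- `Φ.symm` is the ordinary derivative of the transition map into c.
  have hd : mfderiv 𝓘(ℝ, En n) 𝓘(ℝ, En n) Φ.symm x = fderiv ℝ (c ∘ Φ.symm) x := by
    refine HasMFDerivAt.mfderiv ⟨(mdifferentiableAt_symm hΦ hx).continuousAt, ?_⟩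
    simp only [writtenInExtChartAt, mfld_simps]
    exact (hψ.differentiableAt (by simp)).hasFDerivAt.hasFDerivWithinAt
  have he : (L ∘ Φ.symm) =ᶠ[𝓝 x] fun y => (L ∘ c.symm) ((c ∘ Φ.symm) y) := by
    have : Φ.symm ⁻¹' c.source ∈ 𝓝 x :=
      (Φ.continuousAt_symm hx).preimage_mem_nhds (c.open_source.mem_nhds hpc)
    filter_upwards [this] with y hy
    simp [c.left_inv hy]
  rw [secondFF_congr he, secondFF_comp ?_ hψ ?_, secondFFAt, hd]
  · rfl
  · exact (contDiffOn_comp_symm hL hcm).contDiffAt (c.open_target.mem_nhds (c.map_source hpc))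
  · rw [← hd]
    exact (bijective_mfderiv_symm hΦ hx).2

end Charts

/-! ## Cylinders and special Legendre curves from normal forms -/

section Formulas

variable {n : ℕ} [NeZero n] {J S : Set ℝ} {D : ℝ → Hn n} {E : Fin n → ℝ → Hn n} {β : ℝ → ℝ}
  {α : Fin n → ℝ → ℝ} {φ : Fin 3 → ℝ → ℝ}

/-- Left multiplication by q commutes with real scalars but not with quaternions: q(φE) =
(qφq̄)(qE). Only φ changes, by conjugation. -/
theorem IsNormalForm.smul (h : IsNormalForm J D E β α φ) {q : ℍ[ℝ]} (hq : ‖q‖ = 1) :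
    IsNormalForm J (fun t => q • D t) (fun i t => q • E i t) β α
      (fun a t => imComp (q * imQuat (fun a => φ a t) * star q) a) := by
  refine ⟨h.smooth_D.const_smul q, fun i => (h.smooth_E i).const_smul q,
    fun t ht => (h.frame t ht).smul hq, fun t ht => ?_, fun t ht => ?_, fun t ht j hj => ?_⟩
  · rw [smul_comm]
    exact (h.deriv_D t ht).const_smul q
  · have h1 := (h.deriv_E_zero t ht).const_smul q
    have h2 : imQuat (fun a => imComp (q * imQuat (fun a => φ a t) * star q) a) =
        q * imQuat (fun a => φ a t) * star q := imQuat_imComp (re_conj (imQuat_re _))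
    rw [h2, smul_smul, mul_assoc, star_mul_self_of_norm hq, mul_one]
    refine h1.congr_deriv ?_
    rw [smul_sub, Finset.smul_sum, smul_smul]
    exact congrArg _ (Finset.sum_congr rfl fun j _ => smul_comm _ _ _)
  · rw [smul_comm]
    exact (h.deriv_E t ht j hj).const_smul q

/-- The structure equations are of first order, so a new parameter multiplies every coefficient by
σ'. This serves both the parameter ∫α_2 and the normalization of φ. -/
theorem IsNormalForm.reparam (h : IsNormalForm J D E β α φ) {σ ρ : ℝ → ℝ}
    (hσ : ContDiffOn ℝ ∞ σ S) (hm : MapsTo σ S J) (hd : ∀ s ∈ S, HasDerivAt σ (ρ s) s) :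
    IsNormalForm S (fun s => D (σ s)) (fun i s => E i (σ s)) (fun s => ρ s * β (σ s))
      (fun j s => ρ s * α j (σ s)) (fun a s => ρ s * φ a (σ s)) := by
  refine ⟨h.smooth_D.comp hσ hm, fun i => (h.smooth_E i).comp hσ hm,
    fun s hs => h.frame _ (hm hs), fun s hs => ?_, fun s hs => ?_, fun s hs j hj => ?_⟩
  · rw [mul_smul]
    exact (h.deriv_D _ (hm hs)).scomp s (hd s hs)
  · have h1 := (h.deriv_E_zero _ (hm hs)).scomp s (hd s hs)
    have h2 : imQuat (fun a => ρ s * φ a (σ s)) = ρ s • imQuat (fun a => φ a (σ s)) := by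
      ext <;> simp
    rw [h2]
    refine h1.congr_deriv ?_
    rw [smul_sub, Finset.smul_sum, smul_assoc]
    exact congrArg _ (Finset.sum_congr rfl fun j _ => smul_smul _ _ _)
  · rw [mul_smul]
    exact (h.deriv_E _ (hm hs) j hj).scomp s (hd s hs)

theorem IsNormalForm.inner_fderiv (h : IsNormalForm J D E β α φ) {x : En n} (hx : x 0 ∈ J)
    (i j : Fin n) : ⟪fderiv ℝ (nfMap D E) x (coordVec i), fderiv ℝ (nfMap D E) x (coordVec j)⟫_ℝ =
      twistedMetric (fun x => β (x 0) + ∑ j ∈ Finset.univ.erase 0, α j (x 0) * x j) x i j := by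
  have hfr := h.frame _ hx
  by_cases hi : i = 0 <;> by_cases hj : j = 0
  · subst hi hj
    rw [h.fderiv_coordVec_zero hx, inner_smul_left, inner_smul_right, hfr.inner, twistedMetric]
    simp [sq]
  · subst hi
    rw [h.fderiv_coordVec_zero hx, h.fderiv_coordVec hx hj, inner_smul_left, hfr.inner,
      twistedMetric]
    simp [Ne.symm hj]
  · subst hj
    rw [h.fderiv_coordVec_zero hx, h.fderiv_coordVec hx hi, inner_smul_right, hfr.inner,
      twistedMetric]
    simp [hi]
  · rw [h.fderiv_coordVec hx hj, h.fderiv_coordVec hx hi, hfr.inner, twistedMetric]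
    simp [hi]

/-- If the twisting function depends on the first coordinate only, then the map is a Lagrangian
cylinder. -/
theorem IsNormalForm.isLagrangianCylinder {T : Set (En n)} (hT : IsOpen T) (hT' : IsPreconnected T)
    (h : IsNormalForm (firstRange T) D E β α φ) {x₀ : En n} (hx₀ : x₀ ∈ T)
    (hα : ∀ x ∈ T, ∀ j, j ≠ 0 → α j (x 0) = 0) {F : En n → Hn n}
    (hF : ∀ x ∈ T, F x = nfMap D E x) :
    IsLagrangianCylinder T F D (fun j => E j (x₀ 0)) := by
  have hmem : ∀ x ∈ T, x 0 ∈ firstRange T := fun x hx => mem_image_of_mem _ hx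
  have hc : ∀ x ∈ T, ∀ j, j ≠ 0 → E j (x 0) = E j (x₀ 0) := by
    intro x hx j hj
    have hd : ∀ t ∈ firstRange T, HasDerivAt (E j) 0 t := by
      rintro _ ⟨y, hy, rfl⟩
      have := h.deriv_E _ (hmem y hy) j hj
      rwa [hα y hy j hj, zero_smul] at this
    exact (isOpen_firstRange hT).is_const_of_deriv_eq_zero
      (ordConnected_firstRange hT').isPreconnected
      (fun t ht => (hd t ht).differentiableAt.differentiableWithinAt)
      (fun t ht => (hd t ht).deriv) (hmem x hx) (hmem x₀ hx₀)
  have hfr := h.frame _ (hmem x₀ hx₀)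
  refine ⟨h.smooth_D, fun x hx => ?_, fun j k _ _ => hfr.inner j k,
    fun a j k _ _ => hfr.inner_imUnit a j k, fun x hx r j hj => ?_⟩
  · rw [hF x hx, nfMap]
    congr 1
    exact Finset.sum_congr rfl fun j hj => by rw [hc x hx j (Finset.ne_of_mem_erase hj)]
  · rw [(h.deriv_D _ (hmem x hx)).deriv, inner_smul_left, ← hc x hx j hj,
      ← one_smul ℍ[ℝ] (E 0 (x 0)), (h.frame _ (hmem x hx)).inner_smul, if_neg hj.symm, mul_zero]

/-- In a normal form with `α₂ = 1`, the vector `E₂` traces a special Legendre curve. -/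
theorem IsNormalForm.isSpecialLegendre (hS : IsOpen S) (h : IsNormalForm S D E β α φ)
    (h1 : (1 : Fin n) ≠ 0) (hα : ∀ s ∈ S, α 1 s = 1) : IsSpecialLegendre S (E 1) E := by
  -- Since E_0 = z', the equation for E_0 becomes the equation for z'', with the term α_1E_1 turning
  -- into z.
  have hz : ∀ s ∈ S, deriv (E 1) s = E 0 s := by
    intro s hs
    have := h.deriv_E s hs 1 h1
    rw [hα s hs, one_smul] at this
    exact this.deriv
  have hn : ∀ s ∈ S, ∀ i, ‖E i s‖ = 1 := by
    intro s hs i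
    have := (h.frame s hs).inner i i
    rw [if_pos rfl, real_inner_self_eq_norm_sq] at this
    nlinarith [norm_nonneg (E i s)]
  refine ⟨h.smooth_E 1, fun l _ _ => h.smooth_E l, fun s hs => hn s hs 1, fun s hs => ?_,
    fun s hs a => ?_, fun s hs => ?_, fun s hs l hl0 _ => ?_, ?_⟩
  · rw [hz s hs, hn s hs]
  · rw [hz s hs, real_inner_comm, (h.frame s hs).inner_imUnit]
  · convert (h.frame s hs).orthonormal using 2 with r
    rw [hz s hs]
    congr 1
    split_ifs with h0 h2
    · rw [h0]
    · rw [h2]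
    · rfl
  · rw [(h.deriv_E s hs l hl0).deriv, hz s hs]
    exact Submodule.smul_mem _ _ (Submodule.subset_span (by simp))
  · refine ⟨φ, α, fun s hs => ?_⟩
    have he : deriv (E 1) =ᶠ[𝓝 s] E 0 := Filter.mem_of_superset (hS.mem_nhds hs) hz
    rw [he.deriv_eq, (h.deriv_E_zero s hs).deriv, hz s hs, sum_smul_imUnit_smul,
      ← Finset.add_sum_erase (Finset.univ.erase 0) _ (Finset.mem_erase.2 ⟨h1, Finset.mem_univ _⟩),
      hα s hs, one_smul, sub_sub]

theorem nfMap_eq_of_ne (h1 : (1 : Fin n) ≠ 0) (x : En n) : nfMap D E x =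
    D (x 0) + (x 1 • E 1 (x 0) + ∑ j ∈ (Finset.univ.erase 0).erase 1, x j • E j (x 0)) := by
  rw [nfMap, Finset.add_sum_erase (Finset.univ.erase 0) (fun j => x j • E j (x 0))
    (Finset.mem_erase.2 ⟨h1, Finset.mem_univ _⟩)]

/-- A primitive of a function without zeros is a diffeomorphism. -/
theorem exists_diffeo_primitive (hJ : IsOpen J) (hc : J.OrdConnected) {w : ℝ → ℝ}
    (hw : ContDiffOn ℝ ∞ w J) (hw0 : ∀ t ∈ J, w t ≠ 0) {o : ℝ} (ho : o ∈ J) :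
    ∃ e : OpenPartialHomeomorph ℝ ℝ, e.source = J ∧ (∀ t, e t = ∫ s in o..t, w s) ∧
      ContDiffOn ℝ ∞ e.symm e.target ∧ ∀ s ∈ e.target, HasDerivAt e.symm (w (e.symm s))⁻¹ s := by
  have hd : ∀ t ∈ J, HasDerivAt (fun t => ∫ s in o..t, w s) (w t) t := fun t ht =>
    hasDerivAt_primitive hJ hc hw.continuousOn ho ht
  have hne : ∀ a ∈ J, ∀ b ∈ J, a < b → (∫ s in o..a, w s) ≠ ∫ s in o..b, w s := by
    intro a ha b hb hab heq
    have hsub : Icc a b ⊆ J := hc.out ha hb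
    obtain ⟨c, hc', h0⟩ := exists_hasDerivAt_eq_zero hab
      (fun t ht => (hd t (hsub ht)).continuousAt.continuousWithinAt) heq
      (fun t ht => hd t (hsub (Ioo_subset_Icc_self ht)))
    exact hw0 c (hsub (Ioo_subset_Icc_self hc')) h0
  obtain ⟨e, he, hef, hes⟩ := exists_diffeo_of_injOn hJ (contDiffOn_primitive hJ hc hw ho)
    (fun a ha b hb hab => by
      rcases lt_trichotomy a b with h | h | h
      · exact absurd hab (hne a ha b hb h)
      · exact h
      · exact absurd hab.symm (hne b hb a ha h))
    (fun t ht => by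
      rw [(hd t ht).hasFDerivAt.fderiv]
      intro v v' hv
      simpa [hw0 t ht] using hv)
  refine ⟨e, he, hef, hes, fun s hs => ?_⟩
  have hm : e.symm s ∈ J := he ▸ e.map_target hs
  refine e.hasDerivAt_symm hs (hw0 _ hm) ?_
  rw [show (e : ℝ → ℝ) = fun t => ∫ s in o..t, w s from funext hef]
  exact hd _ hm

/-- The diffeomorphism that changes the first coordinate only. -/
theorem exists_diffeo_first {e : OpenPartialHomeomorph ℝ ℝ} {w : ℝ → ℝ}
    (he : ContDiffOn ℝ ∞ e e.source) (hw : ∀ t ∈ e.source, HasDerivAt e (w t) t)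
    (hw0 : ∀ t ∈ e.source, w t ≠ 0) {T : Set (En n)} (hT : IsOpen T)
    (hTe : ∀ x ∈ T, x 0 ∈ e.source) :
    ∃ ψ : OpenPartialHomeomorph (En n) (En n), ψ.source = T ∧ (∀ x, ψ x 0 = e (x 0)) ∧
      (∀ x j, j ≠ 0 → ψ x j = x j) ∧ ContDiffOn ℝ ∞ ψ ψ.source ∧
      ContDiffOn ℝ ∞ ψ.symm ψ.target := by
  let f : En n → En n := fun x => x + (e (x 0) - x 0) • coordVec 0
  have hf0 : ∀ x, f x 0 = e (x 0) := fun x => by simp [f]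
  have hfj : ∀ x j, j ≠ 0 → f x j = x j := fun x j hj => by simp [f, hj]
  have hfs : ContDiffOn ℝ ∞ f T := contDiffOn_id.add
    (((contDiffOn_comp_firstRange he hTe).sub (contDiff_coord 0).contDiffOn).smul contDiffOn_const)
  have hfd : ∀ x ∈ T, HasFDerivAt f (ContinuousLinearMap.id ℝ (En n) +
      ((projZero (n := n)).smulRight (w (x 0)) - projZero).smulRight (coordVec 0)) x := fun x hx =>
    (hasFDerivAt_id x).add (((hasFDerivAt_comp_coord (hw _ (hTe x hx))).sub
      (projZero (n := n)).hasFDerivAt).smul_const (coordVec 0 : En n))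
  obtain ⟨ψ, h1, h2, h3⟩ := exists_diffeo_of_injOn hT hfs (fun x hx y hy hxy => by
      ext j
      by_cases hj : j = 0
      · subst hj
        apply e.injOn (hTe x hx) (hTe y hy)
        rw [← hf0, ← hf0, hxy]
      · rw [← hfj x j hj, hxy, hfj y j hj])
    (fun x hx => by
      rw [(hfd x hx).fderiv, injective_iff_map_eq_zero]
      intro v hv
      have hv' : ∀ j, v j + (v 0 * w (x 0) - v 0) * (coordVec 0 : En n) j = 0 := fun j => by
        have := congrArg (fun u : En n => u j) hv
        simpa using this
      have h0 : v 0 = 0 := by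
        have := hv' 0
        simpa [hw0 _ (hTe x hx)] using this
      ext j
      simpa [h0] using hv' j)
  refine ⟨ψ, h1, fun x => by rw [h2, hf0], fun x j hj => by rw [h2, hfj x j hj], ?_, h3⟩
  rw [h1]
  exact hfs.congr fun x _ => h2 x

end Formulas

/-! ### The explicit formulas (i) and (ii) in adapted coordinates -/

section AdaptedCharts

variable {n : ℕ} [NeZero n] {M : Type*} [TopologicalSpace M] [ChartedSpace (En n) M]
  [IsManifold 𝓘(ℝ, En n) ∞ M] {g : SmoothMetric n M} {L : M → Hn n}
  {Φ : OpenPartialHomeomorph M (En n)} {f : En n → ℝ} {fc : Fin 3 → En n → ℝ} {β : ℝ → ℝ}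
  {α : Fin n → ℝ → ℝ} {q : ℍ[ℝ]}

/-- Part (a) puts qL in normal form, and multiplying by q̄ brings this back to L itself. The
conjugation affects φ only, while β and α stay the given ones. -/
theorem IsAdaptedChart.exists_normalForm (h : IsAdaptedChart g L Φ f fc β α q) :
    ∃ (φ : Fin 3 → ℝ → ℝ) (D : ℝ → Hn n) (E : Fin n → ℝ → Hn n),
      IsNormalForm (firstRange Φ.target) D E β α φ ∧
      ∀ x ∈ Φ.target, L (Φ.symm x) = nfMap D E x := by
  obtain ⟨φ, D, E, hN, hF⟩ := h.isLf.exists_normalForm h.data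
  have hq : ‖star q‖ = 1 := by rw [norm_star, h.norm_q]
  refine ⟨_, _, _, hN.smul hq, fun x hx => ?_⟩
  have h1 : L (Φ.symm x) = star q • (q • L (Φ.symm x)) := by
    rw [smul_smul, star_mul_self_of_norm h.norm_q, one_smul]
  rw [h1, hF x hx, nfMap, nfMap, smul_add, Finset.smul_sum]
  simp only [smul_comm (star q)]

theorem IsAdaptedChart.exists_isLagrangianCylinder (h : IsAdaptedChart g L Φ f fc β α q)
    (hα : ∀ x ∈ Φ.target, ∀ j, j ≠ 0 → α j (x 0) = 0) :
    ∃ (D : ℝ → Hn n) (c : Fin n → Hn n),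
      IsLagrangianCylinder Φ.target (fun x => L (Φ.symm x)) D c := by
  obtain ⟨φ, D, E, hN, hF⟩ := h.exists_normalForm
  obtain ⟨x₀, hx₀⟩ := h.data.simplyConnected.nonempty
  exact ⟨D, _, hN.isLagrangianCylinder h.data.isOpen h.data.isPreconnected hx₀ hα hF⟩

/-- With t = ∫α_1 all coefficients are divided by α_1, the one belonging to E_1 becomes 1, and E_1
is the Legendre curve. Only the first coordinate changes, so the domain is kept. -/
theorem IsAdaptedChart.exists_isSpecialLegendre (hL : IsLagrangianIsometricImmersion g L)
    (h1 : (1 : Fin n) ≠ 0) (h : IsAdaptedChart g L Φ f fc β α q)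
    (hα : ∀ x ∈ Φ.target, α 1 (x 0) ≠ 0) {o : ℝ} (ho : o ∈ firstRange Φ.target) :
    ∃ (Ψ : OpenPartialHomeomorph M (En n)) (b : ℝ → ℝ) (a : Fin n → ℝ → ℝ)
      (z : ℝ → Hn n) (P : Fin n → ℝ → Hn n) (c : Hn n) (S : Set ℝ),
      Ψ.source = Φ.source ∧ S = (fun u : En n => u 0) '' Ψ.target ∧
      (∀ y ∈ Φ.source, Ψ y 0 = ∫ s in o..(Φ y 0), α 1 s) ∧
      (∀ y ∈ Φ.source, ∀ j, j ≠ 0 → Ψ y j = Φ y j) ∧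
      ContDiffOn ℝ ∞ b S ∧
      (∀ j, j ≠ 0 → j ≠ 1 → ContDiffOn ℝ ∞ (a j) S) ∧
      IsTwistedChart g Ψ
        (fun u => b (u 0) + u 1 + ∑ j ∈ (Finset.univ.erase 0).erase 1, a j (u 0) * u j) ∧
      IsSpecialLegendre S z P ∧
      ∀ u ∈ Ψ.target, L (Ψ.symm u) =
        u 1 • z (u 0) + (∑ j ∈ (Finset.univ.erase 0).erase 1, u j • P j (u 0))
          + (∫ s in (0 : ℝ)..(u 0), b s • deriv z s) + c := by
  have hT := h.data.isOpen
  have hJ := isOpen_firstRange hT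
  have hJc := ordConnected_firstRange h.data.isPreconnected
  have hα' : ∀ t ∈ firstRange Φ.target, α 1 t ≠ 0 := by
    rintro _ ⟨x, hx, rfl⟩
    exact hα x hx
  have hmem : ∀ x ∈ Φ.target, x 0 ∈ firstRange Φ.target := fun x hx => mem_image_of_mem _ hx
  obtain ⟨φ, D, E, hN, hF⟩ := h.exists_normalForm
  have hαs := fun j (hj : j ≠ 0) => h.data.contDiffOn_alpha hj
  obtain ⟨e, hes, hef, hesm, hed⟩ := exists_diffeo_primitive hJ hJc (hαs 1 h1) hα' ho
  have hefun : (e : ℝ → ℝ) = fun t => ∫ s in o..t, α 1 s := funext hef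
  obtain ⟨ψ, hψs, hψ0, hψj, hψ1, hψ2⟩ := exists_diffeo_first (n := n) (e := e) (w := α 1)
    (by rw [hes, hefun]; exact contDiffOn_primitive hJ hJc (hαs 1 h1) ho)
    (by rw [hes, hefun]; exact fun t ht => hasDerivAt_primitive hJ hJc (hαs 1 h1).continuousOn ho ht)
    (by rwa [hes]) hT (by rwa [hes])
  have hσm : MapsTo e.symm e.target (firstRange Φ.target) := fun s hs => hes ▸ e.map_target hs
  have hN' := hN.reparam hesm hσm hed
  have hone : ∀ s ∈ e.target, (α 1 (e.symm s))⁻¹ * α 1 (e.symm s) = 1 := fun s hs =>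
    inv_mul_cancel₀ (hα' _ (hσm hs))
  have hΨs : (Φ.trans ψ).source = Φ.source := by
    ext y
    simp only [OpenPartialHomeomorph.trans_source, hψs, mem_inter_iff, mem_preimage]
    exact ⟨fun hy => hy.1, fun hy => ⟨hy, Φ.map_source hy⟩⟩
  have hx : ∀ u ∈ (Φ.trans ψ).target, ∃ x ∈ Φ.target, ψ.symm u = x ∧ u 0 = e (x 0) ∧
      e.symm (u 0) = x 0 ∧ u 0 ∈ e.target ∧ ∀ j, j ≠ 0 → u j = x j := by
    intro u hu
    rw [OpenPartialHomeomorph.trans_target] at hu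
    have hux : ψ (ψ.symm u) = u := ψ.right_inv hu.1
    have h0 : u 0 = e (ψ.symm u 0) := by rw [← hψ0, hux]
    have hxs : ψ.symm u 0 ∈ e.source := hes ▸ hmem _ hu.2
    refine ⟨ψ.symm u, hu.2, rfl, h0, ?_, ?_, fun j hj => by rw [← hψj (ψ.symm u) j hj, hux]⟩
    · rw [h0, e.left_inv hxs]
    · rw [h0]; exact e.map_source hxs
  have hS : e.target = (fun u : En n => u 0) '' (Φ.trans ψ).target := by
    ext s
    constructor
    · intro hs
      obtain ⟨x, hxT, hxs⟩ := hσm hs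
      have hxψ : x ∈ ψ.source := hψs ▸ hxT
      refine ⟨ψ x, ?_, ?_⟩
      · rw [OpenPartialHomeomorph.trans_target]
        exact ⟨ψ.map_source hxψ, by rw [mem_preimage, ψ.left_inv hxψ]; exact hxT⟩
      · simp only [hψ0]
        rw [show x 0 = e.symm s from hxs, e.right_inv hs]
    · rintro ⟨u, hu, rfl⟩
      obtain ⟨x, -, -, -, -, hm, -⟩ := hx u hu
      exact hm
  have heo : e o = 0 := by rw [hef, intervalIntegral.integral_same]
  have h0S : (0 : ℝ) ∈ e.target := heo ▸ e.map_source (hes ▸ ho)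
  have hSc : e.target.OrdConnected := by
    rw [← e.image_source_eq_target, hes]
    exact (hJc.isPreconnected.image _ (hes ▸ e.continuousOn)).ordConnected
  have hρs : ContDiffOn ℝ ∞ (fun s => (α 1 (e.symm s))⁻¹) e.target :=
    ((hαs 1 h1).comp hesm hσm).inv fun s hs => hα' _ (hσm hs)
  have hbs : ContDiffOn ℝ ∞ (fun s => (α 1 (e.symm s))⁻¹ * β (e.symm s)) e.target :=
    hρs.mul (h.data.contDiffOn_beta.comp hesm hσm)
  have hG : ∀ u ∈ (Φ.trans ψ).target, L ((Φ.trans ψ).symm u) =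
      nfMap (fun s => D (e.symm s)) (fun i s => E i (e.symm s)) u := by
    intro u hu
    obtain ⟨x, hxT, hxu, -, hx1, -, hxj⟩ := hx u hu
    rw [OpenPartialHomeomorph.trans_symm_eq_symm_trans_symm, OpenPartialHomeomorph.coe_trans,
      Function.comp_apply, hxu, hF x hxT, nfMap, nfMap, hx1]
    congr 1
    exact Finset.sum_congr rfl fun j hj => by rw [hxj j (Finset.ne_of_mem_erase hj)]
  have hLeg := hN'.isSpecialLegendre e.open_target h1 hone
  have hdz : ∀ s ∈ e.target, deriv (fun s => E 1 (e.symm s)) s = E 0 (e.symm s) := by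
    intro s hs
    have := hN'.deriv_E s hs 1 h1
    rw [hone s hs, one_smul] at this
    exact this.deriv
  refine ⟨Φ.trans ψ, fun s => (α 1 (e.symm s))⁻¹ * β (e.symm s),
    fun j s => (α 1 (e.symm s))⁻¹ * α j (e.symm s), fun s => E 1 (e.symm s),
    fun j s => E j (e.symm s), D o, e.target, hΨs, hS, fun y hy => ?_, fun y hy j hj => ?_, hbs,
    fun j hj _ => hρs.mul ((hαs j hj).comp hesm hσm), ?_, hLeg, fun u hu => ?_⟩
  · rw [OpenPartialHomeomorph.coe_trans, Function.comp_apply, hψ0, hef]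
  · rw [OpenPartialHomeomorph.coe_trans, Function.comp_apply, hψj _ j hj]
  · have hΨ := trans_mem_maximalAtlas h.twisted.1 hψ1 hψ2
    refine ⟨hΨ, fun u hu i j => ?_⟩
    obtain ⟨x, -, -, -, -, hm, -⟩ := hx u hu
    have hev : (L ∘ (Φ.trans ψ).symm) =ᶠ[𝓝 u]
        nfMap (fun s => D (e.symm s)) (fun i s => E i (e.symm s)) :=
      Filter.mem_of_superset ((Φ.trans ψ).open_target.mem_nhds hu) hG
    rw [metricCoeff_eq hL hΨ hu, hev.fderiv_eq, hN'.inner_fderiv hm, twistedMetric, twistedMetric]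
    have : ∑ j ∈ Finset.univ.erase 0, (α 1 (e.symm (u 0)))⁻¹ * α j (e.symm (u 0)) * u j =
        u 1 + ∑ j ∈ (Finset.univ.erase 0).erase 1,
          (α 1 (e.symm (u 0)))⁻¹ * α j (e.symm (u 0)) * u j := by
      rw [← Finset.add_sum_erase (Finset.univ.erase 0) _
        (Finset.mem_erase.2 ⟨h1, Finset.mem_univ _⟩), hone _ hm, one_mul]
    rw [this, add_assoc]
  · obtain ⟨x, -, -, -, -, hm, -⟩ := hx u hu
    have hsub : uIcc 0 (u 0) ⊆ e.target := hSc.uIcc_subset h0S hm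
    -- D' = bE_0 = bz' in the new parameter, so the integral is an increment of D. As x₁ = o
    -- corresponds to t = 0, the constant is D(o).
    have hint : ∫ s in (0 : ℝ)..(u 0), ((α 1 (e.symm s))⁻¹ * β (e.symm s)) •
        deriv (fun s => E 1 (e.symm s)) s = D (e.symm (u 0)) - D (e.symm 0) := by
      refine intervalIntegral.integral_eq_sub_of_hasDerivAt (f := fun s => D (e.symm s))
        (fun s hs => ?_) (ContinuousOn.intervalIntegrable ?_)
      · rw [hdz s (hsub hs)]
        exact hN'.deriv_D s (hsub hs)
      · exact ((hbs.continuousOn.mono hsub).smul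
          (((hN'.smooth_E 0).continuousOn.mono hsub).congr fun s hs => hdz s (hsub hs)))
    have heo' : e.symm 0 = o := by rw [← heo, e.left_inv (hes ▸ ho)]
    rw [hG u hu, nfMap_eq_of_ne h1, hint, heo']
    abel

end AdaptedCharts

/-! ## The Gauss equation in graph coordinates -/

section Gauss

variable {n : ℕ}

/-- The product rule at a zero of the second factor, with a merely continuous first factor. -/
theorem hasFDerivAt_mul_of_continuousAt {V : Type*} [NormedAddCommGroup V] [NormedSpace ℝ V]
    {a b : V → ℝ} {b' : V →L[ℝ] ℝ} {x : V} (ha : ContinuousAt a x) (hb : HasFDerivAt b b' x)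
    (h0 : b x = 0) : HasFDerivAt (fun y => a y * b y) (a x • b') x := by
  have h1 : HasFDerivAt (fun y => a x * b y) (a x • b') x := hb.const_mul (a x)
  have h2 : HasFDerivAt (fun y => (a y - a x) * b y) (0 : V →L[ℝ] ℝ) x := by
    refine HasFDerivAt.of_isLittleO ?_
    have h3 : (fun y => a y - a x) =o[𝓝 x] fun _ => (1 : ℝ) := by
      rw [Asymptotics.isLittleO_one_iff]
      exact tendsto_sub_nhds_zero_iff.2 ha
    have h4 : b =O[𝓝 x] fun y => y - x := by
      simpa only [h0, sub_zero] using hb.isBigO_sub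
    have h5 := h3.mul_isBigO h4.norm_right
    simp only [one_mul] at h5
    simpa only [h0, sub_self, mul_zero, zero_apply, sub_zero] using h5.of_norm_right
  refine ((h1.add h2).congr_fderiv (add_zero _)).congr_of_eventuallyEq
    (Filter.Eventually.of_forall fun y => ?_)
  simp only [Pi.add_apply]
  ring

theorem continuousAt_matrix_inv_entry {X : Type*} [TopologicalSpace X]
    {A : X → Matrix (Fin n) (Fin n) ℝ} {x : X} (hA : ContinuousAt A x) (h : A x = 1)
    (k l : Fin n) : ContinuousAt (fun y => (A y)⁻¹ k l) x := by
  have h1 : ContinuousAt (fun B : Matrix (Fin n) (Fin n) ℝ => B⁻¹) (A x) :=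
    continuousAt_matrix_inv _ (by
      rw [h, Matrix.det_one, Ring.inverse_eq_inv']
      exact continuousAt_inv₀ one_ne_zero)
  exact (continuous_apply_apply k l).continuousAt.comp (h1.comp hA)

/-- The partial derivative `∂_i F` of a vector valued map. -/
def vderiv (i : Fin n) (F : En n → Hn n) (x : En n) : Hn n := fderiv ℝ F x (coordVec i)

variable {F : En n → Hn n} {U : Set (En n)}

theorem contDiffOn_vderiv (hU : IsOpen U) (hF : ContDiffOn ℝ ∞ F U) (i : Fin n) :
    ContDiffOn ℝ ∞ (vderiv i F) U :=
  (hF.fderiv_of_isOpen hU (m := ∞) (by simp)).clm_apply contDiffOn_const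

theorem vderiv_vderiv {x : En n} (hF : ContDiffAt ℝ ∞ F x) (i j : Fin n) : vderiv i (vderiv j F) x =
    fderiv ℝ (fun y => fderiv ℝ F y) x (coordVec i) (coordVec j) :=
  (snd_fderiv_apply hF _ _).symm

theorem vderiv_comm {x : En n} (hF : ContDiffAt ℝ ∞ F x) (i j : Fin n) :
    vderiv i (vderiv j F) x = vderiv j (vderiv i F) x := by
  rw [vderiv_vderiv hF, vderiv_vderiv hF, snd_fderiv_symm hF]

theorem pderiv_inner {H K : En n → Hn n} {x : En n} (hH : DifferentiableAt ℝ H x)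
    (hK : DifferentiableAt ℝ K x) (i : Fin n) :
    pderiv i (fun y => ⟪H y, K y⟫_ℝ) x = ⟪vderiv i H x, K x⟫_ℝ + ⟪H x, vderiv i K x⟫_ℝ := by
  rw [pderiv, fderiv_inner_apply ℝ hH hK, add_comm]
  rfl

/-- The Gauss equation for a flat graph, at the point where the graph coordinates are normal. -/
theorem gauss_of_flat (hU : IsOpen U) (h0U : (0 : En n) ∈ U) (hF : ContDiffOn ℝ ∞ F U)
    {b : Fin n → Hn n} (hb : ∀ u ∈ U, ∀ v i, ⟪fderiv ℝ F u v, b i⟫_ℝ = v i)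
    (h0 : ∀ i, fderiv ℝ F 0 (coordVec i) = b i) {G : En n → Fin n → Fin n → ℝ}
    (hG : ∀ x ∈ U, ∀ i j, G x i j = ⟪fderiv ℝ F x (coordVec i), fderiv ℝ F x (coordVec j)⟫_ℝ)
    (hR : ∀ l k i j, riemannCoeff G l k i j 0 = 0) (i j k l : Fin n) :
    ⟪vderiv j (vderiv k F) 0, vderiv i (vderiv l F) 0⟫_ℝ =
      ⟪vderiv i (vderiv k F) 0, vderiv j (vderiv l F) 0⟫_ℝ := by
  have hU0 : U ∈ 𝓝 (0 : En n) := hU.mem_nhds h0U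
  have hFa : ∀ {x}, x ∈ U → ContDiffAt ℝ ∞ F x := fun hx => hF.contDiffAt (hU.mem_nhds hx)
  have hda : ∀ {H : En n → Hn n} {x}, ContDiffOn ℝ ∞ H U → x ∈ U → DifferentiableAt ℝ H x :=
    fun hH hx => (hH.contDiffAt (hU.mem_nhds hx)).differentiableAt (by simp)
  have hH := fun i => contDiffOn_vderiv hU hF i
  have hK := fun i j => contDiffOn_vderiv hU (hH j) i
  have hGe : ∀ i j, ∀ x ∈ U, (fun y => G y i j) =ᶠ[𝓝 x] fun y => ⟪vderiv i F y, vderiv j F y⟫_ℝ :=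
    fun i j x hx => Filter.mem_of_superset (hU.mem_nhds hx) fun y hy => hG y hy i j
  have hpG : ∀ m i j, ∀ x ∈ U, pderiv m (fun y => G y i j) x =
      ⟪vderiv m (vderiv i F) x, vderiv j F x⟫_ℝ + ⟪vderiv i F x, vderiv m (vderiv j F) x⟫_ℝ := by
    intro m i j x hx
    rw [pderiv, (hGe i j x hx).fderiv_eq]
    exact pderiv_inner (hda (hH i) hx) (hda (hH j) hx) m
  -- As for any immersed submanifold, lowering the index turns Γ into the products ⟨∂_i∂_jF, ∂_lF⟩.
  have hΓ : ∀ k i j, ∀ x ∈ U, christoffel G k i j x =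
      ∑ l, (Matrix.of (G x))⁻¹ k l * ⟪vderiv i (vderiv j F) x, vderiv l F x⟫_ℝ := by
    intro k i j x hx
    rw [christoffel, Finset.mul_sum]
    refine Finset.sum_congr rfl fun l _ => ?_
    rw [hpG _ _ _ x hx, hpG _ _ _ x hx, hpG _ _ _ x hx, vderiv_comm (hFa hx) j i,
      vderiv_comm (hFa hx) l i, vderiv_comm (hFa hx) l j,
      real_inner_comm (vderiv i (vderiv l F) x)]
    ring
  have hδ : ∀ x ∈ U, ∀ i j, ⟪vderiv i F x, b j⟫_ℝ = (coordVec i : En n) j := fun x hx i j =>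
    hb x hx _ j
  -- The graph condition fixes the pairings of ∂_iF with the constant vectors b_j, so second and
  -- third derivatives of F are orthogonal to all b_j. In particular Γ vanishes at the origin, where
  -- ∂_lF = b_l.
  have hconst : ∀ {H : En n → Hn n} {j : Fin n} {c : ℝ}, ContDiffOn ℝ ∞ H U →
      (∀ x ∈ U, ⟪H x, b j⟫_ℝ = c) → ∀ i, ∀ x ∈ U, ⟪vderiv i H x, b j⟫_ℝ = 0 := by
    intro H j c hH' hc i x hx
    have h1 := pderiv_inner (hda hH' hx) (differentiableAt_const (b j)) i
    have h2 : (fun y => ⟪H y, b j⟫_ℝ) =ᶠ[𝓝 x] fun _ => c :=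
      Filter.mem_of_superset (hU.mem_nhds hx) hc
    rw [pderiv, h2.fderiv_eq] at h1
    simpa [vderiv] using h1.symm
  have hKb : ∀ i j l, ∀ x ∈ U, ⟪vderiv i (vderiv j F) x, b l⟫_ℝ = 0 := fun i j l =>
    hconst (hH j) (fun x hx => hδ x hx j l) i
  have hKKb : ∀ m i j l, ⟪vderiv m (vderiv i (vderiv j F)) 0, b l⟫_ℝ = 0 := fun m i j l =>
    hconst (hK i j) (hKb i j l) m 0 h0U
  have h0' : ∀ l, vderiv l F 0 = b l := h0
  have hA0 : Matrix.of (G 0) = 1 := by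
    ext i j
    rw [Matrix.of_apply, hG 0 h0U, h0 j, hb 0 h0U, Matrix.one_apply]
    simp [eq_comm]
  have hAc : ContinuousAt (fun x => Matrix.of (G x)) 0 := by
    refine continuousAt_pi.2 fun i => continuousAt_pi.2 fun j => ?_
    refine ContinuousAt.congr ?_ (hGe i j 0 h0U).symm
    exact (hda (hH i) h0U).continuousAt.inner (hda (hH j) h0U).continuousAt
  have hΓ0 : ∀ k i j, christoffel G k i j 0 = 0 := by
    intro k i j
    rw [hΓ k i j 0 h0U]
    refine Finset.sum_eq_zero fun l _ => ?_
    rw [h0', hKb _ _ _ 0 h0U, mul_zero]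
  -- The second factors of Γ vanish at the origin, so the inverse metric need only be continuous
  -- there. The third derivative drops out by `hKKb`.
  have hdΓ : ∀ m k i j, pderiv m (christoffel G k i j) 0 =
      ⟪vderiv i (vderiv j F) 0, vderiv m (vderiv k F) 0⟫_ℝ := by
    intro m k i j
    have h1 : christoffel G k i j =ᶠ[𝓝 0] fun x =>
        ∑ l, (Matrix.of (G x))⁻¹ k l * ⟪vderiv i (vderiv j F) x, vderiv l F x⟫_ℝ :=
      Filter.mem_of_superset hU0 (hΓ k i j)
    have h2 : HasFDerivAt (fun x =>
        ∑ l, (Matrix.of (G x))⁻¹ k l * ⟪vderiv i (vderiv j F) x, vderiv l F x⟫_ℝ)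
        (∑ l, (Matrix.of (G 0))⁻¹ k l •
          fderiv ℝ (fun x => ⟪vderiv i (vderiv j F) x, vderiv l F x⟫_ℝ) 0) 0 := by
      refine HasFDerivAt.fun_sum fun l _ => hasFDerivAt_mul_of_continuousAt
        (continuousAt_matrix_inv_entry hAc hA0 k l) ?_ ?_
      · exact ((hda (hK i j) h0U).inner ℝ (hda (hH l) h0U)).hasFDerivAt
      · rw [h0', hKb _ _ _ 0 h0U]
    rw [pderiv, h1.fderiv_eq, h2.fderiv, hA0, inv_one, sum_apply, Finset.sum_eq_single k]
    · rw [Matrix.one_apply_eq, one_smul]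
      refine (pderiv_inner (hda (hK i j) h0U) (hda (hH k) h0U) m).trans ?_
      rw [h0', hKKb, zero_add]
    · intro l _ hl
      rw [Matrix.one_apply_ne hl.symm, zero_smul, zero_apply]
    · exact fun h => absurd (Finset.mem_univ k) h
  have h1 := hR l k i j
  rw [riemannCoeff, hdΓ, hdΓ] at h1
  simp only [hΓ0, mul_zero, sub_zero, Finset.sum_const_zero, add_zero] at h1
  exact sub_eq_zero.1 h1

end Gauss

/-! ## Graphs whose second fundamental form has rank one -/

section Developable

variable {n : ℕ}

/-- On the open set `U` the map `F` is a totally real graph over the span of the vectors `b i`, and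
its second fundamental form is `θ ⊗ θ ⊗ ν N`, where `N` is a unit tangent field, `θ` is dual to `N`,
and `ν` is an imaginary quaternion. -/
structure IsRankOneGraph (U : Set (En n)) (F : En n → Hn n) (b : Fin n → Hn n) (N : En n → Hn n)
    (ν : En n → ℍ[ℝ]) : Prop where
  smooth : ContDiffOn ℝ ∞ F U
  smooth_N : ContDiffOn ℝ ∞ N U
  graph : ∀ u ∈ U, ∀ v i, ⟪fderiv ℝ F u v, b i⟫_ℝ = v i
  tangent : ∀ u ∈ U, ∃ w, fderiv ℝ F u w = N u
  inner_N : ∀ u ∈ U, ⟪N u, N u⟫_ℝ = 1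
  lagrangian : ∀ u ∈ U, ∀ a v w, ⟪imUnit a • fderiv ℝ F u v, fderiv ℝ F u w⟫_ℝ = 0
  re_ν : ∀ u ∈ U, (ν u).re = 0
  ν_ne_zero : ∀ u ∈ U, ν u ≠ 0
  secondFF_eq : ∀ u ∈ U, ∀ v w, secondFF F u v w =
    (⟪fderiv ℝ F u v, N u⟫_ℝ * ⟪fderiv ℝ F u w, N u⟫_ℝ) • (ν u • N u)

/-- For fixed w the function ⟪DF w, b i⟫ is constant on U, so its derivatives vanish. -/
theorem inner_snd_fderiv_of_graph {U : Set (En n)} {F : En n → Hn n} {b : Fin n → Hn n}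
    (hU : IsOpen U) (hF : ContDiffOn ℝ ∞ F U)
    (hg : ∀ u ∈ U, ∀ v i, ⟪fderiv ℝ F u v, b i⟫_ℝ = v i) {u : En n} (hu : u ∈ U) (v w : En n)
    (i : Fin n) : ⟪fderiv ℝ (fun y => fderiv ℝ F y) u v w, b i⟫_ℝ = 0 := by
  have hFu := hF.contDiffAt (hU.mem_nhds hu)
  have h1 : DifferentiableAt ℝ (fun y => fderiv ℝ F y w) u :=
    ((hFu.fderiv_right (m := ∞) (by simp)).differentiableAt (by simp)).clm_apply
      (differentiableAt_const w)
  have h2 := fderiv_inner_apply ℝ h1 (differentiableAt_const (b i)) v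
  have h3 : (fun y => ⟪fderiv ℝ F y w, b i⟫_ℝ) =ᶠ[𝓝 u] fun _ => w i :=
    Filter.mem_of_superset (hU.mem_nhds hu) fun y hy => hg y hy w i
  rw [h3.fderiv_eq, ← snd_fderiv_apply hFu] at h2
  simpa using h2.symm

theorem eq_zero_of_inner_graph {Λ : En n →L[ℝ] Hn n} {b : Fin n → Hn n}
    (hg : ∀ v i, ⟪Λ v, b i⟫_ℝ = v i) {v : En n} (h : ∀ i, ⟪Λ v, b i⟫_ℝ = 0) : v = 0 := by
  ext i
  rw [← hg, h]
  rfl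

namespace IsRankOneGraph

variable {U : Set (En n)} {F : En n → Hn n} {b : Fin n → Hn n} {N : En n → Hn n}
  {ν : En n → ℍ[ℝ]}

/-- The coordinates of the field `N`. -/
def nvec (b : Fin n → Hn n) (N : En n → Hn n) (u : En n) : En n := ∑ i, ⟪N u, b i⟫_ℝ • coordVec i

/-- The value of the second derivative on `N`. -/
def hessN (F : En n → Hn n) (b : Fin n → Hn n) (N : En n → Hn n) (u : En n) : Hn n :=
  fderiv ℝ (fun y => fderiv ℝ F y) u (nvec b N u) (nvec b N u)

theorem fderiv_nvec (h : IsRankOneGraph U F b N ν) {u : En n} (hu : u ∈ U) :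
    fderiv ℝ F u (nvec b N u) = N u := by
  obtain ⟨w, hw⟩ := h.tangent u hu
  have : nvec b N u = w := by
    rw [nvec, ← hw]
    simp only [h.graph u hu]
    ext j
    simp [Finset.sum_apply, Pi.single_apply]
  rw [this, hw]

theorem inner_nvec (h : IsRankOneGraph U F b N ν) {u : En n} (hu : u ∈ U) :
    ⟪fderiv ℝ F u (nvec b N u), N u⟫_ℝ = 1 := by
  rw [h.fderiv_nvec hu, h.inner_N u hu]

theorem contDiffOn_fderiv (h : IsRankOneGraph U F b N ν) (hU : IsOpen U) :
    ContDiffOn ℝ ∞ (fun y => fderiv ℝ F y) U :=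
  h.smooth.fderiv_of_isOpen hU (by simp)

theorem contDiffOn_nvec (h : IsRankOneGraph U F b N ν) : ContDiffOn ℝ ∞ (nvec b N) U :=
  ContDiffOn.sum fun _ _ => (h.smooth_N.inner ℝ contDiffOn_const).smul contDiffOn_const

theorem contDiffOn_hessN (h : IsRankOneGraph U F b N ν) (hU : IsOpen U) :
    ContDiffOn ℝ ∞ (hessN F b N) U :=
  (((h.contDiffOn_fderiv hU).fderiv_of_isOpen hU (m := ∞) (by simp)).clm_apply
    h.contDiffOn_nvec).clm_apply h.contDiffOn_nvec

/-- Both sides have the same normal part, so they differ by a tangent vector. It pairs to zero with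
every b_i, as second derivatives of a graph do, and such a tangent vector is zero. Rank one thus
passes from h to D²F. -/
theorem snd_fderiv_eq (h : IsRankOneGraph U F b N ν) (hU : IsOpen U) {u : En n} (hu : u ∈ U)
    (v w : En n) : fderiv ℝ (fun y => fderiv ℝ F y) u v w =
      (⟪fderiv ℝ F u v, N u⟫_ℝ * ⟪fderiv ℝ F u w, N u⟫_ℝ) • hessN F b N u := by
  obtain ⟨p, hp⟩ := snd_fderiv_eq_add F u v w
  obtain ⟨q, hq⟩ := snd_fderiv_eq_add F u (nvec b N u) (nvec b N u)
  set r := ⟪fderiv ℝ F u v, N u⟫_ℝ * ⟪fderiv ℝ F u w, N u⟫_ℝ with hr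
  have h1 : fderiv ℝ F u (p - r • q) =
      fderiv ℝ (fun y => fderiv ℝ F y) u v w - r • hessN F b N u := by
    rw [hessN, hp, hq, h.secondFF_eq u hu, h.secondFF_eq u hu, h.inner_nvec hu, map_sub, map_smul,
      ← hr]
    simp only [mul_one, one_smul, smul_add]
    abel
  have h2 : p - r • q = 0 := eq_zero_of_inner_graph (h.graph u hu) fun i => by
    rw [h1, inner_sub_left, inner_smul_left, hessN,
      inner_snd_fderiv_of_graph hU h.smooth h.graph hu,
      inner_snd_fderiv_of_graph hU h.smooth h.graph hu]
    simp
  rw [h2, map_zero] at h1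
  exact sub_eq_zero.1 h1.symm

theorem hessN_ne_zero (h : IsRankOneGraph U F b N ν) {u : En n} (hu : u ∈ U) :
    hessN F b N u ≠ 0 := by
  intro h0
  have h1 : secondFF F u (nvec b N u) (nvec b N u) = 0 := by
    rw [secondFF]
    exact (congrArg _ h0).trans (map_zero _)
  rw [h.secondFF_eq u hu, h.inner_nvec hu, mul_one, one_smul] at h1
  have h2 : (star (ν u) * ν u) • N u = 0 := by rw [mul_smul, h1, smul_zero]
  rw [Quaternion.star_mul_self] at h2
  have h3 : ⟪((Quaternion.normSq (ν u) : ℝ) : ℍ[ℝ]) • N u, N u⟫_ℝ =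
      Quaternion.normSq (ν u) * ⟪N u, N u⟫_ℝ := by
    rw [inner_eq_re_qdot, inner_eq_re_qdot, qdot_smul_left, Quaternion.coe_mul_eq_smul]
    rfl
  rw [h2, h.inner_N u hu, inner_zero_left, mul_one] at h3
  exact h.ν_ne_zero u hu (Quaternion.normSq_eq_zero.1 h3.symm)

/-- The derivative of `⟪DF v, N⟫` in the direction `w`. -/
theorem hasFDerivAt_inner (h : IsRankOneGraph U F b N ν) (hU : IsOpen U) {u : En n} (hu : u ∈ U)
    (v : En n) : ∃ T : En n →L[ℝ] ℝ, HasFDerivAt (fun y => ⟪fderiv ℝ F y v, N y⟫_ℝ) T u ∧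
      ∀ w, T w = ⟪fderiv ℝ F u v, fderiv ℝ N u w⟫_ℝ +
        ⟪fderiv ℝ (fun y => fderiv ℝ F y) u w v, N u⟫_ℝ := by
  have hFu := h.smooth.contDiffAt (hU.mem_nhds hu)
  have h1 : DifferentiableAt ℝ (fun y => fderiv ℝ F y v) u :=
    ((hFu.fderiv_right (m := ∞) (by simp)).differentiableAt (by simp)).clm_apply
      (differentiableAt_const v)
  have h2 : DifferentiableAt ℝ N u :=
    (h.smooth_N.contDiffAt (hU.mem_nhds hu)).differentiableAt (by simp)
  refine ⟨_, (h1.inner ℝ h2).hasFDerivAt, fun w => ?_⟩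
  rw [fderiv_inner_apply ℝ h1 h2, snd_fderiv_apply hFu]

/-- The derivative of `θ = ⟪DF ·, N⟫` vanishes on `ker θ`. -/
theorem inner_fderiv_N_of_ker (h : IsRankOneGraph U F b N ν) (hU : IsOpen U) {u : En n}
    (hu : u ∈ U) {v w : En n} (hv : ⟪fderiv ℝ F u v, N u⟫_ℝ = 0)
    (hw : ⟪fderiv ℝ F u w, N u⟫_ℝ = 0) : ⟪fderiv ℝ F u w, fderiv ℝ N u v⟫_ℝ = 0 := by
  set m := nvec b N u with hm
  have hmN : ⟪fderiv ℝ F u m, N u⟫_ℝ = 1 := h.inner_nvec hu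
  obtain ⟨Tw, hTw, hTw'⟩ := h.hasFDerivAt_inner hU hu w
  obtain ⟨Tm, hTm, -⟩ := h.hasFDerivAt_inner hU hu m
  obtain ⟨Tv, hTv, -⟩ := h.hasFDerivAt_inner hU hu v
  have hC : HasFDerivAt (hessN F b N) _ u :=
    (((h.contDiffOn_hessN hU).contDiffAt (hU.mem_nhds hu)).differentiableAt (by simp)).hasFDerivAt
  have hG : ContDiffAt ℝ ∞ (fun y => fderiv ℝ F y w) u :=
    ((h.contDiffOn_fderiv hU).clm_apply contDiffOn_const).contDiffAt (hU.mem_nhds hu)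
  have hG' : ∀ c, (fun y => fderiv ℝ (fun y => fderiv ℝ F y w) y c) =ᶠ[𝓝 u]
      fun y => (⟪fderiv ℝ F y c, N y⟫_ℝ * ⟪fderiv ℝ F y w, N y⟫_ℝ) • hessN F b N y := fun c =>
    Filter.mem_of_superset (hU.mem_nhds hu) fun y hy =>
      (snd_fderiv_apply (h.smooth.contDiffAt (hU.mem_nhds hy)) c w).symm.trans
        (h.snd_fderiv_eq hU hy c w)
  -- Write D²F = θ⊗θ·C. In D³F(v, m, w) = D³F(m, v, w), with θ(v) = θ(w) = 0 and θ(m) = 1, the right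
  -- side vanishes and the left side is C times the derivative of θ(w) along v. As C ≠ 0, that
  -- derivative is zero.
  have hs := snd_fderiv_symm hG v m
  rw [snd_fderiv_apply hG, snd_fderiv_apply hG, (hG' m).fderiv_eq, (hG' v).fderiv_eq,
    ((hTm.fun_mul hTw).fun_smul hC).fderiv, ((hTv.fun_mul hTw).fun_smul hC).fderiv] at hs
  simp only [add_apply, smul_apply, ContinuousLinearMap.smulRight_apply, hmN, hw, hv, smul_eq_mul,
    mul_zero, zero_apply, zero_smul, zero_add, add_zero, one_mul] at hs
  have h0 : Tw v = 0 := (smul_eq_zero.1 hs).resolve_right (h.hessN_ne_zero hu)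
  rw [hTw', h.snd_fderiv_eq hU hu, hv, zero_mul, zero_smul, inner_zero_left, add_zero] at h0
  exact h0

/-- Along the directions of `ker θ` the map `F` is affine. -/
theorem apply_add_of_ker (h : IsRankOneGraph U F b N ν) (hU : IsOpen U) (hc : Convex ℝ U)
    {w₀ d : En n} (h0 : w₀ ∈ U) (h1 : w₀ + d ∈ U) (hd : ⟪fderiv ℝ F w₀ d, N w₀⟫_ℝ = 0) :
    F (w₀ + d) = F w₀ + fderiv ℝ F w₀ d := by
  let γ : ℝ → En n := fun s => w₀ + s • d
  have hγ : ∀ s, HasDerivAt γ d s := fun s => by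
    have := ((hasDerivAt_id s).smul_const d).const_add w₀
    rwa [one_smul] at this
  have hγc : Continuous γ := by fun_prop
  set S : Set ℝ := γ ⁻¹' U with hS
  have hSo : IsOpen S := hU.preimage hγc
  have hSc : S.OrdConnected := by
    have : S = AffineMap.lineMap w₀ (w₀ + d) ⁻¹' U := by
      ext s
      simp [hS, γ, AffineMap.lineMap_apply, add_comm]
    rw [this]
    exact (hc.affine_preimage _).ordConnected
  have h0S : (0 : ℝ) ∈ S := by simpa [hS, γ] using h0
  have h1S : (1 : ℝ) ∈ S := by simpa [hS, γ] using h1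
  set θ : En n → En n → ℝ := fun u v => ⟪fderiv ℝ F u v, N u⟫_ℝ with hθ
  have hsm : ContDiffOn ℝ ∞ γ S := by fun_prop
  have hmaps : MapsTo γ S U := fun s hs => hs
  -- A direction in ker θ at w₀ stays in ker θ along its line: s ↦ θ(d) solves a homogeneous linear
  -- equation and starts at zero.
  have hk : ∀ s ∈ S, θ (γ s) d = 0 := by
    let T : En n → En n → En n → ℝ := fun u v w => ⟪fderiv ℝ F u v, fderiv ℝ N u w⟫_ℝ
    let m : En n → En n := nvec b N
    -- d − θ(d)m lies in ker θ, where T vanishes. Expanding, T(d, d) is a multiple of θ(d).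
    have hT : ∀ u ∈ U, T u d d =
        θ u d * (T u d (m u) + T u (m u) d - θ u d * T u (m u) (m u)) := by
      intro u hu
      have h2 : θ u (d - θ u d • m u) = 0 := by
        simp only [hθ, map_sub, map_smul, inner_sub_left, inner_smul_left]
        rw [h.inner_nvec hu]
        simp
      have h3 := h.inner_fderiv_N_of_ker hU hu h2 h2
      simp only [map_sub, map_smul, inner_sub_left, inner_sub_right, inner_smul_left,
        inner_smul_right, conj_trivial] at h3
      linear_combination h3
    let c : En n → ℝ := fun u =>
      T u d (m u) + T u (m u) d - θ u d * T u (m u) (m u) + θ u d * ⟪hessN F b N u, N u⟫_ℝ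
    have hmc : ContinuousOn m U := h.contDiffOn_nvec.continuousOn
    have hTc : ∀ {x y : En n → En n}, ContinuousOn x U → ContinuousOn y U →
        ContinuousOn (fun u => T u (x u) (y u)) U := fun hx hy =>
      ((h.contDiffOn_fderiv hU).continuousOn.clm_apply hx).inner
        ((h.smooth_N.continuousOn_fderiv_of_isOpen hU (by simp)).clm_apply hy)
    have hθc : ContinuousOn (fun u => θ u d) U :=
      ((h.contDiffOn_fderiv hU).continuousOn.clm_apply continuousOn_const).inner
        h.smooth_N.continuousOn
    have hcc : ContinuousOn c U :=
      (((hTc continuousOn_const hmc).add (hTc hmc continuousOn_const)).sub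
        (hθc.mul (hTc hmc hmc))).add
        (hθc.mul ((h.contDiffOn_hessN hU).continuousOn.inner h.smooth_N.continuousOn))
    refine linearODE_unique (A := fun s => c (γ s) • ContinuousLinearMap.id ℝ ℝ)
      (y := fun s => θ (γ s) d) (z := fun _ => 0) hSo hSc
      ((hcc.comp hγc.continuousOn hmaps).smul continuousOn_const) (fun s hs => ?_)
      (fun s _ => by simpa using hasDerivAt_const s (0 : ℝ)) h0S (by simpa [γ] using hd)
    obtain ⟨K, hK, hK'⟩ := h.hasFDerivAt_inner hU (hmaps hs) d
    refine (hK.comp_hasDerivAt s (hγ s)).congr_deriv ?_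
    rw [hK', h.snd_fderiv_eq hU (hmaps hs), inner_smul_left]
    have := hT _ (hmaps hs)
    simp only [smul_apply, ContinuousLinearMap.id_apply, smul_eq_mul, conj_trivial, c]
    linear_combination this
  -- D²F(d, d) = θ(d)²C = 0 on the line, so DF d is constant there and F is affine.
  have hH : ∀ s ∈ S, HasDerivAt (fun s => fderiv ℝ F (γ s) d) (0 : Hn n) s := by
    intro s hs
    have h2 : HasFDerivAt (fun y => fderiv ℝ F y d) _ (γ s) :=
      ((((h.contDiffOn_fderiv hU).clm_apply contDiffOn_const).contDiffAt
        (hU.mem_nhds (hmaps hs))).differentiableAt (by simp)).hasFDerivAt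
    refine (h2.comp_hasDerivAt s (hγ s)).congr_deriv ?_
    rw [← snd_fderiv_apply (h.smooth.contDiffAt (hU.mem_nhds (hmaps hs))),
      h.snd_fderiv_eq hU (hmaps hs)]
    have := hk s hs
    simp only [hθ] at this
    rw [this, zero_mul, zero_smul]
  have hz : ContinuousOn (fun _ : ℝ => (0 : Hn n →L[ℝ] Hn n)) S := continuousOn_const
  have hD : ∀ s ∈ S, fderiv ℝ F (γ s) d = fderiv ℝ F w₀ d :=
    linearODE_unique (y := fun s => fderiv ℝ F (γ s) d) (z := fun _ => fderiv ℝ F w₀ d) hSo hSc hz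
      (fun s hs => hH s hs) (fun s _ => hasDerivAt_const s _) h0S (by simp [γ])
  have hF : ∀ s ∈ S, F (γ s) - s • fderiv ℝ F w₀ d = F w₀ := by
    refine linearODE_unique (y := fun s => F (γ s) - s • fderiv ℝ F w₀ d) (z := fun _ => F w₀)
      hSo hSc hz (fun s hs => ?_) (fun s _ => hasDerivAt_const s _) h0S (by simp [γ])
    have h2 : HasFDerivAt F _ (γ s) := ((h.smooth.contDiffAt
      (hU.mem_nhds (hmaps hs))).differentiableAt (by simp)).hasFDerivAt
    refine ((h2.comp_hasDerivAt s (hγ s)).sub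
      ((hasDerivAt_id s).smul_const (fderiv ℝ F w₀ d))).congr_deriv ?_
    rw [hD s hs, one_smul, sub_self]
    rfl
  have := hF 1 h1S
  simp only [γ, one_smul] at this
  rw [← this, sub_add_cancel]

end IsRankOneGraph

end Developable

/-! ## The normal form along a line transverse to the flat leaves -/

section Axis

variable {n : ℕ} [NeZero n]

/-- The first coordinate axis. -/
def axis (t : ℝ) : En n := t • coordVec 0

theorem hasDerivAt_axis (t : ℝ) : HasDerivAt (axis (n := n)) (coordVec 0) t := by
  have := (hasDerivAt_id t).smul_const (coordVec (0 : Fin n))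
  rwa [one_smul] at this

theorem axis_zero : axis (n := n) 0 = 0 := zero_smul _ _

theorem contDiff_axis : ContDiff ℝ ∞ (axis (n := n)) := contDiff_id.smul contDiff_const

theorem ordConnected_preimage_axis {U : Set (En n)} (hc : Convex ℝ U) :
    (axis ⁻¹' U).OrdConnected :=
  (hc.is_linear_preimage ⟨fun x y => add_smul x y _, fun c x => smul_assoc c x _⟩).ordConnected

namespace IsRankOneGraph

variable {U : Set (En n)} {F : En n → Hn n} {b : Fin n → Hn n} {N : En n → Hn n}
  {ν : En n → ℍ[ℝ]}

/-- The field `ε` along the axis is transported so that its image under `DF` is parallel. -/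
def IsTransported (U : Set (En n)) (F : En n → Hn n) (b : Fin n → Hn n) (N : En n → Hn n)
    (ε : ℝ → En n) : Prop :=
  ∀ t ∈ axis ⁻¹' U, HasDerivAt ε (-(⟪fderiv ℝ F (axis t) (ε t), fderiv ℝ N (axis t) (coordVec 0)⟫_ℝ •
    nvec b N (axis t))) t

section

variable (h : IsRankOneGraph U F b N ν) (hU : IsOpen U)

include h hU

theorem contDiffOn_fderiv_axis : ContDiffOn ℝ ∞ (fun t => fderiv ℝ F (axis t)) (axis ⁻¹' U) :=
  (h.contDiffOn_fderiv hU).comp contDiff_axis.contDiffOn fun _ ht => ht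

theorem contDiffOn_deriv_N_axis :
    ContDiffOn ℝ ∞ (fun t => fderiv ℝ N (axis t) (coordVec 0)) (axis ⁻¹' U) :=
  ((h.smooth_N.fderiv_of_isOpen hU (m := ∞) (by simp)).clm_apply contDiffOn_const).comp
    contDiff_axis.contDiffOn fun _ ht => ht

theorem hasDerivAt_N_axis {t : ℝ} (ht : t ∈ axis ⁻¹' U) :
    HasDerivAt (fun t => N (axis t)) (fderiv ℝ N (axis t) (coordVec 0)) t :=
  ((h.smooth_N.contDiffAt (hU.mem_nhds ht)).differentiableAt
    (by simp)).hasFDerivAt.comp_hasDerivAt t (hasDerivAt_axis t)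

theorem hasDerivAt_F_axis {t : ℝ} (ht : t ∈ axis ⁻¹' U) :
    HasDerivAt (fun t => F (axis t)) (fderiv ℝ F (axis t) (coordVec 0)) t :=
  ((h.smooth.contDiffAt (hU.mem_nhds ht)).differentiableAt
    (by simp)).hasFDerivAt.comp_hasDerivAt t (hasDerivAt_axis t)

theorem hasDerivAt_fderiv_axis {t : ℝ} (ht : t ∈ axis ⁻¹' U) :
    HasDerivAt (fun t => fderiv ℝ F (axis t))
      (fderiv ℝ (fun y => fderiv ℝ F y) (axis t) (coordVec 0)) t :=
  (((h.contDiffOn_fderiv hU).contDiffAt (hU.mem_nhds ht)).differentiableAt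
    (by simp)).hasFDerivAt.comp_hasDerivAt t (hasDerivAt_axis t)

theorem exists_isTransported (hc : Convex ℝ U) (h0 : (0 : En n) ∈ U) (ε₀ : En n) :
    ∃ ε : ℝ → En n, ε 0 = ε₀ ∧ IsTransported U F b N ε ∧ ContDiffOn ℝ ∞ ε (axis ⁻¹' U) := by
  let A : ℝ → En n →L[ℝ] En n := fun t => -(((innerSL ℝ (fderiv ℝ N (axis t) (coordVec 0))) ∘SL
    fderiv ℝ F (axis t)).smulRight (nvec b N (axis t)))
  have hA : ContDiffOn ℝ ∞ A (axis ⁻¹' U) :=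
    ((((innerSL ℝ).contDiff.comp_contDiffOn (h.contDiffOn_deriv_N_axis hU)).clm_comp
      (h.contDiffOn_fderiv_axis hU)).smulRight
      (h.contDiffOn_nvec.comp contDiff_axis.contDiffOn fun _ ht => ht)).neg
  have hJ : IsOpen (axis ⁻¹' U) := hU.preimage contDiff_axis.continuous
  obtain ⟨ε, hε0, hε⟩ := linearODE_exists hJ (ordConnected_preimage_axis hc) hA.continuousOn
    (t₀ := 0) (by simpa [axis_zero] using h0) ε₀
  refine ⟨ε, hε0, fun t ht => (hε t ht).congr_deriv ?_, linearODE_contDiffOn hJ hA hε⟩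
  simp only [A, neg_apply, ContinuousLinearMap.smulRight_apply, ContinuousLinearMap.comp_apply,
    innerSL_apply_apply, real_inner_comm]

variable {ε δ : ℝ → En n} (hε : IsTransported U F b N ε) (hδ : IsTransported U F b N δ)

include hε

theorem hasDerivAt_transported {t : ℝ} (ht : t ∈ axis ⁻¹' U) :
    HasDerivAt (fun t => fderiv ℝ F (axis t) (ε t))
      ((⟪fderiv ℝ F (axis t) (coordVec 0), N (axis t)⟫_ℝ *
          ⟪fderiv ℝ F (axis t) (ε t), N (axis t)⟫_ℝ) • hessN F b N (axis t) -
        ⟪fderiv ℝ F (axis t) (ε t), fderiv ℝ N (axis t) (coordVec 0)⟫_ℝ • N (axis t)) t := by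
  refine ((h.hasDerivAt_fderiv_axis hU ht).clm_apply (hε t ht)).congr_deriv ?_
  rw [h.snd_fderiv_eq hU ht, map_neg, map_smul, h.fderiv_nvec ht, sub_eq_add_neg]

/-- The transport is chosen so that in the derivative of ⟨DF ε, N⟩ the terms with N' cancel, leaving
a multiple of ⟨DF ε, N⟩ itself. -/
theorem inner_transported_N (hc : Convex ℝ U) (h0 : (0 : En n) ∈ U)
    (hi : ⟪fderiv ℝ F 0 (ε 0), N 0⟫_ℝ = 0) {t : ℝ} (ht : t ∈ axis ⁻¹' U) :
    ⟪fderiv ℝ F (axis t) (ε t), N (axis t)⟫_ℝ = 0 := by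
  have hJ : IsOpen (axis ⁻¹' U) := hU.preimage contDiff_axis.continuous
  have hax : ContinuousOn (axis (n := n)) (axis ⁻¹' U) := (contDiff_axis (n := n)).continuous.continuousOn
  refine linearODE_unique (A := fun t => (⟪fderiv ℝ F (axis t) (coordVec 0), N (axis t)⟫_ℝ *
      ⟪hessN F b N (axis t), N (axis t)⟫_ℝ) • ContinuousLinearMap.id ℝ ℝ)
    (y := fun t => ⟪fderiv ℝ F (axis t) (ε t), N (axis t)⟫_ℝ) (z := fun _ => 0)
    hJ (ordConnected_preimage_axis hc) ?_ (fun s hs => ?_)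
    (fun s _ => by simpa using hasDerivAt_const s (0 : ℝ)) (t₀ := 0)
    (by simpa [axis_zero] using h0) (by simpa [axis_zero] using hi) ht
  · have hN : ContinuousOn (fun t => N (axis t)) (axis ⁻¹' U) :=
      h.smooth_N.continuousOn.comp hax fun _ ht => ht
    have hC : ContinuousOn (fun t => hessN F b N (axis t)) (axis ⁻¹' U) :=
      (h.contDiffOn_hessN hU).continuousOn.comp hax fun _ ht => ht
    exact ((((h.contDiffOn_fderiv_axis hU).continuousOn.clm_apply
      (continuousOn_const (c := coordVec 0))).inner (𝕜 := ℝ) hN).mul (hC.inner (𝕜 := ℝ) hN)).smul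
      continuousOn_const
  · refine ((h.hasDerivAt_transported hU hε hs).inner ℝ (h.hasDerivAt_N_axis hU hs)).congr_deriv ?_
    rw [inner_sub_left, inner_smul_left, inner_smul_left, h.inner_N _ hs]
    simp only [smul_apply, ContinuousLinearMap.id_apply, smul_eq_mul, conj_trivial]
    ring

/-- On ker θ the term with D²F disappears and only a multiple of N remains: this is the structure
equation of E_k, k ≠ 0. -/
theorem hasDerivAt_transported' (hc : Convex ℝ U) (h0 : (0 : En n) ∈ U)
    (hi : ⟪fderiv ℝ F 0 (ε 0), N 0⟫_ℝ = 0) {t : ℝ} (ht : t ∈ axis ⁻¹' U) :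
    HasDerivAt (fun t => fderiv ℝ F (axis t) (ε t))
      (-⟪fderiv ℝ F (axis t) (ε t), fderiv ℝ N (axis t) (coordVec 0)⟫_ℝ • N (axis t)) t := by
  refine (h.hasDerivAt_transported hU hε ht).congr_deriv ?_
  rw [h.inner_transported_N hU hε hc h0 hi ht, mul_zero, zero_smul, zero_sub, neg_smul]

include hδ in
-- Both derivatives are multiples of N, to which both vectors are orthogonal.
theorem inner_transported (hc : Convex ℝ U) (h0 : (0 : En n) ∈ U)
    (hi : ⟪fderiv ℝ F 0 (ε 0), N 0⟫_ℝ = 0) (hi' : ⟪fderiv ℝ F 0 (δ 0), N 0⟫_ℝ = 0) {t : ℝ}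
    (ht : t ∈ axis ⁻¹' U) : ⟪fderiv ℝ F (axis t) (ε t), fderiv ℝ F (axis t) (δ t)⟫_ℝ =
      ⟪fderiv ℝ F 0 (ε 0), fderiv ℝ F 0 (δ 0)⟫_ℝ := by
  refine linearODE_unique (A := fun _ => (0 : ℝ →L[ℝ] ℝ))
    (y := fun t => ⟪fderiv ℝ F (axis t) (ε t), fderiv ℝ F (axis t) (δ t)⟫_ℝ)
    (z := fun _ => ⟪fderiv ℝ F 0 (ε 0), fderiv ℝ F 0 (δ 0)⟫_ℝ)
    (hU.preimage contDiff_axis.continuous) (ordConnected_preimage_axis hc) continuousOn_const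
    (fun s hs => ?_) (fun s _ => hasDerivAt_const s _) (t₀ := 0) (by simpa [axis_zero] using h0)
    (by simp [axis_zero]) ht
  refine ((h.hasDerivAt_transported' hU hε hc h0 hi hs).inner ℝ
    (h.hasDerivAt_transported' hU hδ hc h0 hi' hs)).congr_deriv ?_
  rw [inner_smul_left, inner_smul_right, h.inner_transported_N hU hε hc h0 hi hs,
    real_inner_comm (fderiv ℝ F (axis s) (δ s)) (N (axis s)),
    h.inner_transported_N hU hδ hc h0 hi' hs]
  simp

end

end IsRankOneGraph

end Axis

/-! ### Normal form of a rank one graph along the axis -/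

section AxisNormalForm

variable {n : ℕ} [NeZero n]

namespace IsRankOneGraph

variable {U : Set (En n)} {F : En n → Hn n} {b : Fin n → Hn n} {N : En n → Hn n}
  {ν : En n → ℍ[ℝ]}

/-- Differentiating N = DF(n), with n the coordinate vector of N, gives tangential terms and the
normal term h(∂_0, N) = θ(∂_0)νN. -/
theorem fderiv_N_axis (h : IsRankOneGraph U F b N ν) (hU : IsOpen U) {t : ℝ}
    (ht : t ∈ axis ⁻¹' U) : ∃ w, fderiv ℝ N (axis t) (coordVec 0) = fderiv ℝ F (axis t) w +
      (⟪fderiv ℝ F (axis t) (coordVec 0), N (axis t)⟫_ℝ • ν (axis t)) • N (axis t) := by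
  have hn : HasDerivAt (fun t => nvec b N (axis t)) _ t :=
    ((h.contDiffOn_nvec.contDiffAt (hU.mem_nhds ht)).differentiableAt
      (by simp)).hasFDerivAt.comp_hasDerivAt t (hasDerivAt_axis t)
  have h1 := (h.hasDerivAt_fderiv_axis hU ht).clm_apply hn
  have hJ : axis ⁻¹' U ∈ 𝓝 t := (hU.preimage (contDiff_axis (n := n)).continuous).mem_nhds ht
  have h2 : (fun t => N (axis t)) =ᶠ[𝓝 t] fun t => fderiv ℝ F (axis t) (nvec b N (axis t)) :=
    Filter.mem_of_superset hJ fun s hs => (h.fderiv_nvec hs).symm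
  rw [(h.hasDerivAt_N_axis hU ht).unique (h1.congr_of_eventuallyEq h2)]
  obtain ⟨p, hp⟩ := snd_fderiv_eq_add F (axis t) (coordVec 0) (nvec b N (axis t))
  rw [hp, h.secondFF_eq _ ht, h.inner_nvec ht, mul_one, smul_assoc]
  exact ⟨p + fderiv ℝ (nvec b N) (axis t) (coordVec 0), by rw [map_add]; abel⟩

/-- In the coordinates given by the axis and the flat leaves through it, the map is in normal
form. -/
theorem exists_isNormalForm_axis (h : IsRankOneGraph U F b N ν) (hU : IsOpen U)
    (hc : Convex ℝ U) (h0 : (0 : En n) ∈ U) (hb : fderiv ℝ F 0 (coordVec 0) = N 0)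
    {ε₀ : Fin n → En n}
    (hε₀ : ∀ i j, ⟪fderiv ℝ F 0 (ε₀ i), fderiv ℝ F 0 (ε₀ j)⟫_ℝ = if i = j then 1 else 0)
    (hz : ε₀ 0 = coordVec 0) :
    ∃ (D : ℝ → Hn n) (E : Fin n → ℝ → Hn n) (β : ℝ → ℝ) (α : Fin n → ℝ → ℝ)
      (φ : Fin 3 → ℝ → ℝ) (B : Fin n → ℝ → ℝ) (ε : Fin n → ℝ → En n),
      IsNormalForm (axis ⁻¹' U) D E β α φ ∧ ContDiffOn ℝ ∞ β (axis ⁻¹' U) ∧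
      (∀ k, ContDiffOn ℝ ∞ (α k) (axis ⁻¹' U)) ∧ (∀ a, ContDiffOn ℝ ∞ (φ a) (axis ⁻¹' U)) ∧
      (∀ k, ContDiffOn ℝ ∞ (B k) (axis ⁻¹' U)) ∧ (∀ k, ContDiffOn ℝ ∞ (ε k) (axis ⁻¹' U)) ∧
      (∀ k, B k 0 = 0) ∧ (∀ k, ε k 0 = ε₀ k) ∧
      (∀ t ∈ axis ⁻¹' U, ∀ y : Fin n → ℝ,
        axis t + ∑ k ∈ Finset.univ.erase 0, (y k - B k t) • ε k t ∈ U →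
        F (axis t + ∑ k ∈ Finset.univ.erase 0, (y k - B k t) • ε k t) =
          D t + ∑ k ∈ Finset.univ.erase 0, y k • E k t) ∧
      β 0 = 1 ∧ (∀ k, α k 0 = -⟪fderiv ℝ F 0 (ε₀ k), fderiv ℝ N 0 (coordVec 0)⟫_ℝ) ∧
      ∀ a, φ a 0 = imComp (ν 0) a := by
  have hJ : IsOpen (axis ⁻¹' U) := hU.preimage (contDiff_axis (n := n)).continuous
  have hJc : (axis ⁻¹' U).OrdConnected := ordConnected_preimage_axis hc
  have h0J : (0 : ℝ) ∈ axis ⁻¹' U := by simpa [axis_zero] using h0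
  choose ε hε0 hε hεs using fun k => h.exists_isTransported hU hc h0 (ε₀ k)
  have hi : ∀ k, k ≠ 0 → ⟪fderiv ℝ F 0 (ε k 0), N 0⟫_ℝ = 0 := fun k hk => by
    rw [hε0, ← hb, ← hz, hε₀, if_neg hk]
  let E : Fin n → ℝ → Hn n := fun i t =>
    if i = 0 then N (axis t) else fderiv ℝ F (axis t) (ε i t)
  let e : ℝ → Fin n → En n := fun t i => if i = 0 then nvec b N (axis t) else ε i t
  have hEz : ∀ t, E 0 t = N (axis t) := fun t => if_pos rfl
  have hEk : ∀ k t, k ≠ 0 → E k t = fderiv ℝ F (axis t) (ε k t) := fun k t hk => if_neg hk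
  have hEe : ∀ t ∈ axis ⁻¹' U, ∀ i, fderiv ℝ F (axis t) (e t i) = E i t := by
    intro t ht i
    by_cases hi : i = 0
    · simp only [e, E, if_pos hi, h.fderiv_nvec ht]
    · simp only [e, E, if_neg hi]
  have hEin : ∀ t ∈ axis ⁻¹' U, ∀ i j, ⟪E i t, E j t⟫_ℝ = if i = j then 1 else 0 := by
    intro t ht i j
    have hk : ∀ k, k ≠ 0 → ⟪E k t, E 0 t⟫_ℝ = 0 := fun k hk => by
      rw [hEz, hEk k t hk]; exact h.inner_transported_N hU (hε k) hc h0 (hi k hk) ht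
    by_cases hi0 : i = 0 <;> by_cases hj0 : j = 0
    · rw [hi0, hj0, if_pos rfl, hEz, h.inner_N _ ht]
    · rw [hi0, real_inner_comm, hk j hj0, if_neg (Ne.symm hj0)]
    · rw [hj0, hk i hi0, if_neg hi0]
    · rw [hEk i t hi0, hEk j t hj0,
        h.inner_transported hU (hε i) (hε j) hc h0 (hi i hi0) (hi j hj0) ht, hε0, hε0, hε₀]
  have hfr : ∀ t ∈ axis ⁻¹' U, IsQFrame fun i => E i t := fun t ht =>
    isQFrame_of_inner (hEin t ht) fun a i j => by
      rw [← hEe t ht, ← hEe t ht, h.lagrangian _ ht]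
  let N' : ℝ → Hn n := fun t => fderiv ℝ N (axis t) (coordVec 0)
  let ρ : ℝ → ℝ := fun t => ⟪fderiv ℝ F (axis t) (coordVec 0), N (axis t)⟫_ℝ
  let α : Fin n → ℝ → ℝ := fun k t => -⟪fderiv ℝ F (axis t) (ε k t), N' t⟫_ℝ
  let bk : Fin n → ℝ → ℝ := fun k t =>
    ⟪fderiv ℝ F (axis t) (coordVec 0), fderiv ℝ F (axis t) (ε k t)⟫_ℝ
  -- The axis itself drifts along the leaves with velocity components `bk`. Their integral B is the
  -- leaf coordinate of the axis point, and subtracting ΣB_kE_k makes D' a multiple of N.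
  let B : Fin n → ℝ → ℝ := fun k t => ∫ s in (0 : ℝ)..t, bk k s
  let φ : Fin 3 → ℝ → ℝ := fun a t => ⟪N' t, imUnit a • N (axis t)⟫_ℝ
  -- The twisting function equals ρ on the axis, where y_k = B_k; hence ρ = β + ΣB_kα_k.
  let β : ℝ → ℝ := fun t => ρ t - ∑ k ∈ Finset.univ.erase 0, B k t * α k t
  let D : ℝ → Hn n := fun t => F (axis t) -
    ∑ k ∈ Finset.univ.erase 0, B k t • fderiv ℝ F (axis t) (ε k t)
  have hNs : ContDiffOn ℝ ∞ (fun t => N (axis t)) (axis ⁻¹' U) :=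
    h.smooth_N.comp contDiff_axis.contDiffOn fun _ ht => ht
  have hN's : ContDiffOn ℝ ∞ N' (axis ⁻¹' U) := h.contDiffOn_deriv_N_axis hU
  have hΛs := h.contDiffOn_fderiv_axis hU
  have hEs : ∀ k, ContDiffOn ℝ ∞ (fun t => fderiv ℝ F (axis t) (ε k t)) (axis ⁻¹' U) := fun k =>
    hΛs.clm_apply (hεs k)
  have hαs : ∀ k, ContDiffOn ℝ ∞ (α k) (axis ⁻¹' U) := fun k => ((hEs k).inner ℝ hN's).neg
  have hbs : ∀ k, ContDiffOn ℝ ∞ (bk k) (axis ⁻¹' U) := fun k =>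
    (hΛs.clm_apply contDiffOn_const).inner ℝ (hEs k)
  have hBs : ∀ k, ContDiffOn ℝ ∞ (B k) (axis ⁻¹' U) := fun k =>
    contDiffOn_primitive hJ hJc (hbs k) h0J
  have hρs : ContDiffOn ℝ ∞ ρ (axis ⁻¹' U) := (hΛs.clm_apply contDiffOn_const).inner ℝ hNs
  have hFs : ContDiffOn ℝ ∞ (fun t => F (axis t)) (axis ⁻¹' U) :=
    h.smooth.comp contDiff_axis.contDiffOn fun _ ht => ht
  have hEd : ∀ k, k ≠ 0 → ∀ t ∈ axis ⁻¹' U,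
      HasDerivAt (fun t => fderiv ℝ F (axis t) (ε k t)) (α k t • N (axis t)) t :=
    fun k hk t ht => h.hasDerivAt_transported' hU (hε k) hc h0 (hi k hk) ht
  have hsum : ∀ t ∈ axis ⁻¹' U, ∀ w, fderiv ℝ F (axis t) w =
      ∑ i, ⟪fderiv ℝ F (axis t) w, E i t⟫_ℝ • E i t := by
    intro t ht w
    have h1 := eq_sum_of_orthonormal_image (Λ := fderiv ℝ F (axis t)) (e := e t)
      (fun i j => by rw [hEe t ht, hEe t ht]; exact hEin t ht i j) w
    conv_lhs => rw [h1]
    simp only [map_sum, map_smul, hEe t ht]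
  -- The tangential part of N' has no N-component, since |N| = 1, and its E_k-component is −α_k by
  -- the definition of α. Together with the normal term this is the equation for E_0.
  have hN' : ∀ t ∈ axis ⁻¹' U, N' t = (ρ t • ν (axis t)) • E 0 t -
      ∑ k ∈ Finset.univ.erase 0, α k t • E k t := by
    intro t ht
    obtain ⟨w, hw⟩ := h.fderiv_N_axis hU ht
    have hre : (ρ t • ν (axis t)).re = 0 := by
      rw [Quaternion.re_smul, h.re_ν _ ht, smul_zero]
    have h1 : ∀ i, ⟪fderiv ℝ F (axis t) w, E i t⟫_ℝ = ⟪N' t, E i t⟫_ℝ := fun i => by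
      simp only [N']
      rw [hw, inner_add_left]
      have := (hfr t ht).inner_im hre 0 i
      simp only [hEz] at this
      rw [this, add_zero]
    have h2 : ⟪N' t, E 0 t⟫_ℝ = 0 := by
      have h3 := (h.hasDerivAt_N_axis hU ht).inner ℝ (h.hasDerivAt_N_axis hU ht)
      have h4 : (fun t => ⟪N (axis t), N (axis t)⟫_ℝ) =ᶠ[𝓝 t] fun _ => (1 : ℝ) :=
        Filter.mem_of_superset (hJ.mem_nhds ht) fun s hs => h.inner_N _ hs
      have h5 := h3.unique ((hasDerivAt_const t (1 : ℝ)).congr_of_eventuallyEq h4)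
      rw [real_inner_comm] at h5
      rw [hEz]
      simp only [N']
      linarith
    have h6 := hsum t ht w
    rw [sum_eq_zero_add_erase, h1, h2, zero_smul, zero_add] at h6
    change fderiv ℝ N (axis t) (coordVec 0) = _
    rw [hw, h6, ← hEz, add_comm, sub_eq_add_neg, ← Finset.sum_neg_distrib]
    congr 1
    refine Finset.sum_congr rfl fun k hk => ?_
    rw [h1, real_inner_comm, hEk k t (Finset.ne_of_mem_erase hk)]
    simp only [α, neg_smul, neg_neg]
  have hφ : ∀ t ∈ axis ⁻¹' U, ∀ a, φ a t = imComp (ρ t • ν (axis t)) a := by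
    intro t ht a
    have hfr' := hfr t ht
    change ⟪N' t, imUnit a • N (axis t)⟫_ℝ = _
    rw [hN' t ht, ← hEz, inner_sub_left, hfr'.comp_inner, sum_inner, Finset.sum_eq_zero, sub_zero]
    intro k _
    rw [inner_smul_left, real_inner_comm, hfr'.inner_imUnit, mul_zero]
  have hρ0 : ρ 0 = 1 := by
    change ⟪fderiv ℝ F (axis 0) (coordVec 0), N (axis 0)⟫_ℝ = 1
    rw [axis_zero, hb, h.inner_N 0 h0]
  have hB0 : ∀ k, B k 0 = 0 := fun k => intervalIntegral.integral_same
  refine ⟨D, E, β, α, φ, B, ε, ⟨?_, ?_, hfr, ?_, ?_, ?_⟩, ?_, hαs, ?_, hBs, hεs, hB0, hε0, ?_, ?_,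
    ?_, ?_⟩
  · exact hFs.sub (ContDiffOn.sum fun k _ => (hBs k).smul (hEs k))
  · intro i
    by_cases hi0 : i = 0
    · simpa only [E, if_pos hi0] using hNs
    · simpa only [E, if_neg hi0] using hEs i
  · intro t ht
    have h1 : HasDerivAt D _ t := (h.hasDerivAt_F_axis hU ht).sub (HasDerivAt.fun_sum fun k hk =>
      (hasDerivAt_primitive hJ hJc (hbs k).continuousOn h0J ht).smul
        (hEd k (Finset.ne_of_mem_erase hk) t ht))
    refine h1.congr_deriv ?_
    have h2 := hsum t ht (coordVec 0)
    rw [sum_eq_zero_add_erase, hEz] at h2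
    conv_lhs => rw [h2]
    rw [hEz, sub_smul, Finset.sum_smul, Finset.sum_add_distrib, add_sub_assoc]
    rw [Finset.sum_congr rfl fun k hk => by rw [hEk k t (Finset.ne_of_mem_erase hk)]]
    simp only [smul_smul, bk, B]
    abel
  · intro t ht
    have h1 : imQuat (fun a => φ a t) = ρ t • ν (axis t) := by
      rw [show (fun a => φ a t) = imComp (ρ t • ν (axis t)) from funext (hφ t ht),
        imQuat_imComp (by rw [Quaternion.re_smul, h.re_ν _ ht, smul_zero])]
    rw [h1, ← hN' t ht]
    simpa only [E, if_pos] using h.hasDerivAt_N_axis hU ht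
  · intro t ht k hk
    rw [hEz]
    simpa only [E, if_neg hk] using hEd k hk t ht
  · exact hρs.sub (ContDiffOn.sum fun k _ => (hBs k).mul (hαs k))
  · exact fun a => hN's.inner ℝ (hNs.const_smul (imUnit a))
  · intro t ht y hy
    -- The displacement from the axis lies in ker θ, so F is affine up to the given point.
    have h1 : ⟪fderiv ℝ F (axis t) (∑ k ∈ Finset.univ.erase 0, (y k - B k t) • ε k t),
        N (axis t)⟫_ℝ = 0 := by
      rw [map_sum, sum_inner]
      refine Finset.sum_eq_zero fun k hk => ?_
      rw [map_smul, inner_smul_left, h.inner_transported_N hU (hε k) hc h0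
        (hi k (Finset.ne_of_mem_erase hk)) ht, mul_zero]
    rw [h.apply_add_of_ker hU hc ht hy h1, map_sum]
    simp only [D]
    rw [sub_add_eq_add_sub, add_sub_assoc, ← Finset.sum_sub_distrib]
    congr 1
    refine Finset.sum_congr rfl fun k hk => ?_
    rw [map_smul, sub_smul, hEk k t (Finset.ne_of_mem_erase hk)]
  · simp only [β, hB0, zero_mul, Finset.sum_const_zero, sub_zero, hρ0]
  · intro k
    simp only [α, N', axis_zero, hε0]
  · intro a
    rw [hφ 0 h0J, hρ0, one_smul, axis_zero]

end IsRankOneGraph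

end AxisNormalForm

/-! ## Existence of twisted product coordinates for graphs of rank one -/

section TwistedCoordinates

variable {n : ℕ} [NeZero n]

/-- A signed permutation of the coordinate vectors for which a given functional is negative on the
second vector, unless it vanishes on all vectors but the first one. -/
theorem exists_signed_permutation {Λ : En n →L[ℝ] Hn n}
    (hΛ : ∀ i j, ⟪Λ (coordVec i), Λ (coordVec j)⟫_ℝ = if i = j then 1 else 0) (V : Hn n)
    (h1 : (1 : Fin n) ≠ 0) : ∃ ε₀ : Fin n → En n,
      (∀ i j, ⟪Λ (ε₀ i), Λ (ε₀ j)⟫_ℝ = if i = j then 1 else 0) ∧ ε₀ 0 = coordVec 0 ∧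
      ((∃ j, j ≠ 0 ∧ ⟪Λ (ε₀ j), V⟫_ℝ ≠ 0) → ⟪Λ (ε₀ 1), V⟫_ℝ < 0) := by
  by_cases hk : ∃ k, k ≠ 0 ∧ ⟪Λ (coordVec k), V⟫_ℝ ≠ 0
  · obtain ⟨k, hk0, hk⟩ := hk
    -- A sign making the value negative; applied with V the derivative of N along the axis, where
    -- α_k(0) is minus this value, it makes the second α positive.
    obtain ⟨s, hs, hsn⟩ : ∃ s : ℝ, s * s = 1 ∧ s * ⟪Λ (coordVec k), V⟫_ℝ < 0 := by
      rcases lt_or_gt_of_ne hk with h | h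
      · exact ⟨1, by norm_num, by linarith⟩
      · exact ⟨-1, by norm_num, by linarith⟩
    let c : Fin n → ℝ := fun i => if i = 0 then 1 else s
    have hc : ∀ i, c i * c i = 1 := fun i => by
      simp only [c]
      split_ifs
      exacts [one_mul 1, hs]
    refine ⟨fun i => c i • coordVec (Equiv.swap 1 k i), fun i j => ?_, ?_, fun _ => ?_⟩
    · simp only [map_smul, inner_smul_left, inner_smul_right, hΛ, conj_trivial,
        (Equiv.swap 1 k).injective.eq_iff]
      by_cases hij : i = j
      · simp only [hij, if_true, mul_one, hc]
      · simp only [hij, if_false, mul_zero]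
    · simp only [c, if_true, one_smul, Equiv.swap_apply_of_ne_of_ne h1.symm hk0.symm]
    · simp only [c, if_neg h1, Equiv.swap_apply_left, map_smul, inner_smul_left, conj_trivial]
      exact hsn
  · exact ⟨fun i => coordVec i, hΛ, rfl, fun h => absurd h hk⟩

/-- A change of parameter after which the inverse squares of the `φ a` add up to one. -/
theorem exists_normalizing_parameter {J : Set ℝ} (hJ : IsOpen J) (h0 : (0 : ℝ) ∈ J)
    {φ : Fin 3 → ℝ → ℝ} (hφ : ∀ a, ContDiffOn ℝ ∞ (φ a) J) (hφ0 : ∀ a, φ a 0 ≠ 0) :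
    ∃ (S : Set ℝ) (σ ρ : ℝ → ℝ), IsOpen S ∧ (0 : ℝ) ∈ S ∧ ContDiffOn ℝ ∞ σ S ∧ σ 0 = 0 ∧
      MapsTo σ S J ∧ (∀ s ∈ S, HasDerivAt σ (ρ s) s) ∧ ContDiffOn ℝ ∞ ρ S ∧ (∀ s ∈ S, 0 < ρ s) ∧
      (∀ s ∈ S, ∀ a, φ a (σ s) ≠ 0) ∧
      ∀ s ∈ S, ∑ a, 1 / (ρ s * φ a (σ s)) ^ 2 = 1 := by
  have hev : ∀ᶠ t in 𝓝 (0 : ℝ), t ∈ J ∧ ∀ a, φ a t ≠ 0 := by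
    refine (hJ.eventually_mem h0).and (Filter.eventually_all.2 fun a => ?_)
    exact ((hφ a).continuousOn.continuousAt (hJ.mem_nhds h0)).eventually_ne (hφ0 a)
  obtain ⟨r, hr, hball⟩ := Metric.eventually_nhds_iff_ball.1 hev
  set K := Metric.ball (0 : ℝ) r with hK
  have hKo : IsOpen K := Metric.isOpen_ball
  have hKc : K.OrdConnected := (convex_ball _ _).ordConnected
  have h0K : (0 : ℝ) ∈ K := Metric.mem_ball_self hr
  -- The new parameter is ∫w, so σ' = ρ = 1/w at the corresponding point, and Σ1/(ρφ_a)² = w²Σ1/φ_a²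
  -- = 1 for this w.
  let w : ℝ → ℝ := fun t => (√(∑ a, 1 / φ a t ^ 2))⁻¹
  have hpos : ∀ t ∈ K, 0 < ∑ a, 1 / φ a t ^ 2 := fun t ht =>
    Finset.sum_pos (fun a _ => by have := (hball t ht).2 a; positivity) Finset.univ_nonempty
  have hφK : ∀ a, ContDiffOn ℝ ∞ (φ a) K := fun a => (hφ a).mono fun t ht => (hball t ht).1
  have hw : ContDiffOn ℝ ∞ w K :=
    ((ContDiffOn.sum fun a _ => contDiffOn_const.div ((hφK a).pow 2)
      fun t ht => pow_ne_zero 2 ((hball t ht).2 a)).sqrt fun t ht => (hpos t ht).ne').inv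
      fun t ht => (Real.sqrt_pos.2 (hpos t ht)).ne'
  have hw0 : ∀ t ∈ K, 0 < w t := fun t ht => inv_pos.2 (Real.sqrt_pos.2 (hpos t ht))
  obtain ⟨e, hes, hef, hesm, hed⟩ :=
    exists_diffeo_primitive hKo hKc hw (fun t ht => (hw0 t ht).ne') h0K
  have he0 : e 0 = 0 := by rw [hef, intervalIntegral.integral_same]
  have h0e : (0 : ℝ) ∈ e.source := hes ▸ h0K
  have hm : MapsTo e.symm e.target K := fun s hs => hes ▸ e.map_target hs
  refine ⟨e.target, e.symm, fun s => (w (e.symm s))⁻¹, e.open_target, he0 ▸ e.map_source h0e, hesm,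
    ?_, fun s hs => (hball _ (hm hs)).1, hed, (hw.comp hesm hm).inv fun s hs => (hw0 _ (hm hs)).ne',
    fun s hs => inv_pos.2 (hw0 _ (hm hs)), fun s hs => (hball _ (hm hs)).2, fun s hs => ?_⟩
  · conv_lhs => rw [← he0, e.left_inv h0e]
  · have h1 := hpos _ (hm hs)
    have h2 : ∀ a, 1 / ((w (e.symm s))⁻¹ * φ a (e.symm s)) ^ 2 =
        (∑ a, 1 / φ a (e.symm s) ^ 2)⁻¹ * (1 / φ a (e.symm s) ^ 2) := by
      intro a
      simp only [w, inv_inv]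
      rw [mul_pow, Real.sq_sqrt h1.le, one_div, mul_inv, one_div]
    simp only [h2]
    rw [← Finset.mul_sum, inv_mul_cancel₀ h1.ne']

/-- The map sending `x` to the point with coordinates `x_k - B_k` in the leaf through the point
`σ(x₁)` of the axis. -/
def leafMap (σ : ℝ → ℝ) (B : Fin n → ℝ → ℝ) (ε : Fin n → ℝ → En n) (x : En n) : En n :=
  axis (σ (x 0)) + ∑ k ∈ Finset.univ.erase 0, (x k - B k (x 0)) • ε k (x 0)

theorem contDiffOn_leafMap {S : Set ℝ} {σ : ℝ → ℝ} {B : Fin n → ℝ → ℝ} {ε : Fin n → ℝ → En n}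
    (hσ : ContDiffOn ℝ ∞ σ S) (hB : ∀ k, ContDiffOn ℝ ∞ (B k) S)
    (hε : ∀ k, ContDiffOn ℝ ∞ (ε k) S) :
    ContDiffOn ℝ ∞ (leafMap σ B ε) {x | x 0 ∈ S} := by
  have hS : ∀ x ∈ {x : En n | x 0 ∈ S}, x 0 ∈ S := fun _ h => h
  refine (contDiff_axis.comp_contDiffOn (contDiffOn_comp_firstRange hσ hS)).add
    (ContDiffOn.sum fun k _ => ?_)
  exact ((contDiff_coord k).contDiffOn.sub (contDiffOn_comp_firstRange (hB k) hS)).smul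
    (contDiffOn_comp_firstRange (hε k) hS)

/-- As B vanishes at 0, the differential sends v to v_0ρ∂_0 + Σ(v_k − v_0B_k')ε_k(0). Pairing images
with the orthonormal vectors Λε_j(0), where ε_0(0) = ∂_0, gives v_0 = 0 and then every v_k = 0. -/
theorem injective_fderiv_leafMap {S : Set ℝ} (hS : IsOpen S) (h0 : (0 : ℝ) ∈ S) {σ : ℝ → ℝ}
    {B : Fin n → ℝ → ℝ} {ε : Fin n → ℝ → En n} (hB : ∀ k, ContDiffOn ℝ ∞ (B k) S)
    (hε : ∀ k, ContDiffOn ℝ ∞ (ε k) S) {ρ : ℝ} (hρ : HasDerivAt σ ρ 0) (hρ0 : ρ ≠ 0)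
    (hB0 : ∀ k, B k 0 = 0) {Λ : En n →L[ℝ] Hn n}
    (hΛ : ∀ i j, ⟪Λ (ε i 0), Λ (ε j 0)⟫_ℝ = if i = j then 1 else 0) (hε0 : ε 0 0 = coordVec 0) :
    Function.Injective (fderiv ℝ (leafMap σ B ε) 0) := by
  have hz : (0 : En n) 0 = (0 : ℝ) := rfl
  have hd : ∀ {V : Type} [NormedAddCommGroup V] [NormedSpace ℝ V] {g : ℝ → V},
      ContDiffOn ℝ ∞ g S → HasDerivAt g (deriv g 0) ((0 : En n) 0) := fun hg =>
    ((hg.contDiffAt (hS.mem_nhds h0)).differentiableAt (by simp)).hasDerivAt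
  have h1 : HasFDerivAt (leafMap σ B ε) _ 0 :=
    (hasFDerivAt_comp_coord (γ := fun t => axis (σ t)) (x := (0 : En n))
      ((hasDerivAt_axis (σ 0)).scomp 0 hρ)).add
      (HasFDerivAt.fun_sum fun k _ => ((EuclideanSpace.proj k : En n →L[ℝ] ℝ).hasFDerivAt.sub
        (hasFDerivAt_comp_coord (hd (hB k)))).smul (hasFDerivAt_comp_coord (hd (hε k))))
  rw [h1.fderiv, injective_iff_map_eq_zero]
  intro v hv
  simp only [add_apply, ContinuousLinearMap.smulRight_apply, sum_apply, sub_apply, proj_apply, hz,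
    Pi.sub_apply, hB0, smul_eq_mul, PiLp.zero_apply, sub_self, zero_smul, zero_add] at hv
  have hl : ∀ j, v 0 * ρ * (if (0 : Fin n) = j then 1 else 0) + ∑ k ∈ Finset.univ.erase 0,
      (v k - v 0 * deriv (B k) 0) * (if k = j then 1 else 0) = 0 := by
    intro j
    have := congrArg (fun z => ⟪Λ z, Λ (ε j 0)⟫_ℝ) hv
    simpa only [map_add, map_sum, map_smul, inner_add_left, sum_inner, inner_smul_left, ← hε0, hΛ,
      map_zero, inner_zero_left, conj_trivial, mul_assoc] using this
  have hv0 : v 0 = 0 := by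
    have := hl 0
    rw [if_pos rfl, mul_one, Finset.sum_eq_zero, add_zero] at this
    · exact (mul_eq_zero.1 this).resolve_right hρ0
    · intro k hk
      rw [if_neg (Finset.ne_of_mem_erase hk), mul_zero]
  ext j
  by_cases hj : j = 0
  · rw [hj, hv0]; rfl
  · have := hl j
    rw [if_neg (Ne.symm hj), mul_zero, zero_add, Finset.sum_eq_single j] at this
    · simpa [hv0] using this
    · intro k _ hk
      rw [if_neg hk, mul_zero]
    · intro h
      exact absurd (Finset.mem_erase.2 ⟨hj, Finset.mem_univ j⟩) h

end TwistedCoordinates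

/-! ### Twisted product coordinates on a rank one graph -/

section RankOneCoordinates

theorem isSimplyConnected_ball {n : ℕ} {x : En n} {r : ℝ} (hr : 0 < r) :
    IsSimplyConnected (Metric.ball x r) := by
  have := (convex_ball x r).contractibleSpace (Metric.nonempty_ball.2 hr)
  exact SimplyConnectedSpace.ofContractible _

variable {n : ℕ} [NeZero n]

/-- After normalizing the parameter, the leaf map carries the normal form over to F. The remaining
requirements are open conditions at the origin, so a small ball serves as domain and is simply
connected. -/
theorem IsRankOneGraph.exists_twisted_coordinates {U : Set (En n)} {F : En n → Hn n}
    {b : Fin n → Hn n} {N : En n → Hn n} {ν : En n → ℍ[ℝ]} (h : IsRankOneGraph U F b N ν)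
    (hU : IsOpen U) (hc : Convex ℝ U) (h0 : (0 : En n) ∈ U)
    (hb : ∀ i, fderiv ℝ F 0 (coordVec i) = b i) (hN0 : N 0 = b 0) (hν : ∀ a, imComp (ν 0) a ≠ 0)
    (h1 : (1 : Fin n) ≠ 0) :
    ∃ (X : OpenPartialHomeomorph (En n) (En n)) (f : En n → ℝ) (fc : Fin 3 → En n → ℝ)
      (β : ℝ → ℝ) (α : Fin n → ℝ → ℝ), 0 ∈ X.source ∧ X 0 = 0 ∧ X.target ⊆ U ∧
      ContDiffOn ℝ ∞ X X.source ∧ ContDiffOn ℝ ∞ X.symm X.target ∧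
      IsTwistingData X.source f fc β α ∧ IsLf X.source f fc (fun x => F (X x)) ∧
      ((∃ j, j ≠ 0 ∧ α j 0 ≠ 0) → ∀ x ∈ X.source, 0 < α 1 (x 0)) := by
  have hΛ : ∀ i j, ⟪fderiv ℝ F 0 (coordVec i), fderiv ℝ F 0 (coordVec j)⟫_ℝ =
      if i = j then 1 else 0 := by
    intro i j
    rw [hb j, h.graph 0 h0]
    simp [eq_comm]
  obtain ⟨ε₀, hε₀, hε₀z, hneg⟩ :=
    exists_signed_permutation hΛ (fderiv ℝ N 0 (coordVec 0)) h1
  obtain ⟨D, E, β, α, φ, B, ε, hN, hβs, hαs, hφs, hBs, hεs, hB0, hε0, hform, hβ0, hα0, hφ0⟩ :=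
    h.exists_isNormalForm_axis hU hc h0 (by rw [hb, hN0]) hε₀ hε₀z
  have hJ : IsOpen (axis ⁻¹' U) := hU.preimage (contDiff_axis (n := n)).continuous
  have h0J : (0 : ℝ) ∈ axis ⁻¹' U := by simpa [axis_zero] using h0
  obtain ⟨S, σ, ρ, hS, h0S, hσ, hσ0, hm, hσd, hρ, hρpos, hφne, hsum⟩ :=
    exists_normalizing_parameter hJ h0J hφs fun a => by rw [hφ0]; exact hν a
  have hN' := hN.reparam hσ hm hσd
  set φ' : Fin 3 → ℝ → ℝ := fun a s => ρ s * φ a (σ s) with hφ'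
  set α' : Fin n → ℝ → ℝ := fun j s => ρ s * α j (σ s) with hα'
  set β' : ℝ → ℝ := fun s => ρ s * β (σ s) with hβ'
  have hφ's : ∀ a, ContDiffOn ℝ ∞ (φ' a) S := fun a => hρ.mul ((hφs a).comp hσ hm)
  have hα's : ∀ j, ContDiffOn ℝ ∞ (α' j) S := fun j => hρ.mul ((hαs j).comp hσ hm)
  have hβ's : ContDiffOn ℝ ∞ β' S := hρ.mul (hβs.comp hσ hm)
  have hφ'0 : ∀ s ∈ S, ∀ a, φ' a s ≠ 0 := fun s hs a => mul_ne_zero (hρpos s hs).ne' (hφne s hs a)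
  let f : En n → ℝ := fun x => β' (x 0) + ∑ j ∈ Finset.univ.erase 0, α' j (x 0) * x j
  -- Forced by f/f_a = φ'_a. The normalization Σ1/φ'_a² = 1 is then the required identity f² =
  -- Σf_a².
  let fc : Fin 3 → En n → ℝ := fun a x => f x / φ' a (x 0)
  set T₀ : Set (En n) := {x | x 0 ∈ S} with hT₀
  have hT₀o : IsOpen T₀ := hS.preimage (contDiff_coord 0).continuous
  have h0T : (0 : En n) ∈ T₀ := h0S
  have hfs : ContDiffOn ℝ ∞ f T₀ :=
    (contDiffOn_comp_firstRange hβ's fun _ hx => hx).add (ContDiffOn.sum fun j _ =>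
      (contDiffOn_comp_firstRange (hα's j) fun _ hx => hx).mul (contDiff_coord j).contDiffOn)
  have hf0 : 0 < f 0 := by
    have : f 0 = ρ 0 := by simp [f, hβ', hσ0, hβ0]
    rw [this]
    exact hρpos 0 h0S
  let B' : Fin n → ℝ → ℝ := fun k s => B k (σ s)
  let ε' : Fin n → ℝ → En n := fun k s => ε k (σ s)
  have hB's : ∀ k, ContDiffOn ℝ ∞ (B' k) S := fun k => (hBs k).comp hσ hm
  have hε's : ∀ k, ContDiffOn ℝ ∞ (ε' k) S := fun k => (hεs k).comp hσ hm
  set Y : En n → En n := leafMap σ B' ε' with hY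
  have hYs : ContDiffOn ℝ ∞ Y T₀ := contDiffOn_leafMap hσ hB's hε's
  have hY0 : Y 0 = 0 := by
    simp [hY, leafMap, hσ0, axis_zero, B', hB0]
  have hYi : Function.Injective (fderiv ℝ Y 0) :=
    injective_fderiv_leafMap (Λ := fderiv ℝ F 0) hS h0S hB's hε's (hσd 0 h0S) (hρpos 0 h0S).ne'
      (fun k => by simp only [B', hσ0, hB0]) (fun i j => by simp only [ε', hσ0, hε0, hε₀])
      (by simp only [ε', hσ0, hε0, hε₀z])
  -- α'_k(0) is −ρ(0) times the functional made negative by the choice of ε₀, and ρ(0) > 0.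
  have hpos : (∃ j, j ≠ 0 ∧ α' j 0 ≠ 0) → 0 < α' 1 0 := by
    rintro ⟨j, hj, hjα⟩
    have h2 : ∀ k, α' k 0 = -(ρ 0 * ⟪fderiv ℝ F 0 (ε₀ k), fderiv ℝ N 0 (coordVec 0)⟫_ℝ) :=
      fun k => by simp only [hα', hσ0, hα0, mul_neg]
    have h3 := hneg ⟨j, hj, fun h4 => hjα (by rw [h2, h4, mul_zero, neg_zero])⟩
    rw [h2]
    have := mul_neg_of_pos_of_neg (hρpos 0 h0S) h3
    linarith
  have hT₀n : T₀ ∈ 𝓝 (0 : En n) := hT₀o.mem_nhds h0T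
  have hev : ∀ᶠ x in 𝓝 (0 : En n), x ∈ T₀ ∧ Y x ∈ U ∧ 0 < f x ∧
      ((∃ j, j ≠ 0 ∧ α' j 0 ≠ 0) → 0 < α' 1 (x 0)) := by
    refine (hT₀o.eventually_mem h0T).and (Filter.Eventually.and ?_ (Filter.Eventually.and ?_ ?_))
    · exact (hYs.continuousOn.continuousAt hT₀n).eventually_mem (by rw [hY0]; exact hU.mem_nhds h0)
    · exact (hfs.continuousOn.continuousAt hT₀n).eventually (lt_mem_nhds hf0)
    · by_cases hj : ∃ j, j ≠ 0 ∧ α' j 0 ≠ 0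
      · have h2 : ContinuousAt (fun x : En n => α' 1 (x 0)) 0 :=
          ((contDiffOn_comp_firstRange (hα's 1) (T := T₀)
            fun _ hx => hx).continuousOn.continuousAt hT₀n)
        filter_upwards [h2.eventually (lt_mem_nhds (hpos hj))] with x hx _ using hx
      · exact Filter.Eventually.of_forall fun x hj' => absurd hj' hj
  obtain ⟨W, hW, hWo, h0W⟩ := eventually_nhds_iff.1 hev
  obtain ⟨e, h0e, heW, hef, hes⟩ :=
    exists_local_diffeo hWo (hYs.mono fun x hx => (hW x hx).1) h0W hYi
  obtain ⟨r, hr, hre⟩ := Metric.isOpen_iff.1 e.open_source 0 h0e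
  let X := e.restrOpen (Metric.ball 0 r) Metric.isOpen_ball
  have hXs : X.source = Metric.ball 0 r := inter_eq_right.2 hre
  have hXW : X.source ⊆ W := fun x hx => heW hx.1
  have hXY : ∀ x, X x = Y x := fun x => hef x
  have hd : IsTwistingData X.source f fc β' α' := by
    refine ⟨X.open_source, hXs ▸ isSimplyConnected_ball hr, hfs.mono fun x hx => (hW x (hXW hx)).1,
      fun x hx => (hW x (hXW hx)).2.2.1, fun a => ?_, fun a x hx => ?_, fun x hx => ?_,
      fun a => ⟨φ' a, fun x hx => ?_⟩, fun x _ => rfl⟩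
    · exact (hfs.mono fun x hx => (hW x (hXW hx)).1).div
        (contDiffOn_comp_firstRange (hφ's a) fun x hx => (hW x (hXW hx)).1)
        fun x hx => hφ'0 _ (hW x (hXW hx)).1 a
    · exact div_ne_zero (hW x (hXW hx)).2.2.1.ne' (hφ'0 _ (hW x (hXW hx)).1 a)
    · have h2 := hsum _ (hW x (hXW hx)).1
      rw [Fin.sum_univ_three] at h2
      simp only [fc, div_pow, hφ']
      linear_combination (-f x ^ 2) * h2
    · exact div_div_cancel₀ (hW x (hXW hx)).2.2.1.ne'
  refine ⟨X, f, fc, β', α', ⟨h0e, Metric.mem_ball_self hr⟩, (hXY 0).trans hY0, ?_, ?_, ?_, hd, ?_,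
    fun hj x hx => (hW x (hXW hx)).2.2.2 hj⟩
  · intro y hy
    have h2 := X.map_target hy
    rw [← X.right_inv hy, hXY]
    exact (hW _ (hXW h2)).2.1
  · exact (hYs.mono fun x hx => (hW x (hXW hx)).1).congr fun x _ => hXY x
  · exact hes.mono fun y hy => hy.1
  · refine IsLf.congr (hN'.isLf hd (fun a x hx => ?_) hS fun x hx => (hW x (hXW hx)).1)
      X.open_source fun x hx => ?_
    · exact div_div_cancel₀ (hW x (hXW hx)).2.2.1.ne'
    · have h2 := hform (σ (x 0)) (hm (hW x (hXW hx)).1) (fun k => x k)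
        (hW x (hXW hx)).2.1
      change F (X x) = _
      rw [hXY]
      exact h2

end RankOneCoordinates

/-! ## Left multiplication by a unit quaternion -/

section UnitQuaternion

variable {n : ℕ}

theorem re_mul_comm (p q : ℍ[ℝ]) : (p * q).re = (q * p).re := by
  simp only [Quaternion.re_mul]
  ring

theorem inner_smul_smul_of_norm {q : ℍ[ℝ]} (hq : ‖q‖ = 1) (x y : Hn n) :
    ⟪q • x, q • y⟫_ℝ = ⟪x, y⟫_ℝ := by
  rw [inner_eq_re_qdot, inner_eq_re_qdot, qdot_smul_left, qdot_smul_right, re_mul_comm, mul_assoc,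
    star_mul_self_of_norm hq, mul_one]

theorem fderiv_quat_smul {F : En n → Hn n} {u : En n} (hF : DifferentiableAt ℝ F u) (q : ℍ[ℝ])
    (v : En n) : fderiv ℝ (fun y => q • F y) u v = q • fderiv ℝ F u v := by
  rw [fderiv_fun_const_smul hF]
  rfl

theorem secondFF_quat_smul {F : En n → Hn n} {u : En n} (hF : ContDiffAt ℝ ∞ F u) {q : ℍ[ℝ]}
    (hq : ‖q‖ = 1) (v w : En n) :
    secondFF (fun y => q • F y) u v w = q • secondFF F u v w := by
  have hFd : ∀ᶠ y in 𝓝 u, DifferentiableAt ℝ F y :=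
    ((hF.of_le (m := 1) (by simp)).eventually (by simp)).mono fun y hy =>
      hy.differentiableAt (by simp)
  have hd : DifferentiableAt ℝ (fun y => fderiv ℝ F y) u :=
    (hF.fderiv_right (m := ∞) (by simp)).differentiableAt (by simp)
  have h1 : (fun y => fderiv ℝ (fun y => q • F y) y w) =ᶠ[𝓝 u] fun y => q • fderiv ℝ F y w :=
    hFd.mono fun y hy => fderiv_quat_smul hy q w
  have h2 : fderiv ℝ (fun y => fderiv ℝ (fun y => q • F y) y) u v w =
      q • fderiv ℝ (fun y => fderiv ℝ F y) u v w := by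
    rw [snd_fderiv_apply (hF.const_smul q), h1.fderiv_eq,
      fderiv_quat_smul (hd.clm_apply (differentiableAt_const w)), snd_fderiv_apply hF]
  obtain ⟨p, hp⟩ := snd_fderiv_eq_add F u v w
  refine secondFF_eq_of_add (h2.trans (by rw [hp, smul_add]))
    ⟨p, fderiv_quat_smul hFd.self_of_nhds q p⟩ fun z => ?_
  rw [fderiv_quat_smul hFd.self_of_nhds, inner_smul_smul_of_norm hq, inner_secondFF]

/-- q(νN) = (qνq̄)(qN), so ν is conjugated. Since the hermitian product of tangent vectors is real,
qrq̄ = r and the Lagrangian condition survives. -/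
theorem IsRankOneGraph.smul {U : Set (En n)} {F : En n → Hn n} {b : Fin n → Hn n}
    {N : En n → Hn n} {ν : En n → ℍ[ℝ]} (h : IsRankOneGraph U F b N ν) (hU : IsOpen U) {q : ℍ[ℝ]}
    (hq : ‖q‖ = 1) : IsRankOneGraph U (fun u => q • F u) (fun i => q • b i) (fun u => q • N u)
      (fun u => q * ν u * star q) := by
  have hFd : ∀ u ∈ U, DifferentiableAt ℝ F u := fun u hu =>
    (h.smooth.contDiffAt (hU.mem_nhds hu)).differentiableAt (by simp)
  refine ⟨h.smooth.const_smul q, h.smooth_N.const_smul q, fun u hu v i => ?_, fun u hu => ?_,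
    fun u hu => ?_, fun u hu a v w => ?_, fun u hu => re_conj (h.re_ν u hu), fun u hu => ?_,
    fun u hu v w => ?_⟩
  · rw [fderiv_quat_smul (hFd u hu), inner_smul_smul_of_norm hq, h.graph u hu]
  · obtain ⟨w, hw⟩ := h.tangent u hu
    exact ⟨w, by rw [fderiv_quat_smul (hFd u hu), hw]⟩
  · rw [inner_smul_smul_of_norm hq, h.inner_N u hu]
  · have h1 := qdot_eq_coe rfl fun a => h.lagrangian u hu a v w
    rw [fderiv_quat_smul (hFd u hu), fderiv_quat_smul (hFd u hu), inner_imUnit_smul,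
      qdot_smul_left, qdot_smul_right, h1, Quaternion.coe_mul_eq_smul, mul_smul_comm,
      mul_star_self_of_norm hq]
    fin_cases a <;> simp
  · intro h0
    refine h.ν_ne_zero u hu ?_
    calc ν u = star q * (q * ν u * star q) * q := by
          simp only [mul_assoc, star_mul_self_of_norm hq, mul_one]
          rw [← mul_assoc, star_mul_self_of_norm hq, one_mul]
      _ = 0 := by rw [h0, mul_zero, zero_mul]
  · rw [secondFF_quat_smul (h.smooth.contDiffAt (hU.mem_nhds hu)) hq, h.secondFF_eq u hu,
      fderiv_quat_smul (hFd u hu), fderiv_quat_smul (hFd u hu), inner_smul_smul_of_norm hq,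
      inner_smul_smul_of_norm hq, smul_smul (q * ν u * star q), mul_assoc,
      star_mul_self_of_norm hq, mul_one, mul_smul q (ν u), smul_comm q]

end UnitQuaternion

/-! ## Graph coordinates on an immersed manifold -/

section GraphChart

variable {n : ℕ} {M : Type*} [TopologicalSpace M] [ChartedSpace (En n) M]
  [IsManifold 𝓘(ℝ, En n) ∞ M] {g : SmoothMetric n M} {L : M → Hn n}
  {Φ : OpenPartialHomeomorph M (En n)}

theorem contMDiffOn_diffAt (hL : ContMDiff 𝓘(ℝ, En n) 𝓘(ℝ, Hn n) ∞ L) {U : Set M}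
    {e : (x : M) → TangentSpace 𝓘(ℝ, En n) x}
    (he : ContMDiffOn 𝓘(ℝ, En n) (𝓘(ℝ, En n)).tangent ∞
      (fun x => (⟨x, e x⟩ : TangentBundle 𝓘(ℝ, En n) M)) U) :
    ContMDiffOn 𝓘(ℝ, En n) 𝓘(ℝ, Hn n) ∞ (fun x => diffAt L x (e x)) U :=
  ((contMDiff_snd_tangentBundle_modelSpace (Hn n) 𝓘(ℝ, Hn n)).comp
    (hL.contMDiff_tangentMap (m := ∞) (by simp))).comp_contMDiffOn he

/-- Tangent vectors at a point, expressed in a chart. -/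
theorem exists_chart_vectors (hL : ContMDiff 𝓘(ℝ, En n) 𝓘(ℝ, Hn n) ∞ L)
    (hΦ : Φ ∈ IsManifold.maximalAtlas 𝓘(ℝ, En n) ∞ M) {x : En n} (hx : x ∈ Φ.target) {p : M}
    (hp : Φ.symm x = p) : ∃ A : TangentSpace 𝓘(ℝ, En n) p → En n,
      (∀ v, fderiv ℝ (L ∘ Φ.symm) x (A v) = diffAt L p v) ∧
      ∀ v w, secondFF (L ∘ Φ.symm) x (A v) (A w) = secondFFAt L p v w := by
  subst hp
  choose A hA using (bijective_mfderiv_symm hΦ hx).2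
  exact ⟨A, fun v => (diffAt_mfderiv_symm hL hΦ hx (A v)).symm.trans (congrArg _ (hA v)),
    fun v w => (secondFFAt_mfderiv_symm hL hΦ hx (A v) (A w)).symm.trans
      (congrArg₂ (secondFFAt L _) (hA v) (hA w))⟩

/-- Around every point there are graph coordinates over the tangent space. -/
theorem exists_graph_chart (hL : IsLagrangianIsometricImmersion g L) (p : M)
    {e : Fin n → TangentSpace 𝓘(ℝ, En n) p}
    (he : ∀ i j, g.inner p (e i) (e j) = if i = j then 1 else 0) :
    ∃ Φ ∈ IsManifold.maximalAtlas 𝓘(ℝ, En n) ∞ M, p ∈ Φ.source ∧ Φ p = 0 ∧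
      (∀ u ∈ Φ.target, ∀ v i, ⟪fderiv ℝ (L ∘ Φ.symm) u v, diffAt L p (e i)⟫_ℝ = v i) ∧
      ∀ i, fderiv ℝ (L ∘ Φ.symm) 0 (coordVec i) = diffAt L p (e i) := by
  set b : Fin n → Hn n := fun i => diffAt L p (e i) with hb
  have hbb : ∀ i j, ⟪b i, b j⟫_ℝ = if i = j then 1 else 0 := fun i j => by
    rw [hb]; exact (hL.isometric p _ _).trans (he i j)
  set c := chartAt (En n) p with hc
  have hcm : c ∈ IsManifold.maximalAtlas 𝓘(ℝ, En n) ∞ M := IsManifold.chart_mem_maximalAtlas p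
  have hpc : p ∈ c.source := mem_chart_source _ p
  have hx : c p ∈ c.target := c.map_source hpc
  obtain ⟨A, hA, -⟩ := exists_chart_vectors hL.smooth hcm hx (c.left_inv hpc)
  have hF : ContDiffOn ℝ ∞ (L ∘ c.symm) c.target := contDiffOn_comp_symm hL.smooth hcm
  -- Projection onto the tangent space at p, in the coordinates of the frame b. Composed with L −
  -- L(p) it is a local diffeomorphism at p, and these coordinates make L a graph.
  let ℓ : Hn n →L[ℝ] En n := ∑ i, (innerSL ℝ (b i)).smulRight (coordVec i)
  have hℓ : ∀ y i, ℓ y i = ⟪y, b i⟫_ℝ := by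
    intro y i
    simp only [ℓ, sum_apply, ContinuousLinearMap.smulRight_apply, innerSL_apply_apply]
    rw [real_inner_comm]
    simp [Finset.sum_apply, Pi.single_apply]
  let Y : En n → En n := fun x => ℓ (L (c.symm x) - L p)
  have hY : ContDiffOn ℝ ∞ Y c.target := ℓ.contDiff.comp_contDiffOn (hF.sub contDiffOn_const)
  have hYd : fderiv ℝ Y (c p) = ℓ ∘SL fderiv ℝ (L ∘ c.symm) (c p) := by
    have h1 : HasFDerivAt (L ∘ c.symm) _ (c p) :=
      ((hF.contDiffAt (c.open_target.mem_nhds hx)).differentiableAt (by simp)).hasFDerivAt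
    exact (ℓ.hasFDerivAt.comp (c p) (h1.sub_const (L p))).fderiv
  have hYi : Function.Injective (fderiv ℝ Y (c p)) := by
    rw [hYd, injective_iff_map_eq_zero]
    intro v hv
    rw [eq_sum_of_orthonormal_image (Λ := fderiv ℝ (L ∘ c.symm) (c p)) (e := fun i => A (e i))
      (fun i j => by rw [hA, hA]; exact hbb i j) v]
    refine Finset.sum_eq_zero fun i _ => ?_
    have : ℓ (fderiv ℝ (L ∘ c.symm) (c p) v) i = 0 := by
      rw [ContinuousLinearMap.comp_apply] at hv
      rw [hv]; rfl
    have hbi : diffAt L p (e i) = b i := rfl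
    rw [hA, hbi, ← hℓ, this, zero_smul]
  obtain ⟨E, hpE, hEs, hEY, hEsm⟩ := exists_local_diffeo c.open_target hY hx hYi
  have hΦ : c.trans E ∈ IsManifold.maximalAtlas 𝓘(ℝ, En n) ∞ M :=
    trans_mem_maximalAtlas hcm ((hY.mono hEs).congr fun x _ => hEY x) hEsm
  have hpΦ : p ∈ (c.trans E).source := by
    rw [OpenPartialHomeomorph.trans_source]
    exact ⟨hpc, hpE⟩
  have hΦp : (c.trans E) p = 0 := by
    change E (c p) = 0
    rw [hEY]
    simp only [Y]
    rw [c.left_inv hpc, sub_self, map_zero]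
  have hcoord : ∀ u ∈ (c.trans E).target, ℓ (L ((c.trans E).symm u) - L p) = u := by
    intro u hu
    have h1 : (c.trans E) ((c.trans E).symm u) = u := (c.trans E).right_inv hu
    conv_rhs => rw [← h1]
    change _ = E (c ((c.trans E).symm u))
    rw [hEY]
    simp only [Y]
    have h2 : (c.trans E).symm u ∈ c.source := ((c.trans E).map_target hu).1
    rw [c.left_inv h2]
  have hgraph : ∀ u ∈ (c.trans E).target, ∀ v i,
      ⟪fderiv ℝ (L ∘ (c.trans E).symm) u v, b i⟫_ℝ = v i := by
    intro u hu v i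
    have h1 : HasFDerivAt (L ∘ (c.trans E).symm) _ u :=
      (((contDiffOn_comp_symm hL.smooth hΦ).contDiffAt
        ((c.trans E).open_target.mem_nhds hu)).differentiableAt (by simp)).hasFDerivAt
    have h2 := ℓ.hasFDerivAt.comp u (h1.sub_const (L p))
    have h3 : (ℓ ∘ fun x => (L ∘ (c.trans E).symm) x - L p) =ᶠ[𝓝 u] id :=
      Filter.mem_of_superset ((c.trans E).open_target.mem_nhds hu) hcoord
    have h4 := h2.unique ((hasFDerivAt_id u).congr_of_eventuallyEq h3)
    rw [← hℓ, ← ContinuousLinearMap.comp_apply, h4]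
    rfl
  have h0 : (0 : En n) ∈ (c.trans E).target := hΦp ▸ (c.trans E).map_source hpΦ
  refine ⟨c.trans E, hΦ, hpΦ, hΦp, hgraph, fun i => ?_⟩
  obtain ⟨A', hA', -⟩ := exists_chart_vectors hL.smooth hΦ h0
    (by rw [← hΦp, (c.trans E).left_inv hpΦ] : (c.trans E).symm 0 = p)
  have h1 : A' (e i) = coordVec i := by
    ext j
    rw [← hgraph 0 h0, hA']
    refine (hbb i j).trans ?_
    simp [eq_comm]
  rw [← h1, hA']

end GraphChart

/-! ## Flat `H`-umbilical immersions -/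

section FlatUmbilical

variable {n : ℕ}

/-- At the origin the reference plane is the tangent space itself, and the second derivative of a
graph is orthogonal to it. -/
theorem snd_fderiv_eq_secondFF_of_graph {U : Set (En n)} {F : En n → Hn n} {b : Fin n → Hn n}
    (hU : IsOpen U) (hF : ContDiffOn ℝ ∞ F U)
    (hg : ∀ u ∈ U, ∀ v i, ⟪fderiv ℝ F u v, b i⟫_ℝ = v i) (h0 : (0 : En n) ∈ U)
    (hb : ∀ i, fderiv ℝ F 0 (coordVec i) = b i) (v w : En n) :
    fderiv ℝ (fun y => fderiv ℝ F y) 0 v w = secondFF F 0 v w := by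
  obtain ⟨p, hp⟩ := snd_fderiv_eq_add F 0 v w
  have h1 : p = 0 := eq_zero_of_inner_graph (hg 0 h0) fun i => by
    have h2 := inner_snd_fderiv_of_graph hU hF hg h0 v w i
    rwa [hp, inner_add_left, ← hb i, real_inner_comm _ (secondFF F 0 v w), inner_secondFF,
      add_zero, hb i] at h2
  rw [hp, h1, map_zero, zero_add]

theorem secondFF_sum (F : En n → Hn n) (x : En n) (a c : Fin n → ℝ) (e : Fin n → En n) :
    secondFF F x (∑ i, a i • e i) (∑ j, c j • e j) =
      ∑ i, ∑ j, (a i * c j) • secondFF F x (e i) (e j) := by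
  simp only [secondFF, map_sum, map_smul, sum_apply, smul_apply, Finset.smul_sum, smul_smul]
  rw [Finset.sum_comm]
  simp only [mul_comm]

theorem secondFF_symm {F : En n → Hn n} {x : En n} (hF : ContDiffAt ℝ ∞ F x) (v w : En n) :
    secondFF F x v w = secondFF F x w v := by
  rw [secondFF, snd_fderiv_symm hF, secondFF]

theorem fin_one_ne_zero {n : ℕ} [NeZero n] (hn : 1 < n) : (1 : Fin n) ≠ 0 := by
  rw [Ne, Fin.ext_iff, Fin.val_one', Fin.val_zero, Nat.mod_eq_of_lt hn]
  exact one_ne_zero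

variable [NeZero n] {M : Type*} [TopologicalSpace M] [ChartedSpace (En n) M]
  [IsManifold 𝓘(ℝ, En n) ∞ M] {g : SmoothMetric n M} {L : M → Hn n}

/-- On a flat manifold of dimension at least three the coefficients `μ` vanish. -/
theorem umbilic_coefficient_eq_zero (hn : 3 ≤ n) (hflat : IsFlat g)
    (hL : IsLagrangianIsometricImmersion g L) (p : M) {e : Fin n → TangentSpace 𝓘(ℝ, En n) p}
    (he : ∀ i j, g.inner p (e i) (e j) = if i = j then 1 else 0) {m : ℍ[ℝ]}
    (hj : ∀ j, j ≠ 0 → secondFFAt L p (e j) (e j) = m • diffAt L p (e 0))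
    (hjk : ∀ j k, j ≠ 0 → k ≠ 0 → j ≠ k → secondFFAt L p (e j) (e k) = 0) : m = 0 := by
  obtain ⟨Φ, hΦ, hpΦ, hΦp, hg, hb⟩ := exists_graph_chart hL p he
  have h0 : (0 : En n) ∈ Φ.target := hΦp ▸ Φ.map_source hpΦ
  have hF := contDiffOn_comp_symm hL.smooth hΦ
  have hsymm : Φ.symm 0 = p := by rw [← hΦp, Φ.left_inv hpΦ]
  obtain ⟨A, hA, hAff⟩ := exists_chart_vectors hL.smooth hΦ h0 hsymm
  have hAe : ∀ i, A (e i) = coordVec i := fun i => by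
    ext j
    rw [← hg 0 h0, hA, ← hb i, hg 0 h0]
  have hff : ∀ i j, vderiv i (vderiv j (L ∘ Φ.symm)) 0 = secondFFAt L p (e i) (e j) := by
    intro i j
    rw [vderiv_vderiv (hF.contDiffAt (Φ.open_target.mem_nhds h0)),
      snd_fderiv_eq_secondFF_of_graph Φ.open_target hF hg h0 hb, ← hAff, hAe, hAe]
  let i₁ : Fin n := ⟨1, by omega⟩
  let i₂ : Fin n := ⟨2, by omega⟩
  have h1 : i₁ ≠ 0 := by simp [i₁, Fin.ext_iff]
  have h2 : i₂ ≠ 0 := by simp [i₂, Fin.ext_iff]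
  have h12 : i₁ ≠ i₂ := by simp [i₁, i₂, Fin.ext_iff]
  -- For the plane of e_2 and e_3 (indices 1 and 2), flatness says ⟨h(e_3, e_3), h(e_2, e_2)⟩ =
  -- |h(e_2, e_3)|². The left side is |m|² and the right side is 0.
  have hG := gauss_of_flat Φ.open_target h0 hF hg hb (G := metricCoeff g Φ)
    (fun x hx i j => metricCoeff_eq hL hΦ hx i j) (fun l k i j => hflat Φ hΦ 0 h0 l k i j)
    i₁ i₂ i₂ i₁
  have hfr : IsQFrame fun i => diffAt L p (e i) :=
    isQFrame_of_inner (fun i j => (hL.isometric p _ _).trans (he i j))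
      fun a i j => hL.lagrangian p a _ _
  rw [hff, hff, hff, hff, hj _ h1, hj _ h2, hjk _ _ h1 h2 h12, inner_zero_left,
    hfr.inner_smul, if_pos rfl] at hG
  exact inner_self_eq_zero.1 hG

/-- A flat `H`-umbilical immersion without totally geodesic points is locally a graph of rank
one. -/
theorem exists_isRankOneGraph (hn : 3 ≤ n) (hflat : IsFlat g)
    (hL : IsLagrangianIsometricImmersion g L) (hH : IsHUmbilical g L)
    (hT : NoTotallyGeodesicPoint L) (p : M) :
    ∃ Φ ∈ IsManifold.maximalAtlas 𝓘(ℝ, En n) ∞ M, p ∈ Φ.source ∧ Φ p = 0 ∧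
      ∃ (U : Set (En n)) (b : Fin n → Hn n) (N : En n → Hn n) (ν : En n → ℍ[ℝ]), IsOpen U ∧
        Convex ℝ U ∧ 0 ∈ U ∧ U ⊆ Φ.target ∧ IsRankOneGraph U (L ∘ Φ.symm) b N ν ∧
        (∀ i, fderiv ℝ (L ∘ Φ.symm) 0 (coordVec i) = b i) ∧ N 0 = b 0 := by
  obtain ⟨O, hO, hpO, e, lam, mu, hes, hx⟩ := hH p
  obtain ⟨Φ, hΦ, hpΦ, hΦp, hg, hb⟩ := exists_graph_chart hL p (hx p hpO).1
  have h0 : (0 : En n) ∈ Φ.target := hΦp ▸ Φ.map_source hpΦ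
  have hF := contDiffOn_comp_symm hL.smooth hΦ
  have hsymm : Φ.symm 0 = p := by rw [← hΦp, Φ.left_inv hpΦ]
  let G : M → Hn n := fun x => diffAt L x (e 0 x)
  have hev : Φ.target ∩ Φ.symm ⁻¹' O ∈ 𝓝 (0 : En n) :=
    Filter.inter_mem (Φ.open_target.mem_nhds h0)
      ((Φ.continuousAt_symm h0).preimage_mem_nhds (by rw [hsymm]; exact hO.mem_nhds hpO))
  obtain ⟨r, hr, hball⟩ := Metric.mem_nhds_iff.1 hev
  set U : Set (En n) := Metric.ball 0 r with hU
  have hUO : MapsTo Φ.symm U O := fun u hu => (hball hu).2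
  have hUT : U ⊆ Φ.target := fun u hu => (hball hu).1
  have hG : ContDiffOn ℝ ∞ (fun u => G (Φ.symm u)) U := by
    rw [← contMDiffOn_iff_contDiffOn]
    exact (contMDiffOn_diffAt hL.smooth (hes 0)).comp
      ((contMDiffOn_symm_of_mem_maximalAtlas hΦ).mono hUT) hUO
  have key : ∀ u ∈ U, (∃ w, fderiv ℝ (L ∘ Φ.symm) u w = G (Φ.symm u)) ∧
      ⟪G (Φ.symm u), G (Φ.symm u)⟫_ℝ = 1 ∧
      (∀ v w, secondFF (L ∘ Φ.symm) u v w =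
        (⟪fderiv ℝ (L ∘ Φ.symm) u v, G (Φ.symm u)⟫_ℝ *
          ⟪fderiv ℝ (L ∘ Φ.symm) u w, G (Φ.symm u)⟫_ℝ) •
            (imQuat (fun a => lam a (Φ.symm u)) • G (Φ.symm u))) := by
    intro u hu
    obtain ⟨he, h00, h0j, hjk⟩ := hx _ (hUO hu)
    -- The Gauss equation was proved at the centre of graph coordinates; fresh graph coordinates at
    -- each point make μ vanish on the whole neighbourhood.
    have hm : imQuat (fun a => mu a (Φ.symm u)) = 0 :=
      umbilic_coefficient_eq_zero hn hflat hL (Φ.symm u) he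
        (fun j hj => by rw [(h0j j hj).2, sum_smul_imUnit_smul]) hjk
    obtain ⟨A, hA, hAff⟩ := exists_chart_vectors hL.smooth hΦ (hUT hu) rfl
    have hin : ∀ i j, ⟪fderiv ℝ (L ∘ Φ.symm) u (A (e i (Φ.symm u))),
        fderiv ℝ (L ∘ Φ.symm) u (A (e j (Φ.symm u)))⟫_ℝ = if i = j then 1 else 0 := fun i j => by
      rw [hA, hA]
      exact (hL.isometric _ _ _).trans (he i j)
    have hA0 : fderiv ℝ (L ∘ Φ.symm) u (A (e 0 (Φ.symm u))) = G (Φ.symm u) := hA _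
    have hzero : ∀ i j, ¬(i = 0 ∧ j = 0) →
        secondFF (L ∘ Φ.symm) u (A (e i (Φ.symm u))) (A (e j (Φ.symm u))) = 0 := by
      have h0j' : ∀ j, j ≠ 0 →
          secondFF (L ∘ Φ.symm) u (A (e 0 (Φ.symm u))) (A (e j (Φ.symm u))) = 0 := fun j hj => by
        rw [hAff, (h0j j hj).1, sum_smul_imUnit_smul, hm, zero_smul]
      intro i j hij
      by_cases hi : i = 0
      · rw [hi]
        exact h0j' j fun hj => hij ⟨hi, hj⟩
      by_cases hj : j = 0
      · rw [hj, secondFF_symm (hF.contDiffAt (Φ.open_target.mem_nhds (hUT hu)))]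
        exact h0j' i hi
      by_cases hij' : i = j
      · rw [← hij', hAff, (h0j i hi).2, sum_smul_imUnit_smul, hm, zero_smul]
      · rw [hAff]
        exact hjk i j hi hj hij'
    refine ⟨⟨_, hA0⟩, ?_, fun v w => ?_⟩
    · rw [← hA0, hin, if_pos rfl]
    · conv_lhs => rw [eq_sum_of_orthonormal_image hin v, eq_sum_of_orthonormal_image hin w]
      rw [secondFF_sum, Finset.sum_eq_single 0, Finset.sum_eq_single 0, hAff, h00,
        sum_smul_imUnit_smul, hA0]
      · intro j _ hj
        rw [hzero 0 j fun h => hj h.2, smul_zero]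
      · exact fun h => absurd (Finset.mem_univ _) h
      · intro i _ hi
        exact Finset.sum_eq_zero fun j _ => by rw [hzero i j fun h => hi h.1, smul_zero]
      · exact fun h => absurd (Finset.mem_univ _) h
  refine ⟨Φ, hΦ, hpΦ, hΦp, U, fun i => diffAt L p (e i p), fun u => G (Φ.symm u),
    fun u => imQuat fun a => lam a (Φ.symm u), Metric.isOpen_ball, convex_ball _ _,
    Metric.mem_ball_self hr, hUT, ⟨hF.mono hUT, hG, fun u hu => hg u (hUT hu),
    fun u hu => (key u hu).1, fun u hu => (key u hu).2.1, fun u hu a v w => ?_,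
    fun u _ => imQuat_re _, fun u hu h => ?_, fun u hu => (key u hu).2.2⟩, hb, ?_⟩
  · rw [← diffAt_mfderiv_symm hL.smooth hΦ (hUT hu), ← diffAt_mfderiv_symm hL.smooth hΦ (hUT hu)]
    exact hL.lagrangian _ a _ _
  · obtain ⟨v, w, hvw⟩ := hT (Φ.symm u)
    obtain ⟨A, -, hAff⟩ := exists_chart_vectors hL.smooth hΦ (hUT hu) rfl
    rw [← hAff, (key u hu).2.2, h, zero_smul, smul_zero] at hvw
    exact hvw rfl
  · change G (Φ.symm 0) = G p
    rw [hsymm]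

/-- Adapted coordinates centred at a given point. -/
theorem exists_isAdaptedChart (hn : 3 ≤ n) (hflat : IsFlat g)
    (hL : IsLagrangianIsometricImmersion g L) (hH : IsHUmbilical g L)
    (hT : NoTotallyGeodesicPoint L) (p : M) :
    ∃ (Φ : OpenPartialHomeomorph M (En n)) (f : En n → ℝ) (fc : Fin 3 → En n → ℝ)
      (β : ℝ → ℝ) (α : Fin n → ℝ → ℝ) (q : ℍ[ℝ]),
      p ∈ Φ.source ∧ Φ p = 0 ∧ IsAdaptedChart g L Φ f fc β α q ∧
      ((∀ a : Fin 3, ∃ v : TangentSpace 𝓘(ℝ, En n) p,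
        ⟪secondFFAt L p v v, imUnit a • diffAt L p v⟫_ℝ ≠ 0) → q = 1) ∧
      ((∃ j, j ≠ 0 ∧ α j 0 ≠ 0) → ∀ x ∈ Φ.target, 0 < α 1 (x 0)) := by
  obtain ⟨Φ, hΦ, hpΦ, hΦp, U, b, N, ν, hU, hUc, h0U, hUT, hR, hb, hN0⟩ :=
    exists_isRankOneGraph hn hflat hL hH hT p
  have h1 : (1 : Fin n) ≠ 0 := fin_one_ne_zero (by omega)
  obtain ⟨q, hq, hqν, hq1⟩ : ∃ q : ℍ[ℝ], ‖q‖ = 1 ∧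
      (∀ a, imComp (q * ν 0 * star q) a ≠ 0) ∧
      ((∀ a : Fin 3, ∃ v : TangentSpace 𝓘(ℝ, En n) p,
        ⟪secondFFAt L p v v, imUnit a • diffAt L p v⟫_ℝ ≠ 0) → q = 1) := by
    by_cases hP : ∀ a : Fin 3, ∃ v : TangentSpace 𝓘(ℝ, En n) p,
        ⟪secondFFAt L p v v, imUnit a • diffAt L p v⟫_ℝ ≠ 0
    -- Here ⟨h(v, v), a·DL v⟩ = θ(v)³ν_a for each imaginary unit a. If none of the three cubic forms
    -- is zero, then ν already has three nonzero components and no rotation is needed.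
    · refine ⟨1, norm_one, fun a ha => ?_, fun _ => rfl⟩
      rw [one_mul, star_one, mul_one] at ha
      obtain ⟨v, hv⟩ := hP a
      obtain ⟨A, hA, hAff⟩ := exists_chart_vectors hL.smooth hΦ (hUT h0U)
        (by rw [← hΦp, Φ.left_inv hpΦ] : Φ.symm 0 = p)
      have hfr : IsQFrame b := isQFrame_of_inner
        (fun i j => by rw [← hb i, hR.graph 0 h0U]; simp [eq_comm])
        fun a i j => by rw [← hb, ← hb, hR.lagrangian 0 h0U]
      refine hv ?_
      have h2 : diffAt L p v = ∑ i, A v i • b i := by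
        have h3 : A v = ∑ i, A v i • coordVec i := by
          ext j
          simp [Finset.sum_apply, Pi.single_apply]
        rw [← hA]
        conv_lhs => rw [h3]
        simp only [map_sum, map_smul, hb]
      rw [← hAff, hR.secondFF_eq 0 h0U, h2, hN0, inner_smul_left, Finset.smul_sum, inner_sum,
        Finset.sum_eq_zero, mul_zero]
      intro i _
      rw [smul_comm, inner_smul_right, hfr.inner_smul]
      split_ifs with h3
      · have h4 := hfr.comp_inner (ν := ν 0) a 0
        rw [hfr.inner_smul, if_pos rfl, ha] at h4
        rw [h4, mul_zero]
      · exact mul_zero _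
    · obtain ⟨q, hq, hqν⟩ := exists_conj_imComp_ne_zero (hR.re_ν 0 h0U) (hR.ν_ne_zero 0 h0U)
      exact ⟨q, hq, hqν, fun h => absurd h hP⟩
  have hFd : DifferentiableAt ℝ (L ∘ Φ.symm) 0 :=
    (hR.smooth.contDiffAt (hU.mem_nhds h0U)).differentiableAt (by simp)
  obtain ⟨X, f, fc, β, α, h0X, hX0, hXU, hXs, hXs', hd, hLf, hα⟩ :=
    (hR.smul hU hq).exists_twisted_coordinates hU hUc h0U
      (fun i => by rw [fderiv_quat_smul hFd, hb]) (by simp only [hN0]) hqν h1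
  have htgt : (Φ.trans X.symm).target = X.source := by
    rw [OpenPartialHomeomorph.trans_target]
    exact inter_eq_left.2 fun x hx => hUT (hXU (X.map_source hx))
  have hatlas : Φ.trans X.symm ∈ IsManifold.maximalAtlas 𝓘(ℝ, En n) ∞ M :=
    trans_mem_maximalAtlas hΦ hXs' hXs
  have h0t : (0 : En n) ∈ X.target := hX0 ▸ X.map_source h0X
  refine ⟨Φ.trans X.symm, f, fc, β, α, q, ?_, ?_, ⟨⟨hatlas, fun x hx i j => ?_⟩, ?_, hq, ?_⟩, hq1,
    ?_⟩
  · rw [OpenPartialHomeomorph.trans_source]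
    exact ⟨hpΦ, by rw [mem_preimage, hΦp]; exact h0t⟩
  · change X.symm (Φ p) = 0
    rw [hΦp, ← hX0, X.left_inv h0X, hX0]
  · have hxd : DifferentiableAt ℝ (L ∘ (Φ.trans X.symm).symm) x :=
      ((contDiffOn_comp_symm hL.smooth hatlas).contDiffAt
        ((Φ.trans X.symm).open_target.mem_nhds hx)).differentiableAt (by simp)
    -- Left multiplication by q is an isometry, so L and qL induce the same metric.
    rw [metricCoeff_eq hL hatlas hx, ← inner_smul_smul_of_norm hq, ← fderiv_quat_smul hxd,
      ← fderiv_quat_smul hxd]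
    exact hLf.isometric x (htgt ▸ hx) i j
  · rw [htgt]; exact hd
  · rw [htgt]; exact hLf
  · rw [htgt]; exact hα

end FlatUmbilical

end

/-! ### Assembly of parts (a) and (b) -/

theorem theorem3p1 (n : ℕ) [NeZero n] :
    -- (a) existence, and uniqueness up to rigid motions
    (∀ (T : Set (En n)) (f : En n → ℝ) (fc : Fin 3 → En n → ℝ) (β : ℝ → ℝ) (α : Fin n → ℝ → ℝ),
      IsTwistingData T f fc β α →
        ∃ F : En n → Hn n, IsLf T f fc F ∧
          ∀ F' : En n → Hn n, IsLf T f fc F' →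
            ∃ (A : Hn n ≃ₗᵢ[ℍ[ℝ]] Hn n) (c : Hn n), ∀ x ∈ T, F' x = A (F x) + c) ∧
    -- (b) the converse for flat manifolds, with the explicit formulas
    (3 ≤ n → ∀ (M : Type*) [TopologicalSpace M] [ChartedSpace (En n) M]
      [IsManifold 𝓘(ℝ, En n) ∞ M] (g : SmoothMetric n M) (L : M → Hn n),
      IsFlat g → IsLagrangianIsometricImmersion g L → IsHUmbilical g L →
      NoTotallyGeodesicPoint L →
        -- adapted coordinates centred at any given point
        (∀ p : M, ∃ (Φ : OpenPartialHomeomorph M (En n)) (f : En n → ℝ) (fc : Fin 3 → En n → ℝ)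
          (β : ℝ → ℝ) (α : Fin n → ℝ → ℝ) (q : ℍ[ℝ]),
          p ∈ Φ.source ∧ Φ p = 0 ∧ IsAdaptedChart g L Φ f fc β α q ∧
          ((∀ a : Fin 3, ∃ v : TangentSpace 𝓘(ℝ, En n) p,
            ⟪secondFFAt L p v v, imUnit a • diffAt L p v⟫_ℝ ≠ 0) → q = 1) ∧
          ((∃ j, j ≠ 0 ∧ α j 0 ≠ 0) → ∀ x ∈ Φ.target, 0 < α 1 (x 0))) ∧
        -- the explicit formulas in arbitrary adapted coordinates
        (∀ (Φ : OpenPartialHomeomorph M (En n)) (f : En n → ℝ) (fc : Fin 3 → En n → ℝ)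
          (β : ℝ → ℝ) (α : Fin n → ℝ → ℝ) (q : ℍ[ℝ]), IsAdaptedChart g L Φ f fc β α q →
          -- (i)
          ((∀ x ∈ Φ.target, ∀ j, j ≠ 0 → α j (x 0) = 0) →
            ∃ (D : ℝ → Hn n) (c : Fin n → Hn n),
              IsLagrangianCylinder Φ.target (fun x => L (Φ.symm x)) D c) ∧
          -- (ii)
          ((∀ x ∈ Φ.target, α 1 (x 0) ≠ 0) →
            ∀ o ∈ (fun x : En n => x 0) '' Φ.target,
            ∃ (Ψ : OpenPartialHomeomorph M (En n)) (b : ℝ → ℝ) (a : Fin n → ℝ → ℝ)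
              (z : ℝ → Hn n) (P : Fin n → ℝ → Hn n) (c : Hn n) (S : Set ℝ),
              Ψ.source = Φ.source ∧ S = (fun u : En n => u 0) '' Ψ.target ∧
              (∀ y ∈ Φ.source, Ψ y 0 = ∫ s in o..(Φ y 0), α 1 s) ∧
              (∀ y ∈ Φ.source, ∀ j, j ≠ 0 → Ψ y j = Φ y j) ∧
              ContDiffOn ℝ ∞ b S ∧
              (∀ j, j ≠ 0 → j ≠ 1 → ContDiffOn ℝ ∞ (a j) S) ∧
              IsTwistedChart g Ψ
                (fun u => b (u 0) + u 1 + ∑ j ∈ (Finset.univ.erase 0).erase 1, a j (u 0) * u j) ∧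
              IsSpecialLegendre S z P ∧
              ∀ u ∈ Ψ.target, L (Ψ.symm u) =
                u 1 • z (u 0) + (∑ j ∈ (Finset.univ.erase 0).erase 1, u j • P j (u 0))
                  + (∫ s in (0 : ℝ)..(u 0), b s • deriv z s) + c))) := by
  refine ⟨fun T f fc β α hd => hd.exists_isLf, fun hn M _ _ _ g L hflat hL hH hT =>
    ⟨fun p => exists_isAdaptedChart hn hflat hL hH hT p, fun Φ f fc β α q h =>
      ⟨fun hα => h.exists_isLagrangianCylinder hα, fun hα o ho =>
        h.exists_isSpecialLegendre hL (fin_one_ne_zero (by omega)) hα ho⟩⟩⟩
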